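/- **Setting.** Let $\mu$ be a probability measure on $T$, $K:T\times T\to\mathbb R$ bimeasurable, $R(s)=\operatorname{ess\,sup}_{t}|K(t,s)|<\infty$ for $\mu$-almost every $s$, and $$d(t,s)=\operatorname{ess\,sup}_{x}\frac{|K(t,x)-K(s,x)|}{R(x)}$$ (essential suprema with respect to $\mu$). Assume that $d$ is finite and $(T,d)$ is compact, that $d$-open sets are measurable, that $t\mapsto K(t,x)$ is $d$-continuous for $\mu$-almost every $x$, and that $f:T\to\mathbb R$ is $d$-continuous. Put $\psi_R(p)=\big(\int R^p\,d\mu\big)^{1/p}$ and assume $\psi_R(b)<\infty$ for some $b>2$. Let $S[g](t)=\int K(t,s)g(s)\,\mu(ds)$ and $U[g](t)=\int K(t,s)^2g(s)\,\mu(ds)$ on $C(T,d)$ with the sup norm $\|\cdot\|$, let $r_m(U)=\|U^m\|$, and assume that the spectral radius of $U$ is less than $1$. Let $\epsilon\in(0,1)$ and let $N=N(\epsilon)\ge 0$ be an integer with $\sum_{m>N}\|S^m[f]\|<\epsilon$. Put $$y^{(N)}=f+\sum_{m=1}^N S^m[f],\qquad \theta(m)=\frac{\sqrt{r_m(U)}}{\sqrt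 m\,\sum_{k=1}^N\sqrt{k\,r_k(U)}}\quad(0/0=0),\qquad n(m)=1+\lfloor\theta(m)n\rfloor .$$ Let $\xi^{(m)}_{l,i}$ $(1\le m\le N,\ l\ge1,\ 1\le i\le m)$ be independent with distribution $\mu$, and let $$y^{(N)}_{\hat n}(t)=f(t)+\sum_{m=1}^N\frac1{n(m)}\sum_{l=1}^{n(m)}K(t,\xi^{(m)}_{l,1})\,K(\xi^{(m)}_{l,1},\xi^{(m)}_{l,2})\cdots K(\xi^{(m)}_{l,m-1},\xi^{(m)}_{l,m})\,f(\xi^{(m)}_{l,m}),$$ $$\overline{\mathbf Q}(u)=\sup_{n\ge1}\mathbf P\Big(\sqrt n\,\sup_{t\in T}\big|y^{(N)}_{\hat n}(t)-y^{(N)}(t)\big|>u\Big).$$ Let $H(T,d,x)$ be the logarithm of the least number of closed $d$-balls of radius $x$ covering $T$, and $$\hat v(z)=\inf_{0<y<1,\ \psi_R(1/y)<\infty}\Big[zy+\log\frac{\psi_R(1/y)^N}{y\log(1+1/y)}\Big],\qquad \hat I(\epsilon)=\int_0^1\exp\big(\hat v(H(T,d,x))\big)\,dx .$$ Fix $C_0>0$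 and put $\psi_{(N)}(p)=C_0^{-1}\,p\,\psi_R(p)^N/\log p$ for $p\ge2$. For a function $\psi$ on $[2,\infty)$ with values in $[0,\infty]$ put $w^*_\psi(z)=\sup\{pz-p\log\psi(p):\ p\ge2,\ \psi(p)<\infty\}$. **Theorem 6.2.a.** (1) If $\psi_R(1)>0$ and $\hat I(\epsilon)<\infty$, then for all $u>0$ $$\overline{\mathbf Q}(u)\le\exp\Big(-w^*_{\psi_{(N)}}\Big(\log\frac{C^{-1}u}{1+\hat I(\epsilon)}\Big)\Big),$$ where the constant $C\in(0,\infty)$ depends only on $C_0$, $N$, $r_1(U),\dots,r_N(U)$, on upper bounds for $\|f\|$ and for the $d$-diameter of $T$, and on a positive lower bound for $\psi_R(1)$. (2) Suppose that $T$ is a bounded subset of $\mathbb R^k$, $C_2,C_3>0$, $\beta\ge0$, $$\mu\{x:R(x)>u\}\le\exp(-C_2u^{1/\beta})\quad(u\ge1)$$ (for $\beta=0$ this is understood as $R\le C_2$ $\mu$-almost everywhere), and $$d(t,s)\le C_3\min\big(|\log|t-s||^{-\gamma},1\big)\quad(t\ne s),\qquad \gamma>\tilde\beta:=\beta N+1 .$$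 Then $\hat I(\epsilon)<\infty$ and $$\overline{\mathbf Q}(u)\le\exp\big(-C_4u^{1/\tilde\beta}\big),\qquad u\ge u_0,$$ where $C_4>0$ and $u_0\ge1$ depend only on $C_2,C_3,\beta,\gamma,k,N$, $r_1(U),\dots,r_N(U)$ and on upper bounds for $\|f\|$ and for $\sup_{t\in T}|t|$. -/

import Mathlib

open MeasureTheory ProbabilityTheory Filter Topology Set
open scoped ENNReal NNReal

universe u v

namespace FredholmMC

section Kernel

/-- The envelope `R(s) = ess sup_t |K(t,s)|`. -/
noncomputable def envelope {T : Type u} [MeasurableSpace T] (μ : Measure T) (K : T → T → ℝ)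
    (s : T) : ℝ≥0∞ :=
  essSup (fun t => ‖K t s‖ₑ) μ

/-- The natural semi-distance `d(t,s) = ess sup_x |K(t,x) - K(s,x)| / R(x)`, with values in
`[0,∞]`; here `0 / 0 = 0` and `a / 0 = ∞` for `a > 0`. -/
noncomputable def naturalDist {T : Type u} [MeasurableSpace T] (μ : Measure T) (K : T → T → ℝ)
    (t s : T) : ℝ≥0∞ :=
  essSup (fun x => ‖K t x - K s x‖ₑ / envelope μ K x) μ

/-- The moment function `ψ_R(p) = (∫ R(x)^p μ(dx))^{1/p}`. -/
noncomputable def psiR {T : Type u} [MeasurableSpace T] (μ : Measure T) (K : T → T → ℝ)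
    (p : ℝ) : ℝ≥0∞ :=
  (∫⁻ x, envelope μ K x ^ p ∂μ) ^ (1 / p)

/-- The integral operator with kernel `k`: `g ↦ (t ↦ ∫ k(t,s) g(s) μ(ds))`. -/
noncomputable def kernelOp {T : Type u} [MeasurableSpace T] (μ : Measure T) (k : T → T → ℝ)
    (g : T → ℝ) (t : T) : ℝ :=
  ∫ s, k t s * g s ∂μ

/-- The norm, in `[0,∞]`, of the `m`-th power of the integral operator with kernel `k`, as an
operator on the space of continuous functions with the sup norm. -/
noncomputable def powNorm {T : Type u} [PseudoMetricSpace T] [CompactSpace T] [MeasurableSpace T]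
    (μ : Measure T) (k : T → T → ℝ) (m : ℕ) : ℝ≥0∞ :=
  ⨆ g : C(T, ℝ), ⨆ _ : ‖g‖ ≤ 1, ⨆ t : T, ‖(kernelOp μ k)^[m] (⇑g) t‖ₑ

/-- The spectral radius `limsup_m ‖L^m‖^{1/m}` of the integral operator `L` with kernel `k`. -/
noncomputable def specRadius {T : Type u} [PseudoMetricSpace T] [CompactSpace T]
    [MeasurableSpace T] (μ : Measure T) (k : T → T → ℝ) : ℝ≥0∞ :=
  limsup (fun m : ℕ => powNorm μ k m ^ (1 / (m : ℝ))) atTop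

/-- The kernel `K²` of the operator `U = S^{(2)}`. -/
def sqKernel {T : Type u} (K : T → T → ℝ) (t s : T) : ℝ := K t s ^ 2

/-- `r_m(U) = ‖U^m‖`. -/
noncomputable def rU {T : Type u} [PseudoMetricSpace T] [CompactSpace T] [MeasurableSpace T]
    (μ : Measure T) (K : T → T → ℝ) (m : ℕ) : ℝ :=
  (powNorm μ (sqKernel K) m).toReal

/-- The setting: the given semi-metric of the compact space `T` is the natural
semi-distance of the kernel `K`, the kernel is bimeasurable, and so on. -/
structure Setting {T : Type u} [PseudoMetricSpace T] [CompactSpace T] [MeasurableSpace T]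
    (μ : Measure T) (K : T → T → ℝ) (f : T → ℝ) : Prop where
  measurable_kernel : Measurable (Function.uncurry K)
  envelope_lt_top : ∀ᵐ x ∂μ, envelope μ K x < ∞
  edist_eq : ∀ t s : T, edist t s = naturalDist μ K t s
  continuous_kernel : ∀ᵐ x ∂μ, Continuous fun t => K t x
  continuous_f : Continuous f
  exists_moment : ∃ b : ℝ, 2 < b ∧ psiR μ K b < ∞
  specRadius_lt_one : specRadius μ (sqKernel K) < 1

end Kernel

section Estimator

/-- The remainder `∑_{m > N} ‖S^m[f]‖` of the Neumann series, in `[0,∞]`. -/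
noncomputable def neumannTail {T : Type u} [MeasurableSpace T] (μ : Measure T) (K : T → T → ℝ)
    (f : T → ℝ) (N : ℕ) : ℝ≥0∞ :=
  ∑' j : ℕ, ⨆ t : T, ‖(kernelOp μ K)^[N + 1 + j] f t‖ₑ

/-- The truncated Neumann series `y^{(N)} = f + ∑_{m=1}^N S^m[f]`. -/
noncomputable def yTrunc {T : Type u} [MeasurableSpace T] (μ : Measure T) (K : T → T → ℝ)
    (f : T → ℝ) (N : ℕ) (t : T) : ℝ :=
  f t + ∑ m ∈ Finset.Icc 1 N, (kernelOp μ K)^[m] f t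

/-- `K(t,x_0) K(x_0,x_1) ⋯ K(x_{m-2},x_{m-1}) f(x_{m-1})`, for `m ≥ 1`. -/
def pathKernel {T : Type u} (K : T → T → ℝ) (f : T → ℝ) (m : ℕ) (t : T) (x : ℕ → T) : ℝ :=
  K t (x 0) * (∏ i ∈ Finset.range (m - 1), K (x i) (x (i + 1))) * f (x (m - 1))

/-- `ξ m l i` is the `i`-th coordinate of the `l`-th random `m`-tuple; all these variables are
independent with distribution `μ`. -/
structure IsSample {T : Type u} [MeasurableSpace T] (μ : Measure T) {Ω : Type v}
    [MeasurableSpace Ω] (P : Measure Ω) (ξ : ℕ → ℕ → ℕ → Ω → T) : Prop where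
  measurable : ∀ m l i, Measurable (ξ m l i)
  law : ∀ m l i, P.map (ξ m l i) = μ
  indep : iIndepFun (fun a : ℕ × ℕ × ℕ => ξ a.1 a.2.1 a.2.2) P

/-- The Monte-Carlo approximation of `S^m[f](t)` by `k` random `m`-tuples, the same tuples being
used for all `t`. -/
noncomputable def mcPower {T : Type u} {Ω : Type v} (K : T → T → ℝ) (f : T → ℝ)
    (ξ : ℕ → ℕ → ℕ → Ω → T) (m k : ℕ) (t : T) (ω : Ω) : ℝ :=
  (k : ℝ)⁻¹ * ∑ l ∈ Finset.range k, pathKernel K f m t (fun i => ξ m l i ω)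

/-- `θ(m) = r_m(U)^{1/2} / (√m ∑_{k=1}^N k^{1/2} r_k(U)^{1/2})`
(zero when all the `r_k(U)`, `k ≤ N`, vanish). -/
noncomputable def theta {T : Type u} [PseudoMetricSpace T] [CompactSpace T] [MeasurableSpace T]
    (μ : Measure T) (K : T → T → ℝ) (N m : ℕ) : ℝ :=
  √(rU μ K m) / ((∑ k ∈ Finset.Icc 1 N, √(k : ℝ) * √(rU μ K k)) * √(m : ℝ))

/-- The number `n(m) = 1 + [θ(m) n]` of random `m`-tuples. -/
noncomputable def sampleSize {T : Type u} [PseudoMetricSpace T] [CompactSpace T]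
    [MeasurableSpace T] (μ : Measure T) (K : T → T → ℝ) (N n m : ℕ) : ℕ :=
  1 + ⌊theta μ K N m * (n : ℝ)⌋₊

/-- The estimator `y^{(N)}_{n̂}(t) = f(t) + ∑_{m=1}^N S^m_{n(m)}[f](t)`. -/
noncomputable def yMC {T : Type u} [PseudoMetricSpace T] [CompactSpace T] [MeasurableSpace T]
    {Ω : Type v} (μ : Measure T) (K : T → T → ℝ) (f : T → ℝ) (ξ : ℕ → ℕ → ℕ → Ω → T)
    (N n : ℕ) (t : T) (ω : Ω) : ℝ :=
  f t + ∑ m ∈ Finset.Icc 1 N, mcPower K f ξ m (sampleSize μ K N n m) t ω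

/-- `sup_{n ≥ 1} P(√n sup_t |y^{(N)}_{n̂}(t) - y^{(N)}(t)| > u)`. -/
noncomputable def Qbar {T : Type u} [PseudoMetricSpace T] [CompactSpace T] [MeasurableSpace T]
    {Ω : Type v} [MeasurableSpace Ω] (μ : Measure T) (K : T → T → ℝ) (f : T → ℝ) (P : Measure Ω)
    (ξ : ℕ → ℕ → ℕ → Ω → T) (N : ℕ) (u : ℝ) : ℝ≥0∞ :=
  ⨆ n : ℕ, ⨆ _ : 1 ≤ n,
    P {ω | ENNReal.ofReal u <
      ⨆ t : T, ENNReal.ofReal (√(n : ℝ) * |yMC μ K f ξ N n t ω - yTrunc μ K f N t|)}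

end Estimator

section Entropy

/-- The metric entropy `H(T,d,x) = log N(T,d,x)`, where `N(T,d,x)` is the least number of closed
balls of radius `x` that cover `T` (finite for `x > 0`, `T` being compact). -/
noncomputable def entropy (T : Type u) [PseudoMetricSpace T] (x : ℝ) : ℝ :=
  Real.log ((Metric.coveringNumber x.toNNReal (Set.univ : Set T)).toNat : ℝ)

/-- `v̂_{ψ,m}(x) = inf { x y + log (ψ(1/y)^m / (y log(1 + 1/y))) : 0 < y < 1, ψ(1/y) < ∞ }`. -/
noncomputable def vHat (ψ : ℝ → ℝ≥0∞) (m : ℕ) (x : ℝ) : EReal :=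
  ⨅ y : ℝ, ⨅ _ : y ∈ Set.Ioo (0 : ℝ) 1 ∧ ψ (1 / y) < ∞,
    ((x * y : ℝ) : EReal) +
      ENNReal.log (ψ (1 / y) ^ m / ENNReal.ofReal (y * Real.log (1 + 1 / y)))

/-- The entropy integral `Î = ∫_0^1 exp(v̂_{ψ_R,N}(H(T,d,x))) dx`, in `[0,∞]`. -/
noncomputable def IHat {T : Type u} [PseudoMetricSpace T] [MeasurableSpace T] (μ : Measure T)
    (K : T → T → ℝ) (N : ℕ) : ℝ≥0∞ :=
  ∫⁻ x in Set.Ioc (0 : ℝ) 1, EReal.exp (vHat (psiR μ K) N (entropy T x))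

/-- `ψ_{(N)}(p) = C₀⁻¹ p ψ(p)^N / log p`, for `p ≥ 2`. -/
noncomputable def psiN (C₀ : ℝ) (ψ : ℝ → ℝ≥0∞) (N : ℕ) (p : ℝ) : ℝ≥0∞ :=
  ENNReal.ofReal (C₀⁻¹ * p / Real.log p) * ψ p ^ N

/-- The Young-Fenchel transform `w*_ψ(z) = sup { p z - p log ψ(p) : p ≥ 2, ψ(p) < ∞ }` of the
function `w_ψ(p) = p log ψ(p)`. -/
noncomputable def wStar (ψ : ℝ → ℝ≥0∞) (z : ℝ) : EReal :=
  ⨆ p : ℝ, ⨆ _ : 2 ≤ p ∧ ψ p < ∞, ((p * z : ℝ) : EReal) - (p : EReal) * ENNReal.log (ψ p)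

end Entropy

section Example

/-- `μ{R > u} ≤ exp(-C₂ u^{1/β})` for all `u ≥ 1`; by convention, for `β = 0` this means that the
envelope `R` is essentially bounded by `C₂`. -/
def EnvelopeTail {T : Type u} [MeasurableSpace T] (μ : Measure T) (K : T → T → ℝ)
    (β C₂ : ℝ) : Prop :=
  (0 < β ∧ ∀ u : ℝ, 1 ≤ u → μ {x | ENNReal.ofReal u < envelope μ K x} ≤
      ENNReal.ofReal (Real.exp (-C₂ * u ^ (1 / β)))) ∨
    (β = 0 ∧ ∀ᵐ x ∂μ, envelope μ K x ≤ ENNReal.ofReal C₂)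

/-- `d(t,s) ≤ C₃ min(|log|t-s||^{-γ}, 1)` for `t ≠ s`, where `ι` places `T` in `ℝ^k`. Powers are
taken in `[0,∞]`, so that the minimum is `1` when `|t-s| = 1`. -/
def LogModulus {T : Type u} [MeasurableSpace T] (μ : Measure T) (K : T → T → ℝ)
    {k : ℕ} (ι : T → EuclideanSpace ℝ (Fin k)) (γ C₃ : ℝ) : Prop :=
  ∀ t s : T, t ≠ s → naturalDist μ K t s ≤
    ENNReal.ofReal C₃ * min (ENNReal.ofReal |Real.log ‖ι t - ι s‖| ^ (-γ)) 1

end Example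

end FredholmMC

namespace FredholmMC

/-! ### A Marcinkiewicz–Zygmund inequality for real exponents `p ≥ 2` -/

section MomentInequality

/-! The normalized error `W_n(t) = √n (y_n(t) - y(t))` is a sum over `m ≤ N` of centred averages of
`n(m) ≥ θ(m) n` independent path kernels. A Marcinkiewicz–Zygmund inequality with constant of order
`√q` (`eLpNorm'_sum_range_le_sqrt`) bounds each term in `L^q` by `√q` times the `L^q` norm of one
path kernel, uniformly in `n`. A path kernel is dominated by a constant times `R(ξ_1) ⋯ R(ξ_m)`, so
by independence its norm is at most a constant times `ψ_R(q)^m`. In the increment from `t` to `s`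
only the first factor changes, and it changes by at most `d(t,s) R(ξ_1)`. Hence `W_n` is bounded by
some `ρ(q)` in `L^q`, and Lipschitz for `d` with the same constant (`eLpNorm'_scaledError_le`,
`eLpNorm'_scaledError_sub_le`).

Chaining over dyadic nets (`exists_chaining_bound`) then bounds the `p`-norm of `sup_t |W_n(t)|`.
The maximum over a net of `N(x)` points may be estimated in any `L^q` with `q ≥ p`, at the price
`N(x)^{1/q} ρ(q)`, and `q` may be chosen separately at each scale. The result is `5 ∫_0^1 inf_{q ≥
p} N(x)^{1/q} ρ(q) dx`, and Markov's inequality gives `Qbar_le_chainBound`.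

For the general bound, `√q` is at most a multiple of `q / log (1 + q)`, and with `y = 1/q` the
integrand is at most a constant times `ψ_{(N)}(p) exp(v̂(H(x)))` (`chainBound_le_exp_vHat`).
Minimizing the Markov bound over `p` is the Young–Fenchel transform.

In the example the tail of `R` gives `ψ_R(p) ≤ A p^β`, and the logarithmic modulus gives `H(x) ≤ a
x^{-1/γ}`. Taking `q = p a x^{-1/γ}` makes `N(x)^{1/q} ≤ e` and leaves the integral of `x^{-β̃/γ}`,
finite because `β̃ < γ`. The tail is then at most `(C p^{β̃} / u)^p`, and `p` is chosen so that the
base is `1/e`. -/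

/-- Bernoulli's inequality for `(a / c)^r`, multiplied by `c^r`. -/
lemma rpow_sub_rpow_le {r a c : ℝ} (hr : 1 ≤ r) (ha : 0 ≤ a) (hac : a ≤ c) :
    c ^ r - a ^ r ≤ r * c ^ (r - 1) * (c - a) := by
  rcases eq_or_lt_of_le (ha.trans hac) with hc | hc
  · have : a = 0 := le_antisymm (hc ▸ hac) ha
    subst hc; subst this; simp
  have h := one_add_mul_self_le_rpow_one_add (s := a / c - 1)
    (by have := div_nonneg ha hc.le; linarith) hr
  have h1 : 1 + (a / c - 1) = a / c := by ring
  rw [h1, Real.div_rpow ha hc.le] at h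
  have hcr : 0 < c ^ r := Real.rpow_pos_of_pos hc r
  rw [le_div_iff₀ hcr] at h
  have h2 : c ^ (r - 1) = c ^ r / c := Real.rpow_sub_one hc.ne' r
  rw [h2]
  have h3 : r * (c ^ r / c) * (c - a) = r * c ^ r * (1 - a / c) := by field_simp
  rw [h3]
  nlinarith

lemma abs_rpow_mul_self_of_nonneg {p x : ℝ} (hp : 2 ≤ p) (hx : 0 ≤ x) :
    |x| ^ (p - 2) * x = x ^ (p - 1) := by
  rw [abs_of_nonneg hx]
  nth_rw 2 [← Real.rpow_one x]
  rw [← Real.rpow_add_of_nonneg hx (by linarith) zero_le_one]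
  congr 1; ring

lemma signed_rpow_sub_le_of_nonneg {p M a c : ℝ} (hp : 2 ≤ p) (ha : 0 ≤ a) (hac : a ≤ c)
    (hc : c ≤ M) : |c| ^ (p - 2) * c - |a| ^ (p - 2) * a ≤ (p - 1) * M ^ (p - 2) * (c - a) := by
  rw [abs_rpow_mul_self_of_nonneg hp ha, abs_rpow_mul_self_of_nonneg hp (ha.trans hac)]
  refine (rpow_sub_rpow_le (by linarith) ha hac).trans ?_
  have : p - 1 - 1 = p - 2 := by ring
  rw [this]
  have := Real.rpow_le_rpow (ha.trans hac) hc (by linarith : 0 ≤ p - 2)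
  have h1 : 0 ≤ c - a := by linarith
  gcongr
  linarith

/-- The function `|x|^(p-2) x` is the derivative of `|x|^p / p`. Its Lipschitz bound replaces a
second derivative in the Taylor estimate. Opposite signs are handled by passing through `0`, two
negative arguments by oddness. -/
lemma signed_rpow_sub_le {p M a c : ℝ} (hp : 2 ≤ p) (hac : a ≤ c) (ha : |a| ≤ M)
    (hc : |c| ≤ M) : |c| ^ (p - 2) * c - |a| ^ (p - 2) * a ≤ (p - 1) * M ^ (p - 2) * (c - a) := by
  rcases le_total 0 a with h | h
  · exact signed_rpow_sub_le_of_nonneg hp h hac ((le_abs_self c).trans hc)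
  rcases le_total 0 c with h' | h'
  · have h1 := signed_rpow_sub_le_of_nonneg hp le_rfl h' ((le_abs_self c).trans hc)
    have h2 := signed_rpow_sub_le_of_nonneg hp le_rfl (neg_nonneg.2 h) ((neg_le_abs a).trans ha)
    rw [abs_neg] at h2
    simp only [mul_zero, sub_zero, mul_neg] at h1 h2
    rw [mul_sub]
    linarith
  · have h2 := signed_rpow_sub_le_of_nonneg hp (neg_nonneg.2 h') (neg_le_neg hac)
      ((neg_le_abs a).trans ha)
    simp only [abs_neg, mul_neg] at h2
    convert h2 using 1 <;> ring

/-- Second order Taylor bound for `|x|^p`, `p ≥ 2`. -/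
lemma abs_add_rpow_le {p : ℝ} (hp : 2 ≤ p) (a b : ℝ) :
    |a + b| ^ p ≤ |a| ^ p + p * (|a| ^ (p - 2) * a * b) +
      p * (p - 1) * (b ^ 2 * (|a| + |b|) ^ (p - 2)) := by
  have hd : ∀ x : ℝ, HasDerivAt (fun x => |x| ^ p) (p * |x| ^ (p - 2) * x) x :=
    fun x => hasDerivAt_abs_rpow x (by linarith)
  have hcont : Continuous fun x : ℝ => |x| ^ p :=
    continuous_iff_continuousAt.2 fun x => (hd x).continuousAt
  have hp0 : 0 < p := by linarith
  rcases lt_trichotomy b 0 with hb | hb | hb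
  · obtain ⟨c, hc, h⟩ := exists_hasDerivAt_eq_slope (fun x => |x| ^ p) _
      (show a + b < a by linarith) hcont.continuousOn fun x _ => hd x
    have hcM : |c| ≤ |a| + |b| := abs_le.2 ⟨by linarith [hc.1, neg_abs_le a, neg_abs_le b],
      by linarith [hc.2, le_abs_self a, abs_nonneg b]⟩
    have h2 := signed_rpow_sub_le hp hc.2.le hcM
      (by linarith [abs_nonneg b] : |a| ≤ |a| + |b|)
    rw [eq_div_iff (by linarith)] at h
    have hM : 0 ≤ (|a| + |b|) ^ (p - 2) := by positivity
    have h3 : (p - 1) * (|a| + |b|) ^ (p - 2) * (a - c) ≤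
        (p - 1) * (|a| + |b|) ^ (p - 2) * (-b) := by
      apply mul_le_mul_of_nonneg_left (by linarith [hc.1])
      exact mul_nonneg (by linarith) hM
    have h4 := mul_le_mul_of_nonneg_left (h2.trans h3) (mul_nonneg hp0.le (neg_nonneg.2 hb.le))
    nlinarith
  · subst hb; simp
  · obtain ⟨c, hc, h⟩ := exists_hasDerivAt_eq_slope (fun x => |x| ^ p) _
      (show a < a + b by linarith) hcont.continuousOn fun x _ => hd x
    have hcM : |c| ≤ |a| + |b| := abs_le.2 ⟨by linarith [hc.1, neg_abs_le a, abs_nonneg b],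
      by linarith [hc.2, le_abs_self a, le_abs_self b]⟩
    have h2 := signed_rpow_sub_le hp hc.1.le (by linarith [abs_nonneg b] : |a| ≤ |a| + |b|) hcM
    rw [eq_div_iff (by linarith)] at h
    have hM : 0 ≤ (|a| + |b|) ^ (p - 2) := by positivity
    have h3 : (p - 1) * (|a| + |b|) ^ (p - 2) * (c - a) ≤
        (p - 1) * (|a| + |b|) ^ (p - 2) * b := by
      apply mul_le_mul_of_nonneg_left (by linarith [hc.2])
      exact mul_nonneg (by linarith) hM
    have h4 := mul_le_mul_of_nonneg_left (h2.trans h3) (mul_nonneg hp0.le hb.le)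
    nlinarith

/-- The induction step for the sum bound `s = 2z√(pk)`. For `k ≥ p` the ratio `z/s = 1/(2√(pk))` is
at most `1/(2p)`, so `(1 + z/s)^(p-2) ≤ e^{1/2} ≤ 2`. Since `z² = s²/(4pk)`, the second-order term
is then at most `s^p p/(2k)`, which is the growth that Bernoulli's inequality provides in `(1 +
1/k)^(p/2)`. -/
lemma moment_step_bound {p z : ℝ} (hp : 2 ≤ p) (hz : 0 ≤ z) {k : ℕ} (hk : p ≤ k) :
    (2 * z * √(p * k)) ^ p + p * (p - 1) * (z ^ 2 * (2 * z * √(p * k) + z) ^ (p - 2)) ≤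
      (2 * z * √(p * (k + 1 : ℕ))) ^ p := by
  have hk0 : (0 : ℝ) < k := by linarith
  have hq : 0 < √(p * k) := Real.sqrt_pos.2 (by positivity)
  have hsq : √(p * k) ^ 2 = p * k := Real.sq_sqrt (by positivity)
  set s := 2 * z * √(p * k) with hs
  have hs0 : 0 ≤ s := by positivity
  have hpq : p ≤ √(p * k) := Real.le_sqrt_of_sq_le (by nlinarith)
  have h1 : s + z = s * (1 + 1 / (2 * √(p * k))) := by rw [hs]; field_simp
  have h2 : (1 + 1 / (2 * √(p * k))) ^ (p - 2) ≤ 2 := by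
    calc (1 + 1 / (2 * √(p * k))) ^ (p - 2) ≤ (Real.exp (1 / (2 * √(p * k)))) ^ (p - 2) := by
          apply Real.rpow_le_rpow (by positivity) _ (by linarith)
          rw [add_comm]; exact Real.add_one_le_exp _
      _ = Real.exp (1 / (2 * √(p * k)) * (p - 2)) := by rw [← Real.exp_mul]
      _ ≤ Real.exp (1 / 2) := by
          apply Real.exp_le_exp.2
          rw [one_div_mul_eq_div, div_le_iff₀ (by positivity)]
          linarith
      _ ≤ 2 := by
          rw [← Real.le_log_iff_exp_le (by norm_num)]
          linarith [Real.log_two_gt_d9]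
  have h3 : s ^ p = s ^ 2 * s ^ (p - 2) := by
    rw [← Real.rpow_natCast s 2, ← Real.rpow_add_of_nonneg hs0 (by norm_num) (by linarith)]
    congr 1; push_cast; ring
  have h4 : z ^ 2 = s ^ 2 / (4 * p * k) := by
    rw [hs, mul_pow, mul_pow, hsq]; field_simp; norm_num
  have h5 : z ^ 2 * (s + z) ^ (p - 2) ≤ s ^ p / (2 * p * k) := by
    rw [h1, Real.mul_rpow hs0 (by positivity), h4]
    have : s ^ 2 / (4 * p * k) * (s ^ (p - 2) * (1 + 1 / (2 * √(p * k))) ^ (p - 2)) ≤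
        s ^ 2 / (4 * p * k) * (s ^ (p - 2) * 2) := by gcongr
    refine this.trans (le_of_eq ?_)
    rw [h3]; field_simp; norm_num
  have h6 : √(p * (k + 1 : ℕ)) = √(p * k) * √(1 + 1 / k) := by
    rw [← Real.sqrt_mul (by positivity)]; congr 1; push_cast; field_simp
  have h7 : (2 * z * √(p * (k + 1 : ℕ))) ^ p = s ^ p * (1 + 1 / (k : ℝ)) ^ (p / 2) := by
    rw [h6, ← mul_assoc, ← hs, Real.mul_rpow hs0 (by positivity), Real.sqrt_eq_rpow,
      ← Real.rpow_mul (by positivity)]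
    congr 2; ring
  have h8 := one_add_mul_self_le_rpow_one_add (s := 1 / (k : ℝ)) (p := p / 2)
    (by have : 0 ≤ 1 / (k : ℝ) := by positivity
        linarith) (by linarith)
  rw [h7]
  have h9 : 0 ≤ s ^ p := by positivity
  calc s ^ p + p * (p - 1) * (z ^ 2 * (s + z) ^ (p - 2))
      ≤ s ^ p + p * (p - 1) * (s ^ p / (2 * p * k)) := by
        have : 0 ≤ p * (p - 1) := mul_nonneg (by linarith) (by linarith)
        gcongr
    _ ≤ s ^ p + p * p * (s ^ p / (2 * p * k)) := by
        have : 0 ≤ s ^ p / (2 * p * k) := by positivity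
        nlinarith
    _ = s ^ p * (1 + p / 2 * (1 / k)) := by field_simp
    _ ≤ _ := by gcongr

variable {Ω : Type*} [MeasurableSpace Ω] {P : Measure Ω}

lemma memLp_of_eLpNorm'_le {p c : ℝ} (hp : 0 < p) {X : Ω → ℝ} (hX : Measurable X)
    (h : eLpNorm' X p P ≤ ENNReal.ofReal c) : MemLp X (ENNReal.ofReal p) P := by
  refine ⟨hX.aestronglyMeasurable, ?_⟩
  rw [eLpNorm_eq_eLpNorm' (by simpa using hp) ENNReal.ofReal_ne_top, ENNReal.toReal_ofReal hp.le]
  exact h.trans_lt ENNReal.ofReal_lt_top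

lemma integrable_abs_rpow {p : ℝ} (hp : 0 < p) {X : Ω → ℝ} (h : MemLp X (ENNReal.ofReal p) P) :
    Integrable (fun ω => |X ω| ^ p) P := by
  have := h.integrable_norm_rpow (by simpa using hp) ENNReal.ofReal_ne_top
  simpa [ENNReal.toReal_ofReal hp.le] using this

lemma lintegral_enorm_rpow_eq {p : ℝ} (hp : 0 < p) {X : Ω → ℝ}
    (h : MemLp X (ENNReal.ofReal p) P) :
    ∫⁻ ω, ‖X ω‖ₑ ^ p ∂P = ENNReal.ofReal (∫ ω, |X ω| ^ p ∂P) := by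
  rw [ofReal_integral_eq_lintegral_ofReal (integrable_abs_rpow hp h)
    (Eventually.of_forall fun ω => by positivity)]
  refine lintegral_congr fun ω => ?_
  rw [← ENNReal.ofReal_rpow_of_nonneg (abs_nonneg _) hp.le, Real.enorm_eq_ofReal_abs]

lemma eLpNorm'_le_ofReal_iff {p c : ℝ} (hp : 0 < p) (hc : 0 ≤ c) {X : Ω → ℝ}
    (h : MemLp X (ENNReal.ofReal p) P) :
    eLpNorm' X p P ≤ ENNReal.ofReal c ↔ ∫ ω, |X ω| ^ p ∂P ≤ c ^ p := by
  rw [eLpNorm'_eq_lintegral_enorm, lintegral_enorm_rpow_eq hp h, one_div,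
    ENNReal.rpow_inv_le_iff hp, ENNReal.ofReal_rpow_of_nonneg hc hp.le,
    ENNReal.ofReal_le_ofReal_iff (by positivity)]

/-- Hölder with the weights `2/p` and `(p-2)/p`, which still makes sense at `p = 2`, together with
Minkowski for `|X| + |Y|`. -/
lemma integral_sq_mul_rpow_le {p s z : ℝ} (hp : 2 ≤ p) (hs : 0 ≤ s) (hz : 0 ≤ z) {X Y : Ω → ℝ}
    (hX : Measurable X) (hY : Measurable Y) (hXs : eLpNorm' X p P ≤ ENNReal.ofReal s)
    (hYz : eLpNorm' Y p P ≤ ENNReal.ofReal z) :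
    Integrable (fun ω => Y ω ^ 2 * (|X ω| + |Y ω|) ^ (p - 2)) P ∧
    ∫ ω, Y ω ^ 2 * (|X ω| + |Y ω|) ^ (p - 2) ∂P ≤ z ^ 2 * (s + z) ^ (p - 2) := by
  have hp0 : 0 < p := by linarith
  set W : Ω → ℝ := fun ω => |X ω| + |Y ω| with hW
  have hWm : Measurable W := (hX.abs).add hY.abs
  have hXa : eLpNorm' (fun ω => |X ω|) p P = eLpNorm' X p P :=
    eLpNorm'_congr_norm_ae (Eventually.of_forall fun ω => by simp)
  have hYa : eLpNorm' (fun ω => |Y ω|) p P = eLpNorm' Y p P :=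
    eLpNorm'_congr_norm_ae (Eventually.of_forall fun ω => by simp)
  have hWn : eLpNorm' W p P ≤ ENNReal.ofReal (s + z) := by
    rw [ENNReal.ofReal_add hs hz]
    refine (eLpNorm'_add_le hX.abs.aestronglyMeasurable hY.abs.aestronglyMeasurable
      (by linarith)).trans ?_
    rw [hXa, hYa]
    exact add_le_add hXs hYz
  have key : ∫⁻ ω, ‖Y ω ^ 2 * W ω ^ (p - 2)‖ₑ ∂P ≤
      ENNReal.ofReal (z ^ 2 * (s + z) ^ (p - 2)) := by
    have h1 : ∀ ω, ‖Y ω ^ 2 * W ω ^ (p - 2)‖ₑ =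
        (‖Y ω‖ₑ ^ p) ^ (2 / p) * (‖W ω‖ₑ ^ p) ^ ((p - 2) / p) := by
      intro ω
      have hW0 : 0 ≤ W ω := by positivity
      rw [← ENNReal.rpow_mul, ← ENNReal.rpow_mul, mul_div_cancel₀ _ hp0.ne',
        mul_div_cancel₀ _ hp0.ne', enorm_mul, enorm_pow, Real.enorm_of_nonneg (Real.rpow_nonneg hW0 (p - 2)),
        Real.enorm_of_nonneg hW0, ENNReal.ofReal_rpow_of_nonneg hW0 (by linarith)]
      congr 1
      exact (ENNReal.rpow_natCast _ 2).symm
    simp_rw [h1]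
    refine (ENNReal.lintegral_mul_norm_pow_le (by fun_prop) (by fun_prop) (by positivity)
      (div_nonneg (by linarith) hp0.le) (by field_simp; ring)).trans ?_
    rw [ENNReal.ofReal_mul (by positivity)]
    have h2 : (∫⁻ ω, ‖Y ω‖ₑ ^ p ∂P) ^ (2 / p) = eLpNorm' Y p P ^ (2 : ℝ) := by
      rw [eLpNorm'_eq_lintegral_enorm, ← ENNReal.rpow_mul]; congr 1; ring
    have h3 : (∫⁻ ω, ‖W ω‖ₑ ^ p ∂P) ^ ((p - 2) / p) = eLpNorm' W p P ^ (p - 2) := by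
      rw [eLpNorm'_eq_lintegral_enorm, ← ENNReal.rpow_mul]; congr 1; ring
    rw [h2, h3]
    refine mul_le_mul' ?_ ?_
    · rw [ENNReal.ofReal_pow hz, ← ENNReal.rpow_natCast _ 2]
      exact ENNReal.rpow_le_rpow hYz (by norm_num)
    · rw [← ENNReal.ofReal_rpow_of_nonneg (by positivity) (by linarith)]
      exact ENNReal.rpow_le_rpow hWn (by linarith)
  have hint : Integrable (fun ω => Y ω ^ 2 * W ω ^ (p - 2)) P :=
    ⟨by fun_prop, key.trans_lt ENNReal.ofReal_lt_top⟩
  refine ⟨hint, ?_⟩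
  have h0 : 0 ≤ z ^ 2 * (s + z) ^ (p - 2) := by positivity
  rw [← ENNReal.ofReal_le_ofReal_iff h0, ofReal_integral_eq_lintegral_ofReal hint
    (Eventually.of_forall fun ω => by simp only [hW, Pi.zero_apply]; positivity)]
  refine (lintegral_mono fun ω => ?_).trans key
  exact Real.ofReal_le_enorm _

/-- Adding an independent centred variable, `p ≥ 2`. -/
lemma integral_abs_add_rpow_le [IsProbabilityMeasure P] {p s z : ℝ} (hp : 2 ≤ p) (hs : 0 ≤ s)
    (hz : 0 ≤ z) {X Y : Ω → ℝ} (hX : Measurable X) (hY : Measurable Y)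
    (hXs : eLpNorm' X p P ≤ ENNReal.ofReal s) (hYz : eLpNorm' Y p P ≤ ENNReal.ofReal z)
    (hXY : IndepFun X Y P) (hY0 : ∫ ω, Y ω ∂P = 0) :
    ∫ ω, |X ω + Y ω| ^ p ∂P ≤ s ^ p + p * (p - 1) * (z ^ 2 * (s + z) ^ (p - 2)) := by
  have hp0 : 0 < p := by linarith
  have hXL := memLp_of_eLpNorm'_le hp0 hX hXs
  have hYL := memLp_of_eLpNorm'_le hp0 hY hYz
  have hXX := (eLpNorm'_le_ofReal_iff hp0 hs hXL).1 hXs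
  obtain ⟨hi, hle⟩ := integral_sq_mul_rpow_le hp hs hz hX hY hXs hYz
  have hp1 : 1 ≤ ENNReal.ofReal p := by
    rw [← ENNReal.ofReal_one]; exact ENNReal.ofReal_le_ofReal (by linarith)
  have hYi : Integrable Y P := hYL.integrable hp1
  have hind : IndepFun (fun ω => |X ω| ^ (p - 2) * X ω) Y P :=
    hXY.comp (φ := fun x : ℝ => |x| ^ (p - 2) * x) (ψ := id) (by fun_prop) measurable_id
  have hXi : Integrable (fun ω => |X ω| ^ (p - 2) * X ω) P := by
    have h1 : Integrable (fun ω => |X ω| ^ p + 1) P :=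
      (integrable_abs_rpow hp0 hXL).add (integrable_const _)
    refine h1.mono' (by fun_prop) (Eventually.of_forall fun ω => ?_)
    have h2 : ‖|X ω| ^ (p - 2) * X ω‖ = |X ω| ^ (p - 1) := by
      rw [norm_mul, Real.norm_of_nonneg (by positivity), Real.norm_eq_abs,
        ← abs_rpow_mul_self_of_nonneg hp (abs_nonneg (X ω)), abs_abs]
    rw [h2]
    rcases le_total |X ω| 1 with h | h
    · have := Real.rpow_le_one (abs_nonneg _) h (by linarith : 0 ≤ p - 1)
      have : 0 ≤ |X ω| ^ p := by positivity
      linarith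
    · have := Real.rpow_le_rpow_of_exponent_le h (by linarith : p - 1 ≤ p)
      linarith
  have hm : Integrable (fun ω => |X ω| ^ (p - 2) * X ω * Y ω) P := hind.integrable_mul hXi hYi
  -- The first-order Taylor term has mean zero, since `Y` is centred and independent of `X`. This is
  -- the source of the `√n` gain over the triangle inequality.
  have hm0 : ∫ ω, |X ω| ^ (p - 2) * X ω * Y ω ∂P = 0 := by
    rw [hind.integral_fun_mul_eq_mul_integral (by fun_prop) (by fun_prop), hY0, mul_zero]
  have hA := (integrable_abs_rpow hp0 hXL)
  have hB := hm.const_mul p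
  have hC := hi.const_mul (p * (p - 1))
  have hAB : Integrable (fun ω => |X ω| ^ p + p * (|X ω| ^ (p - 2) * X ω * Y ω)) P := hA.add hB
  have hsum : Integrable (fun ω => X ω + Y ω) P := (hXL.integrable hp1).add hYi
  calc ∫ ω, |X ω + Y ω| ^ p ∂P ≤ ∫ ω, (|X ω| ^ p + p * (|X ω| ^ (p - 2) * X ω * Y ω) +
      p * (p - 1) * (Y ω ^ 2 * (|X ω| + |Y ω|) ^ (p - 2))) ∂P := by
        apply integral_mono_of_nonneg (Eventually.of_forall fun ω => by simp only [Pi.zero_apply]; positivity)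
          (hAB.add hC)
        exact Eventually.of_forall fun ω => abs_add_rpow_le hp _ _
    _ = ∫ ω, |X ω| ^ p ∂P + p * (p - 1) * ∫ ω, Y ω ^ 2 * (|X ω| + |Y ω|) ^ (p - 2) ∂P := by
        rw [integral_add hAB hC, integral_add hA hB, integral_const_mul,
          integral_const_mul, hm0, mul_zero, add_zero]
    _ ≤ _ := by
        have : 0 ≤ p * (p - 1) := mul_nonneg (by linarith) (by linarith)
        gcongr

lemma eLpNorm'_sum_range_le {p : ℝ} (hp : 1 ≤ p) {z : ℝ≥0∞} {Z : ℕ → Ω → ℝ}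
    (hZ : ∀ l, Measurable (Z l)) (hz : ∀ l, eLpNorm' (Z l) p P ≤ z) (n : ℕ) :
    eLpNorm' (fun ω => ∑ l ∈ Finset.range n, Z l ω) p P ≤ n * z := by
  induction n with
  | zero => simp [eLpNorm'_eq_lintegral_enorm, show 0 < p by linarith]
  | succ n ih =>
    simp_rw [Finset.sum_range_succ]
    refine (eLpNorm'_add_le (f := fun ω => ∑ l ∈ Finset.range n, Z l ω) (g := Z n)
      (Finset.measurable_sum _ fun l _ => hZ l).aestronglyMeasurable
      (hZ n).aestronglyMeasurable hp).trans ?_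
    push_cast
    rw [add_mul, one_mul]
    exact add_le_add ih (hz n)

/-- Marcinkiewicz-Zygmund inequality for independent centred variables, with the constant
`2√p`. -/
theorem eLpNorm'_sum_range_le_sqrt [IsProbabilityMeasure P] {p z : ℝ} (hp : 2 ≤ p) (hz : 0 ≤ z)
    {Z : ℕ → Ω → ℝ} (hZ : ∀ l, Measurable (Z l))
    (hZz : ∀ l, eLpNorm' (Z l) p P ≤ ENNReal.ofReal z)
    (hind : ∀ n, IndepFun (fun ω => ∑ l ∈ Finset.range n, Z l ω) (Z n) P)
    (h0 : ∀ l, ∫ ω, Z l ω ∂P = 0) (n : ℕ) :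
    eLpNorm' (fun ω => ∑ l ∈ Finset.range n, Z l ω) p P ≤ ENNReal.ofReal (2 * z * √(p * n)) := by
  have hp0 : 0 < p := by linarith
  have hS : ∀ n, Measurable fun ω => ∑ l ∈ Finset.range n, Z l ω :=
    fun n => Finset.measurable_sum _ fun l _ => hZ l
  induction n with
  | zero => simp [eLpNorm'_eq_lintegral_enorm, hp0]
  | succ k ih =>
    -- Up to `4p` summands the triangle inequality is already good enough, since `k + 1 ≤ 2√(p(k +
    -- 1))`. Beyond that `k ≥ p`, as the Taylor step requires.
    rcases le_or_gt ((k + 1 : ℕ) : ℝ) (4 * p) with hk | hk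
    · refine (eLpNorm'_sum_range_le (by linarith) hZ hZz (k + 1)).trans ?_
      rw [← ENNReal.ofReal_natCast, ← ENNReal.ofReal_mul (by positivity)]
      apply ENNReal.ofReal_le_ofReal
      have : ((k + 1 : ℕ) : ℝ) ≤ 2 * √(p * (k + 1 : ℕ)) := by
        rw [show (2 : ℝ) = √4 by rw [show (4 : ℝ) = 2 ^ 2 by norm_num]; simp,
          ← Real.sqrt_mul (by norm_num)]
        apply Real.le_sqrt_of_sq_le
        nlinarith [(Nat.cast_nonneg (k + 1) : (0 : ℝ) ≤ (k + 1 : ℕ))]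
      nlinarith
    · have hkp : p ≤ k := by push_cast at hk; linarith
      have hm := integral_abs_add_rpow_le hp (by positivity) hz (hS k) (hZ k) ih (hZz k) (hind k)
        (h0 k)
      have hL : MemLp (fun ω => ∑ l ∈ Finset.range (k + 1), Z l ω) (ENNReal.ofReal p) P := by
        refine memLp_of_eLpNorm'_le (c := (k + 1 : ℕ) * z) hp0 (hS _) ?_
        rw [ENNReal.ofReal_mul (by positivity), ENNReal.ofReal_natCast]
        exact eLpNorm'_sum_range_le (by linarith) hZ hZz (k + 1)
      rw [eLpNorm'_le_ofReal_iff hp0 (by positivity) hL]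
      simp_rw [Finset.sum_range_succ]
      exact hm.trans (moment_step_bound hp hz hkp)

end MomentInequality

/-! ### Chaining in `L^p` and the entropy integral -/

section Chaining

/-- On the interval from `2^{-(k+2)}` to `2^{-(k+1)}` the function is at least its value at the
right end, and the length is a quarter of `2^{-k}`. This gives the factor `4`; the term `g 1` costs
one more integral. -/
lemma sum_mul_le_lintegral_of_antitone {g : ℝ → ℝ≥0∞}
    (hg : ∀ x y, 0 < x → x ≤ y → g y ≤ g x) (K : ℕ) :
    g 1 + ∑ k ∈ Finset.range K, ENNReal.ofReal ((1 / 2) ^ k) * g ((1 / 2) ^ (k + 1)) ≤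
      5 * ∫⁻ x in Ioc (0 : ℝ) 1, g x := by
  have hconst : ∀ a b : ℝ, 0 < b → 0 ≤ a →
      ENNReal.ofReal (b - a) * g b ≤ ∫⁻ x in Ioc a b, g x := by
    intro a b hb ha
    calc ENNReal.ofReal (b - a) * g b = ∫⁻ _ in Ioc a b, g b := by
          rw [setLIntegral_const, Real.volume_Ioc, mul_comm]
      _ ≤ _ := setLIntegral_mono' measurableSet_Ioc fun x hx => hg x b (ha.trans_lt hx.1) hx.2
  have h1 : g 1 ≤ ∫⁻ x in Ioc (0 : ℝ) 1, g x := by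
    simpa using hconst 0 1 one_pos le_rfl
  have hpos : ∀ k : ℕ, (0 : ℝ) < (1 / 2) ^ k := fun k => by positivity
  have h2 : ∀ K : ℕ, ∑ k ∈ Finset.range K, ENNReal.ofReal ((1 / 2) ^ k) * g ((1 / 2) ^ (k + 1)) ≤
      4 * ∫⁻ x in Ioc ((1 / 2 : ℝ) ^ (K + 1)) (1 / 2), g x := by
    intro K
    induction K with
    | zero => simp
    | succ K ih =>
      have hle : (1 / 2 : ℝ) ^ (K + 1 + 1) ≤ (1 / 2) ^ (K + 1) :=
        pow_le_pow_of_le_one (by norm_num) (by norm_num) (by omega)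
      have hle' : (1 / 2 : ℝ) ^ (K + 1) ≤ 1 / 2 := by
        simpa using pow_le_pow_of_le_one (a := (1 / 2 : ℝ)) (by norm_num) (by norm_num)
          (show 1 ≤ K + 1 by omega)
      rw [Finset.sum_range_succ, ← Ioc_union_Ioc_eq_Ioc hle hle',
        lintegral_union measurableSet_Ioc
          (by rw [Set.disjoint_left]; rintro x hx hx'; exact absurd hx.2 (not_le.2 hx'.1)),
        mul_add, add_comm]
      refine add_le_add ?_ ih
      have h3 : ENNReal.ofReal ((1 / 2) ^ K) =
          4 * ENNReal.ofReal ((1 / 2) ^ (K + 1) - (1 / 2) ^ (K + 1 + 1)) := by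
        rw [show (4 : ℝ≥0∞) = ENNReal.ofReal 4 by simp, ← ENNReal.ofReal_mul (by norm_num)]
        congr 1; ring
      rw [h3, mul_assoc]
      gcongr
      exact hconst _ _ (hpos _) (hpos _).le
  have h3 : ∫⁻ x in Ioc ((1 / 2 : ℝ) ^ (K + 1)) (1 / 2), g x ≤ ∫⁻ x in Ioc (0 : ℝ) 1, g x :=
    lintegral_mono_set (Ioc_subset_Ioc (hpos _).le (by norm_num))
  calc _ ≤ (∫⁻ x in Ioc (0 : ℝ) 1, g x) + 4 * ∫⁻ x in Ioc (0 : ℝ) 1, g x := by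
        refine add_le_add h1 ((h2 K).trans ?_)
        gcongr
    _ = _ := by ring

/-- The covering number as a natural number. -/
noncomputable def coverCard (T : Type u) [PseudoMetricSpace T] (x : ℝ) : ℕ :=
  (Metric.coveringNumber x.toNNReal (Set.univ : Set T)).toNat

variable {T : Type u} [PseudoMetricSpace T]

lemma coveringNumber_univ_ne_top [CompactSpace T] {x : ℝ} (hx : 0 < x) :
    Metric.coveringNumber x.toNNReal (Set.univ : Set T) ≠ ⊤ := by
  obtain ⟨N, hN, hfin, hc⟩ := Metric.exists_finite_isCover_of_isCompact
    (ε := x.toNNReal) (by simpa using hx) (isCompact_univ (X := T))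
  exact ((hc.coveringNumber_le_encard hN).trans_lt hfin.encard_lt_top).ne

lemma exists_finset_cover [CompactSpace T] {x : ℝ} (hx : 0 < x) :
    ∃ C : Finset T, C.card = coverCard T x ∧ ∀ t, ∃ s ∈ C, edist t s ≤ ENNReal.ofReal x := by
  obtain ⟨C, -, hfin, hc, hcard⟩ :=
    Metric.exists_set_encard_eq_coveringNumber (coveringNumber_univ_ne_top (T := T) hx)
  refine ⟨hfin.toFinset, ?_, fun t => ?_⟩
  · rw [coverCard, ← hcard, hfin.encard_eq_coe_toFinset_card]; rfl
  · obtain ⟨s, hs, hts⟩ := hc (Set.mem_univ t)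
    exact ⟨s, by simpa using hs, hts⟩

lemma coverCard_anti [CompactSpace T] {x y : ℝ} (hx : 0 < x) (hxy : x ≤ y) : coverCard T y ≤ coverCard T x :=
  ENat.toNat_le_toNat (Metric.coveringNumber_anti (Real.toNNReal_le_toNNReal hxy))
    (coveringNumber_univ_ne_top hx)

lemma one_le_coverCard [CompactSpace T] [Nonempty T] {x : ℝ} (hx : 0 < x) : 1 ≤ coverCard T x := by
  obtain ⟨C, hC, h⟩ := exists_finset_cover (T := T) hx
  obtain ⟨s, hs, -⟩ := h (Classical.arbitrary T)
  rw [← hC]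
  exact Finset.card_pos.2 ⟨s, hs⟩

variable {Ω : Type v} [MeasurableSpace Ω] {P : Measure Ω}

/-- The `q`-th power of a maximum is at most the sum of the `q`-th powers. -/
lemma eLpNorm'_finset_sup_le {ι : Type*} {q : ℝ} (hq : 0 < q) (S : Finset ι) {V : ι → Ω → ℝ}
    (hV : ∀ i, Measurable (V i)) {a : ℝ≥0∞} (ha : ∀ i ∈ S, eLpNorm' (V i) q P ≤ a) :
    eLpNorm' (fun ω => S.sup fun i => ‖V i ω‖ₑ) q P ≤ (S.card : ℝ≥0∞) ^ (1 / q) * a := by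
  have h1 : ∀ ω, (S.sup fun i => ‖V i ω‖ₑ) ^ q ≤ ∑ i ∈ S, ‖V i ω‖ₑ ^ q := by
    intro ω
    rcases S.eq_empty_or_nonempty with rfl | hS
    · simp [hq]
    · obtain ⟨i, hi, he⟩ := Finset.exists_mem_eq_sup S hS fun i => ‖V i ω‖ₑ
      rw [he]
      exact Finset.single_le_sum (f := fun i => ‖V i ω‖ₑ ^ q) (fun _ _ => zero_le) hi
  rw [eLpNorm'_eq_lintegral_enorm]
  calc (∫⁻ ω, ‖S.sup fun i => ‖V i ω‖ₑ‖ₑ ^ q ∂P) ^ (1 / q)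
      ≤ (∑ _i ∈ S, a ^ q) ^ (1 / q) := by
        refine ENNReal.rpow_le_rpow ?_ (by positivity)
        refine (lintegral_mono (g := fun ω => ∑ i ∈ S, ‖V i ω‖ₑ ^ q) fun ω => ?_).trans
          ((lintegral_finsetSum S fun i _ => (hV i).enorm.pow_const q).le.trans
            (Finset.sum_le_sum fun i hi => ?_))
        · simp only [enorm_eq_self]; exact h1 ω
        · have := ha i hi
          rw [eLpNorm'_eq_lintegral_enorm, one_div, ENNReal.rpow_inv_le_iff hq] at this
          exact this
    _ = _ := by
        rw [Finset.sum_const, nsmul_eq_mul, ENNReal.mul_rpow_of_nonneg _ _ (by positivity),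
          ← ENNReal.rpow_mul, mul_one_div_cancel hq.ne', ENNReal.rpow_one]

/-- The bound for the maximum of `N(T,d,x)` variables, optimized over the exponents `q ≥ p`,
when their `q`-norms are at most `ρ q`. -/
noncomputable def chainBound (T : Type u) [PseudoMetricSpace T] (ρ : ℝ → ℝ≥0∞) (p x : ℝ) : ℝ≥0∞ :=
  ⨅ q : ℝ, ⨅ _ : p ≤ q, (coverCard T x : ℝ≥0∞) ^ (1 / q) * ρ q

lemma chainBound_anti [CompactSpace T] {ρ : ℝ → ℝ≥0∞} {p x y : ℝ} (hp : 0 < p) (hx : 0 < x)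
    (hxy : x ≤ y) : chainBound T ρ p y ≤ chainBound T ρ p x := by
  refine iInf_mono fun q => iInf_mono fun hq => ?_
  have : 0 < q := hp.trans_le hq
  gcongr
  exact coverCard_anti hx hxy

lemma measurable_finset_sup_enorm {ι : Type*} (S : Finset ι) {V : ι → Ω → ℝ}
    (hV : ∀ i, Measurable (V i)) : Measurable fun ω => S.sup fun i => ‖V i ω‖ₑ := by
  classical
  induction S using Finset.induction_on with
  | empty => simp
  | insert a s ha ih =>
    simp only [Finset.sup_insert]
    exact (hV a).enorm.sup ih

/-- On a probability space the `p`-norm is at most every `q`-norm with `q ≥ p`, so the bound for a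
maximum may be used at the best `q`. -/
lemma eLpNorm'_finset_sup_le_chainBound [IsProbabilityMeasure P] {ι : Type*} 
    {ρ : ℝ → ℝ≥0∞} {p x δ : ℝ} (hp : 0 < p) (hδ : 0 < δ) (S : Finset ι)
    (hS : S.card = coverCard T x) {V : ι → Ω → ℝ} (hV : ∀ i, Measurable (V i))
    (h : ∀ q, p ≤ q → ∀ i ∈ S, eLpNorm' (V i) q P ≤ ENNReal.ofReal δ * ρ q) :
    eLpNorm' (fun ω => S.sup fun i => ‖V i ω‖ₑ) p P ≤
      ENNReal.ofReal δ * chainBound T ρ p x := by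
  have hδ0 : ENNReal.ofReal δ ≠ 0 := by simpa using hδ
  rw [chainBound, ENNReal.mul_iInf_of_ne hδ0 ENNReal.ofReal_ne_top]
  refine le_iInf fun q => ?_
  rw [ENNReal.mul_iInf_of_ne hδ0 ENNReal.ofReal_ne_top]
  refine le_iInf fun hq => ?_
  refine (eLpNorm'_le_eLpNorm'_of_exponent_le hp hq P
    (measurable_finset_sup_enorm S hV).aestronglyMeasurable).trans ?_
  refine (eLpNorm'_finset_sup_le (hp.trans_le hq) S hV (h q hq)).trans ?_
  rw [hS, mul_left_comm]

/-- Chaining in the spaces `L^p`: an almost sure bound for the supremum of a process with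
continuous paths, with control of its `p`-norm by an entropy integral. -/
theorem exists_chaining_bound [CompactSpace T] [IsProbabilityMeasure P] {ρ : ℝ → ℝ≥0∞} {p : ℝ}
    (hp : 1 ≤ p) {W : T → Ω → ℝ} (hW : ∀ t, Measurable (W t))
    (hcont : ∀ᵐ ω ∂P, Continuous fun t => W t ω)
    (h0 : ∀ q, p ≤ q → ∀ t, eLpNorm' (W t) q P ≤ ρ q)
    (h1 : ∀ q, p ≤ q → ∀ t s,
      eLpNorm' (fun ω => W t ω - W s ω) q P ≤ edist t s * ρ q) :
    ∃ B : Ω → ℝ≥0∞, Measurable B ∧ (∀ᵐ ω ∂P, ∀ t, ‖W t ω‖ₑ ≤ B ω) ∧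
      eLpNorm' B p P ≤ 5 * ∫⁻ x in Ioc (0 : ℝ) 1, chainBound T ρ p x := by
  have hp0 : 0 < p := by linarith
  have hpos : ∀ k : ℕ, (0 : ℝ) < (1 / 2) ^ k := fun k => by positivity
  choose C hC hcov using fun k : ℕ => exists_finset_cover (T := T) (hpos k)
  choose π hπ hπd using hcov
  set base : Ω → ℝ≥0∞ := fun ω => (C 0).sup fun s => ‖W s ω‖ₑ with hbase
  -- Links start only at the points of the finer net, so level `k` has `N(2^{-(k+1)})` increments,
  -- each over a distance of at most `2^{-k}`.
  set link : ℕ → Ω → ℝ≥0∞ := fun k ω => (C (k + 1)).sup fun s => ‖W s ω - W (π k s) ω‖ₑ with hlink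
  have hbm : Measurable base := measurable_finset_sup_enorm _ hW
  have hlm : ∀ k, Measurable (link k) := fun k =>
    measurable_finset_sup_enorm (V := fun s ω => W s ω - W (π k s) ω) _
      fun s => (hW s).sub (hW _)
  set B : ℕ → Ω → ℝ≥0∞ := fun K ω => base ω + ∑ k ∈ Finset.range K, link k ω with hB
  have hBm : ∀ K, Measurable (B K) := fun K =>
    hbm.add (Finset.measurable_sum _ fun k _ => hlm k)
  have hnet : ∀ ω K, ∀ s ∈ C K, ‖W s ω‖ₑ ≤ B K ω := by
    intro ω K
    induction K with
    | zero =>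
      intro s hs
      simp only [hB, hbase, Finset.range_zero, Finset.sum_empty, add_zero]
      exact Finset.le_sup (f := fun s => ‖W s ω‖ₑ) hs
    | succ K ih =>
      intro s hs
      have e1 : ‖W s ω‖ₑ ≤ ‖W (π K s) ω‖ₑ + ‖W s ω - W (π K s) ω‖ₑ := by
        have := enorm_add_le (W (π K s) ω) (W s ω - W (π K s) ω)
        rwa [add_sub_cancel] at this
      have e2 := ih _ (hπ K s)
      have e3 : ‖W s ω - W (π K s) ω‖ₑ ≤ link K ω :=
        Finset.le_sup (f := fun s => ‖W s ω - W (π K s) ω‖ₑ) hs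
      refine e1.trans ((add_le_add e2 e3).trans (le_of_eq ?_))
      simp only [hB, Finset.sum_range_succ, add_assoc]
  have hmono : ∀ ω, Monotone fun K => B K ω := fun ω => monotone_nat_of_le_succ fun K => by
    simp only [hB, Finset.sum_range_succ, ← add_assoc]
    exact le_self_add
  have hBnorm : ∀ K, eLpNorm' (B K) p P ≤ 5 * ∫⁻ x in Ioc (0 : ℝ) 1, chainBound T ρ p x := by
    intro K
    refine le_trans ?_ (sum_mul_le_lintegral_of_antitone
      (fun x y hx hxy => chainBound_anti hp0 hx hxy) K)
    have e0 : eLpNorm' base p P ≤ chainBound T ρ p 1 := by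
      have := eLpNorm'_finset_sup_le_chainBound (P := P) (ρ := ρ) (p := p) (x := 1)
        (δ := 1) hp0 one_pos (C 0) (by simpa using hC 0) hW
        (fun q hpq t _ => by simpa using h0 q hpq t)
      simpa using this
    have e1 : ∀ k, eLpNorm' (link k) p P ≤
        ENNReal.ofReal ((1 / 2) ^ k) * chainBound T ρ p ((1 / 2) ^ (k + 1)) := fun k =>
      eLpNorm'_finset_sup_le_chainBound (V := fun s ω => W s ω - W (π k s) ω) hp0 (hpos k) _
        (hC (k + 1)) (fun s => (hW s).sub (hW _)) fun q hpq s _ =>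
        (h1 q hpq s (π k s)).trans (by gcongr; exact hπd k s)
    refine (eLpNorm'_add_le (f := base) (g := fun ω => ∑ k ∈ Finset.range K, link k ω)
      hbm.aestronglyMeasurable
      (Finset.measurable_sum _ fun k _ => hlm k).aestronglyMeasurable hp).trans ?_
    refine add_le_add e0 ?_
    induction K with
    | zero => simp [eLpNorm'_eq_lintegral_enorm, hp0]
    | succ K ih =>
      simp_rw [Finset.sum_range_succ]
      exact (eLpNorm'_add_le (f := fun ω => ∑ k ∈ Finset.range K, link k ω) (g := link K)
        (Finset.measurable_sum _ fun k _ => hlm k).aestronglyMeasurable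
        (hlm K).aestronglyMeasurable hp).trans (add_le_add ih (e1 K))
  refine ⟨fun ω => ⨆ K, B K ω, Measurable.iSup hBm, ?_, ?_⟩
  · filter_upwards [hcont] with ω hω t
    -- The nets control only countably many points. Continuity of the path carries the bound to
    -- every `t`.
    have hlim : Tendsto (fun k => π k t) atTop (𝓝 t) := by
      rw [tendsto_iff_edist_tendsto_0]
      have h2 : Tendsto (fun k : ℕ => ENNReal.ofReal ((1 / 2) ^ k)) atTop (𝓝 0) := by
        have := (tendsto_pow_atTop_nhds_zero_of_lt_one (r := (1 / 2 : ℝ)) (by norm_num)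
          (by norm_num))
        have h := (ENNReal.continuous_ofReal.tendsto 0).comp this
        rwa [ENNReal.ofReal_zero] at h
      refine tendsto_of_tendsto_of_tendsto_of_le_of_le tendsto_const_nhds h2
        (fun _ => zero_le) fun k => ?_
      rw [edist_comm]
      exact hπd k t
    have hlim2 : Tendsto (fun k => ‖W (π k t) ω‖ₑ) atTop (𝓝 ‖W t ω‖ₑ) :=
      ((continuous_enorm.comp hω).tendsto t).comp hlim
    exact le_of_tendsto' hlim2 fun k =>
      (hnet ω k _ (hπ k t)).trans (le_iSup (fun K => B K ω) k)
  · rw [eLpNorm'_eq_lintegral_enorm, one_div, ENNReal.rpow_inv_le_iff hp0]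
    -- The partial bounds increase with the level and their norms are bounded uniformly, so monotone
    -- convergence applies.
    have e : ∀ ω, ‖⨆ K, B K ω‖ₑ ^ p = ⨆ K, B K ω ^ p := fun ω =>
      (ENNReal.orderIsoRpow p hp0).map_iSup _
    simp_rw [e]
    rw [lintegral_iSup (fun K => (hBm K).pow_const p)
      fun i j hij ω => ENNReal.rpow_le_rpow (hmono ω hij) hp0.le]
    refine iSup_le fun K => ?_
    have := hBnorm K
    rw [eLpNorm'_eq_lintegral_enorm, one_div, ENNReal.rpow_inv_le_iff hp0] at this
    exact this

lemma measure_lt_le_of_eLpNorm'_le {p u : ℝ} (hp : 0 < p) (hu : 0 < u) {B : Ω → ℝ≥0∞}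
    (hB : Measurable B) {b : ℝ≥0∞} (hb : eLpNorm' B p P ≤ b) :
    P {ω | ENNReal.ofReal u < B ω} ≤ (b / ENNReal.ofReal u) ^ p := by
  have hu0 : ENNReal.ofReal u ≠ 0 := by simpa using hu
  rw [eLpNorm'_eq_lintegral_enorm, one_div, ENNReal.rpow_inv_le_iff hp] at hb
  calc P {ω | ENNReal.ofReal u < B ω} ≤ P {ω | ENNReal.ofReal u ^ p ≤ B ω ^ p} :=
        measure_mono fun ω hω => ENNReal.rpow_le_rpow (le_of_lt hω) hp.le
    _ ≤ (∫⁻ ω, B ω ^ p ∂P) / ENNReal.ofReal u ^ p :=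
        meas_ge_le_lintegral_div (hB.pow_const p).aemeasurable
          (by simp [hu0, hp]) (by simp [hp.le])
    _ ≤ b ^ p / ENNReal.ofReal u ^ p := by gcongr; exact hb
    _ = _ := (ENNReal.div_rpow_of_nonneg _ _ hp.le).symm

end Chaining

/-! ### Measurability of the envelope and domination of iterated operators -/

section KernelFacts

variable {T : Type u} [MeasurableSpace T] {μ : Measure T} {K : T → T → ℝ}

/-- `R(x) > c` exactly when the section `{t : |K(t,x)| > c}` has positive measure, and the measure
of a section depends measurably on `x`. -/
lemma measurable_envelope [SFinite μ] (hK : Measurable (Function.uncurry K)) :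
    Measurable (envelope μ K) := by
  refine measurable_of_Ioi fun c => ?_
  have hset : MeasurableSet {p : T × T | c < ‖K p.2 p.1‖ₑ} :=
    measurableSet_lt measurable_const (hK.comp measurable_swap).enorm
  have h : envelope μ K ⁻¹' Ioi c =
      {x | μ (Prod.mk x ⁻¹' {p : T × T | c < ‖K p.2 p.1‖ₑ}) ≠ 0} := by
    ext x
    simp only [mem_preimage, mem_Ioi, mem_ofPred_eq, preimage_ofPred_eq]
    rw [← not_iff_not, not_lt, not_not]
    constructor
    · intro hle
      have : ∀ᵐ t ∂μ, ‖K t x‖ₑ ≤ c := by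
        filter_upwards [ENNReal.ae_le_essSup (μ := μ) fun t => ‖K t x‖ₑ] with t ht
        exact ht.trans hle
      simpa [ae_iff] using this
    · intro h0
      exact essSup_le_of_ae_le c (by simpa [EventuallyLE, ae_iff] using h0)
  rw [h]
  exact (measurable_measure_prodMk_left hset) (measurableSet_singleton 0).compl

lemma psiR_eq_eLpNorm' (p : ℝ) : psiR μ K p = eLpNorm' (envelope μ K) p μ := by
  simp [psiR, eLpNorm'_eq_lintegral_enorm]

lemma psiR_mono [IsProbabilityMeasure μ] (hK : Measurable (Function.uncurry K)) {p q : ℝ}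
    (hp : 0 < p) (hpq : p ≤ q) : psiR μ K p ≤ psiR μ K q := by
  rw [psiR_eq_eLpNorm', psiR_eq_eLpNorm']
  exact eLpNorm'_le_eLpNorm'_of_exponent_le hp hpq μ (measurable_envelope hK).aestronglyMeasurable

lemma lintegral_envelope_rpow {p : ℝ} (hp : 0 < p) :
    ∫⁻ x, envelope μ K x ^ p ∂μ = psiR μ K p ^ p := by
  rw [psiR, ← ENNReal.rpow_mul, one_div_mul_cancel hp.ne', ENNReal.rpow_one]

lemma enorm_kernelOp_le {k : T → T → ℝ} {E : T → ℝ≥0∞} (hE : Measurable E)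
    (hkE : ∀ᵐ x ∂μ, ∀ t, ‖k t x‖ₑ ≤ E x) {g : T → ℝ} {a : ℝ≥0∞} (hg : ∀ t, ‖g t‖ₑ ≤ a) (t : T) :
    ‖kernelOp μ k g t‖ₑ ≤ (∫⁻ x, E x ∂μ) * a := by
  rw [kernelOp, ← lintegral_mul_const _ hE]
  refine (enorm_integral_le_lintegral_enorm _).trans (lintegral_mono_ae ?_)
  filter_upwards [hkE] with x hx
  rw [enorm_mul]
  exact mul_le_mul' (hx t) (hg x)

lemma enorm_iterate_kernelOp_le {k : T → T → ℝ} {E : T → ℝ≥0∞} (hE : Measurable E)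
    (hkE : ∀ᵐ x ∂μ, ∀ t, ‖k t x‖ₑ ≤ E x) {g : T → ℝ} {a : ℝ≥0∞} (hg : ∀ t, ‖g t‖ₑ ≤ a) (m : ℕ)
    (t : T) : ‖(kernelOp μ k)^[m] g t‖ₑ ≤ (∫⁻ x, E x ∂μ) ^ m * a := by
  induction m generalizing g a with
  | zero => simpa using hg t
  | succ m ih =>
    rw [Function.iterate_succ_apply, pow_succ, mul_assoc]
    exact ih (enorm_kernelOp_le hE hkE hg)

lemma measurable_kernelOp [SFinite μ] {k : T → T → ℝ} (hk : Measurable (Function.uncurry k))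
    {g : T → ℝ} (hg : Measurable g) : Measurable (kernelOp μ k g) := by
  have : StronglyMeasurable (Function.uncurry fun t s => k t s * g s) :=
    (hk.mul (hg.comp measurable_snd)).stronglyMeasurable
  exact this.integral_prod_right.measurable

lemma measurable_sqKernel (hK : Measurable (Function.uncurry K)) :
    Measurable (Function.uncurry (sqKernel K)) := hK.pow_const 2

end KernelFacts

/-! ### Pointwise bounds for the kernel from the natural distance -/

section Setting

lemma dist_le_diam_univ {T : Type u} [PseudoMetricSpace T] [CompactSpace T] (t s : T) :
    dist t s ≤ Metric.diam (Set.univ : Set T) :=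
  Metric.dist_le_diam_of_mem isCompact_univ.isBounded trivial trivial

variable {T : Type u} [PseudoMetricSpace T] [CompactSpace T] [MeasurableSpace T]
  {μ : Measure T} {K : T → T → ℝ} {f : T → ℝ}

/-- The definition of `d` gives the inequality off a null set that depends on the pair `(t,s)`.
Restricting to a countable dense set leaves one null set; off it, continuity of `K(·,x)` extends the
inequality to all pairs. -/
lemma Setting.ae_enorm_sub_le (h : Setting μ K f) :
    ∀ᵐ x ∂μ, ∀ t s, ‖K t x - K s x‖ₑ ≤ edist t s * envelope μ K x := by
  obtain ⟨S, hSc, hSd⟩ := TopologicalSpace.exists_countable_dense T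
  have h1 : ∀ᵐ x ∂μ, ∀ t ∈ S, ∀ s ∈ S, ‖K t x - K s x‖ₑ / envelope μ K x ≤ edist t s := by
    refine (ae_ball_iff hSc).2 fun t _ => (ae_ball_iff hSc).2 fun s _ => ?_
    rw [h.edist_eq]
    exact ENNReal.ae_le_essSup _
  filter_upwards [h1, h.envelope_lt_top, h.continuous_kernel] with x hx hR hc
  have hclosed : IsClosed {p : T × T | ‖K p.1 x - K p.2 x‖ₑ ≤ edist p.1 p.2 * envelope μ K x} := by
    refine isClosed_le ?_ ((ENNReal.continuous_mul_const hR.ne).comp (by fun_prop))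
    exact ((hc.comp continuous_fst).sub (hc.comp continuous_snd)).enorm
  have hsub : S ×ˢ S ⊆ {p : T × T | ‖K p.1 x - K p.2 x‖ₑ ≤ edist p.1 p.2 * envelope μ K x} := by
    rintro ⟨t, s⟩ ⟨ht, hs⟩
    -- The case `R(x) = 0` is allowed: `d(t,s)` is finite, so the convention `a / 0 = ∞` for `a > 0`
    -- forces the numerator to vanish.
    exact (ENNReal.div_le_iff_le_mul (Or.inr (edist_ne_top t s)) (Or.inl hR.ne)).1 (hx t ht s hs)
  intro t s
  have hmem : (t, s) ∈ closure (S ×ˢ S) := by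
    rw [(hSd.prod hSd).closure_eq]; trivial
  exact hclosed.closure_subset_iff.2 hsub hmem

/-- The essential supremum bounds `K(s,x)` for almost every `s` only. From one such `s` any `t` is
reached at the cost `d(t,s) R(x) ≤ D R(x)`, whence the factor `1 + D`. -/
lemma Setting.ae_enorm_le [IsProbabilityMeasure μ] (h : Setting μ K f) {D : ℝ}
    (hD : ∀ t s : T, dist t s ≤ D) :
    ∀ᵐ x ∂μ, ∀ t, ‖K t x‖ₑ ≤ ENNReal.ofReal (1 + D) * envelope μ K x := by
  filter_upwards [h.ae_enorm_sub_le] with x hx t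
  obtain ⟨s, hs⟩ := (ENNReal.ae_le_essSup (μ := μ) fun t => ‖K t x‖ₑ).exists
  have hD0 : 0 ≤ D := dist_nonneg.trans (hD t t)
  have e1 : ‖K t x‖ₑ ≤ ‖K s x‖ₑ + ‖K t x - K s x‖ₑ := by
    have := enorm_add_le (K s x) (K t x - K s x)
    rwa [add_sub_cancel] at this
  refine e1.trans ?_
  rw [ENNReal.ofReal_add zero_le_one hD0, add_mul, ENNReal.ofReal_one, one_mul]
  refine add_le_add hs ((hx t s).trans ?_)
  gcongr
  rw [edist_dist]
  exact ENNReal.ofReal_le_ofReal (hD t s)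

lemma Setting.psiR_two_lt_top [IsProbabilityMeasure μ] (h : Setting μ K f) :
    psiR μ K 2 < ∞ := by
  obtain ⟨b, hb, hlt⟩ := h.exists_moment
  exact (psiR_mono h.measurable_kernel two_pos hb.le).trans_lt hlt

lemma Setting.ae_enorm_sqKernel_le [IsProbabilityMeasure μ] (h : Setting μ K f) {D : ℝ}
    (hD : ∀ t s : T, dist t s ≤ D) :
    ∀ᵐ x ∂μ, ∀ t, ‖sqKernel K t x‖ₑ ≤ (ENNReal.ofReal (1 + D) * envelope μ K x) ^ 2 := by
  filter_upwards [h.ae_enorm_le hD] with x hx t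
  rw [sqKernel, enorm_pow]
  exact pow_le_pow_left' (hx t) 2

lemma Setting.lintegral_sq_envelope_lt_top [IsProbabilityMeasure μ] (h : Setting μ K f) (c : ℝ) :
    ∫⁻ x, (ENNReal.ofReal c * envelope μ K x) ^ 2 ∂μ < ∞ := by
  have hm := measurable_envelope (μ := μ) h.measurable_kernel
  simp_rw [mul_pow]
  rw [lintegral_const_mul _ (hm.pow_const 2)]
  refine ENNReal.mul_lt_top (by simp) ?_
  have := lintegral_envelope_rpow (μ := μ) (K := K) two_pos
  simp only [ENNReal.rpow_ofNat] at this
  rw [this]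
  exact ENNReal.pow_lt_top h.psiR_two_lt_top

/-- Finiteness makes `rU` faithful: `r_m(U) = 0` then means that the norm of `U^m` vanishes, not
that it is infinite and was sent to `0` by `toReal`. -/
lemma Setting.powNorm_lt_top [IsProbabilityMeasure μ] (h : Setting μ K f) (m : ℕ) :
    powNorm μ (sqKernel K) m < ∞ := by
  have hm : Measurable fun x => (ENNReal.ofReal (1 + Metric.diam (Set.univ : Set T)) *
      envelope μ K x) ^ 2 := by
    have := measurable_envelope (μ := μ) h.measurable_kernel
    fun_prop
  refine lt_of_le_of_lt ?_ (ENNReal.pow_lt_top (n := m)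
    (h.lintegral_sq_envelope_lt_top (1 + Metric.diam (Set.univ : Set T))))
  refine iSup_le fun g => iSup_le fun hg => iSup_le fun t => ?_
  have := enorm_iterate_kernelOp_le hm (h.ae_enorm_sqKernel_le dist_le_diam_univ) (g := g) (a := 1)
    (fun t => by
      rw [← ofReal_norm, ← ENNReal.ofReal_one]
      exact ENNReal.ofReal_le_ofReal ((g.norm_coe_le_norm t).trans hg)) m t
  simpa using this

lemma Setting.iterate_sqKernel_one_eq_zero [IsProbabilityMeasure μ] (h : Setting μ K f) {m : ℕ}
    (hm : rU μ K m = 0) (t : T) : (kernelOp μ (sqKernel K))^[m] (fun _ => 1) t = 0 := by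
  have h0 : powNorm μ (sqKernel K) m = 0 := by
    rcases (ENNReal.toReal_eq_zero_iff _).1 hm with h0 | h0
    · exact h0
    · exact absurd h0 (h.powNorm_lt_top m).ne
  have h1 : ‖(kernelOp μ (sqKernel K))^[m] (⇑(1 : C(T, ℝ))) t‖ₑ ≤ powNorm μ (sqKernel K) m :=
    le_iSup_of_le (1 : C(T, ℝ)) (le_iSup_of_le (by
      refine (ContinuousMap.norm_le _ zero_le_one).2 fun x => by simp)
      (le_iSup (fun t => ‖(kernelOp μ (sqKernel K))^[m] (⇑(1 : C(T, ℝ))) t‖ₑ) t))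
  rw [h0, nonpos_iff_eq_zero, enorm_eq_zero] at h1
  exact h1

end Setting

/-! ### Path kernels along independent sequences -/

section Paths

lemma pathKernel_succ {T : Type u} {k : T → T → ℝ} {g : T → ℝ} (j : ℕ) (t : T) (x : ℕ → T) :
    pathKernel k g (j + 1) t x =
      k t (x 0) * (∏ i ∈ Finset.range j, k (x i) (x (i + 1))) * g (x j) := rfl

lemma pathKernel_congr {T : Type u} {k : T → T → ℝ} {g : T → ℝ} {j : ℕ} {t : T} {x y : ℕ → T}
    (h : ∀ i ≤ j, x i = y i) : pathKernel k g (j + 1) t x = pathKernel k g (j + 1) t y := by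
  rw [pathKernel_succ, pathKernel_succ, h 0 (Nat.zero_le _), h j le_rfl]
  congr 2
  refine Finset.prod_congr rfl fun i hi => ?_
  have := Finset.mem_range.1 hi
  rw [h i (by omega), h (i + 1) (by omega)]

/-- The head `v` is kept apart so that the same estimate serves both `K(t,x_0)` and the difference
`K(t,x_0) - K(s,x_0)`. -/
lemma enorm_path_le {T : Type u} {k : T → T → ℝ} {g : T → ℝ} {G : ℝ≥0∞} {E : T → ℝ≥0∞} {x : ℕ → T}
    (hx : ∀ i t, ‖k t (x i)‖ₑ ≤ E (x i)) (hg : ∀ t, ‖g t‖ₑ ≤ G) (v : ℝ) (j : ℕ) :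
    ‖v * (∏ i ∈ Finset.range j, k (x i) (x (i + 1))) * g (x j)‖ₑ ≤
      ‖v‖ₑ * (G * ∏ i ∈ Finset.range j, E (x (i + 1))) := by
  rw [enorm_mul, enorm_mul, mul_assoc, mul_comm G]
  refine mul_le_mul' le_rfl (mul_le_mul' ?_ (hg _))
  induction j with
  | zero => simp
  | succ j ih =>
    rw [Finset.prod_range_succ, Finset.prod_range_succ, enorm_mul]
    exact mul_le_mul' ih (hx _ _)

variable {T : Type u} [MeasurableSpace T] {μ : Measure T}
  {Ω : Type v} [MeasurableSpace Ω] {P : Measure Ω}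

lemma integral_indepFun_eq [IsProbabilityMeasure P] [SFinite μ] {S : Type*} [MeasurableSpace S]
    {Y : Ω → S}
    {Z : Ω → T} (hY : Measurable Y) (hZ : Measurable Z) (hYZ : IndepFun Y Z P)
    (hlaw : P.map Z = μ) {H : S → T → ℝ} (hH : Measurable (Function.uncurry H))
    (hint : Integrable (fun ω => H (Y ω) (Z ω)) P) :
    ∫ ω, H (Y ω) (Z ω) ∂P = ∫ ω, ∫ z, H (Y ω) z ∂μ ∂P := by
  have hm : Measurable fun ω => (Y ω, Z ω) := hY.prodMk hZ
  have hmap := (indepFun_iff_map_prod_eq_prod_map_map hY.aemeasurable hZ.aemeasurable).1 hYZ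
  rw [hlaw] at hmap
  have hint' : Integrable (Function.uncurry H) ((P.map Y).prod μ) := by
    rw [← hmap]
    exact (integrable_map_measure hH.aestronglyMeasurable hm.aemeasurable).2 hint
  have : IsProbabilityMeasure (P.map Y) := Measure.isProbabilityMeasure_map hY.aemeasurable
  calc ∫ ω, H (Y ω) (Z ω) ∂P = ∫ p, Function.uncurry H p ∂(P.map fun ω => (Y ω, Z ω)) :=
        (integral_map hm.aemeasurable hH.aestronglyMeasurable).symm
    _ = ∫ y, ∫ z, H y z ∂μ ∂(P.map Y) := by rw [hmap, integral_prod _ hint']; rfl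
    _ = _ := integral_map hY.aemeasurable
        hH.stronglyMeasurable.integral_prod_right.aestronglyMeasurable

lemma lintegral_prod_rpow [IsProbabilityMeasure P] {X : ℕ → Ω → T} (hX : ∀ i, Measurable (X i))
    (hlaw : ∀ i, P.map (X i) = μ) (hind : iIndepFun X P) {E : T → ℝ≥0∞} (hE : Measurable E)
    {q : ℝ} (hq : 0 ≤ q) (m : ℕ) :
    ∫⁻ ω, (∏ i ∈ Finset.range m, E (X i ω)) ^ q ∂P = (∫⁻ x, E x ^ q ∂μ) ^ m := by
  have h1 : iIndepFun (fun i ω => E (X i ω) ^ q) P :=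
    hind.comp (fun _ x => E x ^ q) fun _ => hE.pow_const q
  have h2 : ∀ ω, (∏ i ∈ Finset.range m, E (X i ω)) ^ q =
      ∏ i ∈ Finset.range m, E (X i ω) ^ q := fun ω =>
    (ENNReal.prod_rpow_of_nonneg hq).symm
  have h3 : ∀ i, ∫⁻ ω, E (X i ω) ^ q ∂P = ∫⁻ x, E x ^ q ∂μ := fun i => by
    rw [← hlaw i, lintegral_map (hE.pow_const q) (hX i)]
  simp_rw [h2]
  induction m with
  | zero => simp
  | succ m ih =>
    simp_rw [Finset.prod_range_succ]
    have hi : IndepFun (∏ i ∈ Finset.range m, fun ω => E (X i ω) ^ q) (fun ω => E (X m ω) ^ q) P :=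
      h1.indepFun_finsetProd_of_notMem (fun i => (hE.comp (hX i)).pow_const q) (by simp)
    have hm : ∀ i, Measurable fun ω => E (X i ω) ^ q := fun i => (hE.comp (hX i)).pow_const q
    have := lintegral_mul_eq_lintegral_mul_lintegral_of_indepFun
      (Finset.prod_induction _ Measurable (fun _ _ h h' => h.mul h') measurable_const
        fun i _ => hm i) (hm m) hi
    simp only [Pi.mul_apply, Finset.prod_apply] at this
    rw [pow_succ, ← ih fun ω => (ENNReal.prod_rpow_of_nonneg hq).symm, ← h3 m]
    exact this

lemma ae_forall_comp {X : ℕ → Ω → T} (hX : ∀ i, Measurable (X i))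
    (hlaw : ∀ i, P.map (X i) = μ) {p : T → Prop} (hp : ∀ᵐ x ∂μ, p x) :
    ∀ᵐ ω ∂P, ∀ i, p (X i ω) :=
  ae_all_iff.2 fun i => ae_of_ae_map (hX i).aemeasurable (by rwa [hlaw i])

lemma measurable_kernel_apply {k : T → T → ℝ} (hk : Measurable (Function.uncurry k)) (i j : ℕ) :
    Measurable fun x : ℕ → T => k (x i) (x j) :=
  hk.comp (g := Function.uncurry k) (f := fun x : ℕ → T => (x i, x j))
    ((measurable_pi_apply i).prodMk (measurable_pi_apply j))

lemma measurable_pathKernel {k : T → T → ℝ} (hk : Measurable (Function.uncurry k)) {g : T → ℝ}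
    (hg : Measurable g) (m : ℕ) (t : T) : Measurable (pathKernel k g m t) := by
  have h1 : Measurable fun x : ℕ → T => k t (x 0) :=
    hk.comp (measurable_const.prodMk (measurable_pi_apply 0))
  exact (h1.mul (Finset.measurable_prod _ fun i _ => measurable_kernel_apply hk i (i + 1))).mul (hg.comp (measurable_pi_apply _))

/-- The past is recorded as an infinite sequence frozen at time `j`, so that functionals of
sequences can be applied to it although it involves finitely many variables. -/
lemma indepFun_past {X : ℕ → Ω → T} (hX : ∀ i, Measurable (X i)) (hind : iIndepFun X P) (j : ℕ) :
    IndepFun (fun ω (i : ℕ) => X (min i j) ω) (X (j + 1)) P := by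
  have h := hind.indepFun_finset (Finset.range (j + 1)) {j + 1} (by simp) hX
  exact h.comp
    (φ := fun (y : Finset.range (j + 1) → T) (i : ℕ) =>
      y ⟨min i j, Finset.mem_range.2 (by omega)⟩)
    (ψ := fun (y : ({j + 1} : Finset ℕ) → T) => y ⟨j + 1, Finset.mem_singleton_self _⟩)
    (by fun_prop) (by fun_prop)

lemma integrable_pathKernel [IsProbabilityMeasure P] {X : ℕ → Ω → T} (hX : ∀ i, Measurable (X i))
    (hlaw : ∀ i, P.map (X i) = μ) (hind : iIndepFun X P) {k : T → T → ℝ}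
    (hk : Measurable (Function.uncurry k)) {E : T → ℝ≥0∞} (hE : Measurable E)
    (hkE : ∀ᵐ x ∂μ, ∀ t, ‖k t x‖ₑ ≤ E x) (hEi : ∫⁻ x, E x ∂μ < ∞) {g : T → ℝ} (hg : Measurable g)
    {G : ℝ≥0∞} (hG : G < ∞) (hgG : ∀ t, ‖g t‖ₑ ≤ G) (j : ℕ) (t : T) :
    Integrable (fun ω => pathKernel k g (j + 1) t fun i => X i ω) P := by
  refine ⟨((measurable_pathKernel hk hg _ t).comp
    (measurable_pi_iff.2 hX)).aestronglyMeasurable, ?_⟩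
  refine lt_of_le_of_lt (b := ∫⁻ ω, G * ∏ i ∈ Finset.range (j + 1), E (X i ω) ∂P) ?_ ?_
  · refine lintegral_mono_ae ?_
    filter_upwards [ae_forall_comp hX hlaw hkE] with ω hω
    rw [pathKernel_succ]
    refine (enorm_path_le hω hgG _ j).trans ?_
    rw [Finset.prod_range_succ', mul_left_comm, mul_comm _ (E (X 0 ω))]
    gcongr
    exact hω 0 t
  · have hm : Measurable fun ω => ∏ i ∈ Finset.range (j + 1), E (X i ω) :=
      Finset.measurable_prod _ fun i _ => hE.comp (hX i)
    rw [lintegral_const_mul _ hm]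
    refine ENNReal.mul_lt_top hG ?_
    have := lintegral_prod_rpow hX hlaw hind hE zero_le_one (j + 1)
    simp only [ENNReal.rpow_one] at this
    rw [this]
    exact ENNReal.pow_lt_top hEi

/-- The expectation of the path kernel along an i.i.d. sequence is the iterated operator. -/
theorem integral_pathKernel [IsProbabilityMeasure P] [SFinite μ] {X : ℕ → Ω → T}
    (hX : ∀ i, Measurable (X i))
    (hlaw : ∀ i, P.map (X i) = μ) (hind : iIndepFun X P) {k : T → T → ℝ}
    (hk : Measurable (Function.uncurry k)) {E : T → ℝ≥0∞} (hE : Measurable E)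
    (hkE : ∀ᵐ x ∂μ, ∀ t, ‖k t x‖ₑ ≤ E x) (hEi : ∫⁻ x, E x ∂μ < ∞) {g : T → ℝ} (hg : Measurable g)
    {G : ℝ≥0∞} (hG : G < ∞) (hgG : ∀ t, ‖g t‖ₑ ≤ G) (j : ℕ) (t : T) :
    ∫ ω, pathKernel k g (j + 1) t (fun i => X i ω) ∂P = (kernelOp μ k)^[j + 1] g t := by
  induction j generalizing g G with
  | zero =>
    have hm : Measurable fun s => k t s * g s := (hk.comp measurable_prodMk_left).mul hg
    simp only [pathKernel_succ, Finset.range_zero, Finset.prod_empty, mul_one, zero_add,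
      Function.iterate_one, kernelOp]
    rw [← hlaw 0, integral_map (hX 0).aemeasurable hm.aestronglyMeasurable]
  | succ j ih =>
    -- Integrating out the last point replaces `g` by the operator applied to `g`, evaluated at the
    -- preceding point. This is why the induction is over all `g`.
    rw [Function.iterate_succ_apply, ← ih (measurable_kernelOp hk hg)
      (ENNReal.mul_lt_top hEi hG) (enorm_kernelOp_le hE hkE hgG)]
    set head : (ℕ → T) → ℝ :=
      fun y => k t (y 0) * ∏ i ∈ Finset.range j, k (y i) (y (i + 1)) with hhead
    have hheadm : Measurable head :=
      (hk.comp (measurable_const.prodMk (measurable_pi_apply 0))).mul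
        (Finset.measurable_prod _ fun i _ => measurable_kernel_apply hk i (i + 1))
    have hhead_eq : ∀ ω, head (fun i => X (min i j) ω) = head (fun i => X i ω) := fun ω => by
      simp only [hhead, Nat.zero_min]
      congr 1
      refine Finset.prod_congr rfl fun i hi => ?_
      have := Finset.mem_range.1 hi
      rw [min_eq_left (by omega), min_eq_left (by omega)]
    set H : (ℕ → T) → T → ℝ := fun y z => head y * (k (y j) z * g z) with hH
    have hkm : Measurable fun p : (ℕ → T) × T => k (p.1 j) p.2 :=
      hk.comp (g := Function.uncurry k) (f := fun p : (ℕ → T) × T => (p.1 j, p.2))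
        (((measurable_pi_apply j).comp measurable_fst).prodMk measurable_snd)
    have hHm : Measurable (Function.uncurry H) :=
      (hheadm.comp measurable_fst).mul (hkm.mul (hg.comp measurable_snd))
    have hpath : ∀ ω, pathKernel k g (j + 1 + 1) t (fun i => X i ω) =
        H (fun i => X (min i j) ω) (X (j + 1) ω) := fun ω => by
      simp only [hH, hhead_eq, min_self]
      simp only [pathKernel_succ, Finset.prod_range_succ, hhead]
      ring
    have hint := integrable_pathKernel hX hlaw hind hk hE hkE hEi hg hG hgG (j + 1) t
    simp_rw [hpath] at hint ⊢
    rw [integral_indepFun_eq (measurable_pi_iff.2 fun i => hX _) (hX (j + 1))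
      (indepFun_past hX hind j) (hlaw _) hHm hint]
    refine integral_congr_ae (Eventually.of_forall fun ω => ?_)
    simp only [hH, hhead_eq, min_self, integral_const_mul]
    rw [pathKernel_succ]
    rfl

end Paths

/-! ### Errors of averages of independent variables -/

section Averages

variable {Ω : Type v} [MeasurableSpace Ω] {P : Measure Ω}

lemma eLpNorm'_sub_const_le [IsProbabilityMeasure P] {q : ℝ} (hq : 1 ≤ q) {Y : Ω → ℝ}
    (hY : Measurable Y) :
    eLpNorm' (fun ω => Y ω - ∫ ω', Y ω' ∂P) q P ≤ 2 * eLpNorm' Y q P := by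
  have hq0 : 0 < q := by linarith
  have h1 : ‖-∫ ω', Y ω' ∂P‖ₑ ≤ eLpNorm' Y q P := by
    rw [enorm_neg]
    refine (enorm_integral_le_lintegral_enorm _).trans ?_
    have := eLpNorm'_le_eLpNorm'_of_exponent_le one_pos hq P hY.aestronglyMeasurable
    simpa [eLpNorm'_eq_lintegral_enorm] using this
  refine (eLpNorm'_add_le (f := Y) (g := fun _ => -∫ ω', Y ω' ∂P) hY.aestronglyMeasurable
    aestronglyMeasurable_const hq).trans ?_
  rw [eLpNorm'_const _ hq0, measure_univ, ENNReal.one_rpow, mul_one, two_mul]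
  gcongr

lemma eLpNorm'_const_mul {q : ℝ} (hq : 0 < q) (c : ℝ) (Y : Ω → ℝ) :
    eLpNorm' (fun ω => c * Y ω) q P = ‖c‖ₑ * eLpNorm' Y q P :=
  eLpNorm'_const_smul (f := Y) c hq

/-- The `q`-norm of the error of an average of `k` independent variables. -/
lemma eLpNorm'_average_sub_le [IsProbabilityMeasure P] {q : ℝ} (hq : 2 ≤ q) {Y : ℕ → Ω → ℝ}
    (hY : ∀ l, Measurable (Y l)) {e : ℝ} (he : ∀ l, ∫ ω, Y l ω ∂P = e)
    (hYi : ∀ l, Integrable (Y l) P) {a : ℝ≥0∞}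
    (ha : ∀ l, eLpNorm' (Y l) q P ≤ a)
    (hind : ∀ n, IndepFun (fun ω => ∑ l ∈ Finset.range n, (Y l ω - e)) (fun ω => Y n ω - e) P)
    {k : ℕ} (hk : 0 < k) :
    eLpNorm' (fun ω => (k : ℝ)⁻¹ * ∑ l ∈ Finset.range k, Y l ω - e) q P ≤
      ENNReal.ofReal (4 * √q / √k) * a := by
  have hq0 : 0 < q := by linarith
  have hk0 : (0 : ℝ) < k := by exact_mod_cast hk
  have hc : 0 < 4 * √q / √k := by positivity
  rcases eq_or_ne a ∞ with rfl | hatop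
  · rw [ENNReal.mul_top (by simpa using hc)]; exact le_top
  -- Centring doubles the norm; with the constant `2√q` of the moment inequality this makes `4√q`.
  have hZz : ∀ l, eLpNorm' (fun ω => Y l ω - e) q P ≤ ENNReal.ofReal (2 * a.toReal) := fun l => by
    have := eLpNorm'_sub_const_le (P := P) (q := q) (by linarith) (hY l)
    rw [he l] at this
    refine this.trans ?_
    rw [ENNReal.ofReal_mul zero_le_two, ENNReal.ofReal_toReal hatop, ENNReal.ofReal_ofNat]
    gcongr
    exact ha l
  have hsum := eLpNorm'_sum_range_le_sqrt hq (by positivity) (fun l => (hY l).sub_const e) hZz hind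
    (fun l => by rw [integral_sub (hYi l) (integrable_const _), he l]; simp) k
  have heq : (fun ω => (k : ℝ)⁻¹ * ∑ l ∈ Finset.range k, Y l ω - e) =
      fun ω => (k : ℝ)⁻¹ * ∑ l ∈ Finset.range k, (Y l ω - e) := by
    funext ω
    rw [Finset.sum_sub_distrib, Finset.sum_const, Finset.card_range, nsmul_eq_mul]
    field_simp
  rw [heq, eLpNorm'_const_mul hq0]
  calc ‖(k : ℝ)⁻¹‖ₑ * eLpNorm' (fun ω => ∑ l ∈ Finset.range k, (Y l ω - e)) q P
      ≤ ENNReal.ofReal (k : ℝ)⁻¹ * ENNReal.ofReal (2 * (2 * a.toReal) * √(q * k)) := by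
        rw [Real.enorm_of_nonneg (by positivity)]
        gcongr
    _ = ENNReal.ofReal (4 * √q / √k) * a := by
        nth_rw 2 [← ENNReal.ofReal_toReal hatop]
        rw [← ENNReal.ofReal_mul (by positivity), ← ENNReal.ofReal_mul (by positivity),
          Real.sqrt_mul hq0.le]
        congr 1
        have : (k : ℝ) = √k * √k := (Real.mul_self_sqrt hk0.le).symm
        have hs : 0 < √(k : ℝ) := Real.sqrt_pos.2 hk0
        rw [this, Real.sqrt_mul_self hs.le]
        field_simp
        ring

lemma eLpNorm'_finset_sum_le {q : ℝ} (hq : 1 ≤ q) (S : Finset ℕ) {Y : ℕ → Ω → ℝ}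
    (hY : ∀ m ∈ S, Measurable (Y m)) {a : ℕ → ℝ≥0∞} (ha : ∀ m ∈ S, eLpNorm' (Y m) q P ≤ a m) :
    eLpNorm' (fun ω => ∑ m ∈ S, Y m ω) q P ≤ ∑ m ∈ S, a m := by
  have := eLpNorm'_sum_le (μ := P) (f := Y) (s := S)
    (fun m hm => (hY m hm).aestronglyMeasurable) hq
  have heq : (∑ m ∈ S, Y m) = fun ω => ∑ m ∈ S, Y m ω := by
    funext ω; exact Finset.sum_apply _ _ _
  rw [heq] at this
  exact this.trans (Finset.sum_le_sum ha)

end Averages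

/-! ### Independence within the array of random tuples -/

section Samples

variable {T : Type u} [MeasurableSpace T] {μ : Measure T}
  {Ω : Type v} [MeasurableSpace Ω] {P : Measure Ω} {ξ : ℕ → ℕ → ℕ → Ω → T}

lemma IsSample.iIndepFun_tuple (h : IsSample μ P ξ) (m l : ℕ) :
    iIndepFun (fun i => ξ m l i) P :=
  h.indep.precomp (g := fun i : ℕ => ((m, l, i) : ℕ × ℕ × ℕ)) fun i j hij => by simpa using hij

/-- The first `n` tuples and the tuple with index `n` occupy disjoint sets of indices. Dependence on
the coordinates up to `j` only makes these sets finite. -/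
lemma IsSample.indepFun_sum (h : IsSample μ P ξ) (m j n : ℕ) {Φ : (ℕ → T) → ℝ}
    (hΦ : Measurable Φ) (hΦj : ∀ x y : ℕ → T, (∀ i ≤ j, x i = y i) → Φ x = Φ y) :
    IndepFun (fun ω => ∑ l ∈ Finset.range n, Φ fun i => ξ m l i ω)
      (fun ω => Φ fun i => ξ m n i ω) P := by
  classical
  set S : Finset (ℕ × ℕ × ℕ) := {m} ×ˢ Finset.range n ×ˢ Finset.range (j + 1) with hS
  set S' : Finset (ℕ × ℕ × ℕ) := {m} ×ˢ {n} ×ˢ Finset.range (j + 1) with hS'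
  have hdisj : Disjoint S S' := by
    rw [Finset.disjoint_left]
    rintro ⟨a, b, c⟩ h1 h2
    simp only [hS, hS', Finset.mem_product, Finset.mem_singleton, Finset.mem_range] at h1 h2
    omega
  have hi := h.indep.indepFun_finset S S' hdisj fun a => h.measurable _ _ _
  have hmS : ∀ (l : Fin n) (i : ℕ), ((m, (l : ℕ), min i j) : ℕ × ℕ × ℕ) ∈ S := fun l i => by
    simp [hS]
  have hmS' : ∀ i : ℕ, ((m, n, min i j) : ℕ × ℕ × ℕ) ∈ S' := fun i => by
    simp [hS']
  have htrunc : ∀ l ω, (Φ fun i => ξ m l i ω) = Φ fun i => ξ m l (min i j) ω := fun l ω =>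
    hΦj _ _ fun i hij => by simp [hij]
  have := hi.comp
    (φ := fun y : S → T => ∑ l : Fin n, Φ fun i => y ⟨(m, (l : ℕ), min i j), hmS l i⟩)
    (ψ := fun y : S' → T => Φ fun i => y ⟨(m, n, min i j), hmS' i⟩)
    (Finset.measurable_sum _ fun l _ => hΦ.comp (by fun_prop)) (hΦ.comp (by fun_prop))
  simp_rw [htrunc, Finset.sum_range]
  exact this

/-- The error of the Monte-Carlo average of a functional of the first `j + 1` coordinates. -/
lemma IsSample.eLpNorm'_average_sub_le [IsProbabilityMeasure P] (h : IsSample μ P ξ) (m j : ℕ)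
    {Φ : (ℕ → T) → ℝ} (hΦ : Measurable Φ)
    (hΦj : ∀ x y : ℕ → T, (∀ i ≤ j, x i = y i) → Φ x = Φ y) {q : ℝ} (hq : 2 ≤ q) {e : ℝ}
    (he : ∀ l, ∫ ω, Φ (fun i => ξ m l i ω) ∂P = e)
    (hi : ∀ l, Integrable (fun ω => Φ fun i => ξ m l i ω) P) {a : ℝ≥0∞}
    (ha : ∀ l, eLpNorm' (fun ω => Φ fun i => ξ m l i ω) q P ≤ a) {k : ℕ} (hk : 0 < k) :
    eLpNorm' (fun ω => (k : ℝ)⁻¹ * ∑ l ∈ Finset.range k, Φ (fun i => ξ m l i ω) - e) q P ≤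
      ENNReal.ofReal (4 * √q / √k) * a :=
  FredholmMC.eLpNorm'_average_sub_le (Y := fun l ω => Φ fun i => ξ m l i ω) hq
    (fun l => hΦ.comp (measurable_pi_iff.2 fun i => h.measurable m l i)) he hi ha
    (fun n => h.indepFun_sum m j n (hΦ.sub_const e) fun x y hxy => by rw [hΦj x y hxy]) hk

lemma eLpNorm'_le_of_ae_enorm_le {q : ℝ} (hq : 0 < q) {Y : Ω → ℝ} {g : Ω → ℝ≥0∞}
    (hg : Measurable g) {c : ℝ≥0∞} (h : ∀ᵐ ω ∂P, ‖Y ω‖ₑ ≤ c * g ω) :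
    eLpNorm' Y q P ≤ c * (∫⁻ ω, g ω ^ q ∂P) ^ (1 / q) := by
  rw [eLpNorm'_eq_lintegral_enorm]
  calc (∫⁻ ω, ‖Y ω‖ₑ ^ q ∂P) ^ (1 / q) ≤ (∫⁻ ω, c ^ q * g ω ^ q ∂P) ^ (1 / q) := by
        refine ENNReal.rpow_le_rpow (lintegral_mono_ae ?_) (by positivity)
        filter_upwards [h] with ω hω
        rw [← ENNReal.mul_rpow_of_nonneg _ _ hq.le]
        exact ENNReal.rpow_le_rpow hω hq.le
    _ = _ := by
        rw [lintegral_const_mul _ (hg.pow_const q), ENNReal.mul_rpow_of_nonneg _ _ (by positivity),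
          ← ENNReal.rpow_mul, mul_one_div_cancel hq.ne', ENNReal.rpow_one]

end Samples

/-! ### Moments, means and degeneracy of the path kernels -/

section Moments

variable {T : Type u} [PseudoMetricSpace T] [CompactSpace T] [MeasurableSpace T]
  {μ : Measure T} [IsProbabilityMeasure μ] {K : T → T → ℝ} {f : T → ℝ}
  {Ω : Type v} [MeasurableSpace Ω] {P : Measure Ω} [IsProbabilityMeasure P]

lemma lintegral_prod_envelope_rpow (hK : Measurable (Function.uncurry K)) {X : ℕ → Ω → T}
    (hX : ∀ i, Measurable (X i)) (hlaw : ∀ i, P.map (X i) = μ) (hind : iIndepFun X P) {q : ℝ}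
    (hq : 0 < q) (m : ℕ) :
    (∫⁻ ω, (∏ i ∈ Finset.range m, envelope μ K (X i ω)) ^ q ∂P) ^ (1 / q) = psiR μ K q ^ m := by
  rw [lintegral_prod_rpow hX hlaw hind (measurable_envelope hK) hq.le,
    lintegral_envelope_rpow hq, ← ENNReal.rpow_natCast, ← ENNReal.rpow_mul, ← ENNReal.rpow_mul,
    ← ENNReal.rpow_natCast]
  congr 1
  field_simp

variable {X : ℕ → Ω → T} {D F : ℝ}

/-- The amplitude `F (1 + D)^m ψ_R(q)^m` of the `m`-th path kernel in `L^q`. -/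
noncomputable def pathMoment (ψ : ℝ → ℝ≥0∞) (F D : ℝ) (m : ℕ) (q : ℝ) : ℝ≥0∞ :=
  ENNReal.ofReal (F * (1 + D) ^ m) * ψ q ^ m

/-- Only the first factor depends on the starting point, and its increment is at most `d(t,s)
R(X_0)`. This saves one factor `1 + D`, which is given away so that the amplitude agrees with that
of the path kernel itself. -/
lemma Setting.eLpNorm'_pathKernel_sub_le (h : Setting μ K f) (hD : ∀ t s : T, dist t s ≤ D)
    (hF : ∀ t, |f t| ≤ F) (hX : ∀ i, Measurable (X i)) (hlaw : ∀ i, P.map (X i) = μ)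
    (hind : iIndepFun X P) {q : ℝ} (hq : 0 < q) (j : ℕ) (t s : T) :
    eLpNorm' (fun ω => pathKernel K f (j + 1) t (fun i => X i ω) -
      pathKernel K f (j + 1) s fun i => X i ω) q P ≤
      edist t s * pathMoment (psiR μ K) F D (j + 1) q := by
  have hD0 : 0 ≤ D := dist_nonneg.trans (hD t t)
  have hF0 : 0 ≤ F := (abs_nonneg _).trans (hF t)
  have hm := measurable_envelope (μ := μ) h.measurable_kernel
  have hc1 : 1 ≤ ENNReal.ofReal (1 + D) := by
    rw [← ENNReal.ofReal_one]; exact ENNReal.ofReal_le_ofReal (by linarith)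
  rw [pathMoment, ← mul_assoc,
    ← lintegral_prod_envelope_rpow h.measurable_kernel hX hlaw hind hq (j + 1)]
  refine eLpNorm'_le_of_ae_enorm_le hq
    (g := fun ω => ∏ i ∈ Finset.range (j + 1), envelope μ K (X i ω)) (Finset.measurable_prod _ fun i _ =>
    (hm.comp (hX i) : Measurable fun ω => envelope μ K (X i ω))) ?_
  filter_upwards [ae_forall_comp hX hlaw h.ae_enorm_sub_le,
    ae_forall_comp hX hlaw (h.ae_enorm_le hD)] with ω h1 h2
  rw [pathKernel_succ, pathKernel_succ, ← sub_mul, ← sub_mul]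
  refine (enorm_path_le (E := fun x => ENNReal.ofReal (1 + D) * envelope μ K x)
    (G := ENNReal.ofReal F) h2
    (fun t => by rw [Real.enorm_eq_ofReal_abs]; exact ENNReal.ofReal_le_ofReal (hF t)) _ j).trans ?_
  rw [Finset.prod_mul_distrib, Finset.prod_const, Finset.card_range, Finset.prod_range_succ',
    ENNReal.ofReal_mul hF0, ENNReal.ofReal_pow (by positivity)]
  calc _ ≤ edist t s * envelope μ K (X 0 ω) * (ENNReal.ofReal F * (ENNReal.ofReal (1 + D) ^ (j + 1) *
          ∏ i ∈ Finset.range j, envelope μ K (X (i + 1) ω))) := by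
        refine mul_le_mul' ?_ (mul_le_mul' le_rfl (mul_le_mul' ?_ le_rfl))
        · exact h1 0 t s
        · exact pow_le_pow_right' hc1 (Nat.le_succ j)
    _ = _ := by ring

lemma Setting.eLpNorm'_pathKernel_le (h : Setting μ K f) (hD : ∀ t s : T, dist t s ≤ D)
    (hF : ∀ t, |f t| ≤ F) (hX : ∀ i, Measurable (X i)) (hlaw : ∀ i, P.map (X i) = μ)
    (hind : iIndepFun X P) {q : ℝ} (hq : 0 < q) (j : ℕ) (t : T) :
    eLpNorm' (fun ω => pathKernel K f (j + 1) t fun i => X i ω) q P ≤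
      pathMoment (psiR μ K) F D (j + 1) q := by
  have hD0 : 0 ≤ D := dist_nonneg.trans (hD t t)
  have hF0 : 0 ≤ F := (abs_nonneg _).trans (hF t)
  have hm := measurable_envelope (μ := μ) h.measurable_kernel
  rw [pathMoment, ← lintegral_prod_envelope_rpow h.measurable_kernel hX hlaw hind hq (j + 1)]
  refine eLpNorm'_le_of_ae_enorm_le hq
    (g := fun ω => ∏ i ∈ Finset.range (j + 1), envelope μ K (X i ω)) (Finset.measurable_prod _ fun i _ =>
    (hm.comp (hX i) : Measurable fun ω => envelope μ K (X i ω))) ?_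
  filter_upwards [ae_forall_comp hX hlaw (h.ae_enorm_le hD)] with ω h2
  rw [pathKernel_succ]
  refine (enorm_path_le (E := fun x => ENNReal.ofReal (1 + D) * envelope μ K x)
    (G := ENNReal.ofReal F) h2
    (fun t => by rw [Real.enorm_eq_ofReal_abs]; exact ENNReal.ofReal_le_ofReal (hF t)) _ j).trans ?_
  rw [Finset.prod_mul_distrib, Finset.prod_const, Finset.card_range, Finset.prod_range_succ',
    ENNReal.ofReal_mul hF0, ENNReal.ofReal_pow (by positivity)]
  calc _ ≤ ENNReal.ofReal (1 + D) * envelope μ K (X 0 ω) * (ENNReal.ofReal F *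
          (ENNReal.ofReal (1 + D) ^ j *
          ∏ i ∈ Finset.range j, envelope μ K (X (i + 1) ω))) := by
        gcongr
        exact h2 0 t
    _ = _ := by ring

lemma Setting.lintegral_envelope_lt_top (h : Setting μ K f) (c : ℝ) :
    ∫⁻ x, ENNReal.ofReal c * envelope μ K x ∂μ < ∞ := by
  rw [lintegral_const_mul _ (measurable_envelope h.measurable_kernel)]
  refine ENNReal.mul_lt_top (by simp) ?_
  have h1 := (psiR_mono h.measurable_kernel one_pos one_le_two).trans_lt h.psiR_two_lt_top
  simpa [psiR] using h1

/-- The mean square of the product of kernels is `U^m[1](t)`. The lemma treats the terms with `θ(m)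
= 0`: there a single tuple is used for every `n`, so the factor `√n` is harmless only because the
term vanishes. -/
lemma Setting.pathKernel_ae_eq_zero (h : Setting μ K f) (hX : ∀ i, Measurable (X i))
    (hlaw : ∀ i, P.map (X i) = μ) (hind : iIndepFun X P) {j : ℕ} (hj : rU μ K (j + 1) = 0)
    (t : T) : ∀ᵐ ω ∂P, pathKernel K f (j + 1) t (fun i => X i ω) = 0 := by
  have hm : Measurable fun x => (ENNReal.ofReal (1 + Metric.diam (Set.univ : Set T)) *
      envelope μ K x) ^ 2 :=
    ((measurable_envelope h.measurable_kernel).const_mul _).pow_const 2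
  have hk := measurable_sqKernel h.measurable_kernel
  have hE := h.lintegral_sq_envelope_lt_top (1 + Metric.diam (Set.univ : Set T))
  have hint := integrable_pathKernel hX hlaw hind hk hm (h.ae_enorm_sqKernel_le dist_le_diam_univ) hE
    (g := fun _ => 1) measurable_const (G := 1) (by simp) (by simp) j t
  have h0 := integral_pathKernel hX hlaw hind hk hm (h.ae_enorm_sqKernel_le dist_le_diam_univ) hE
    (g := fun _ => 1) measurable_const (G := 1) (by simp) (by simp) j t
  rw [h.iterate_sqKernel_one_eq_zero hj] at h0
  have hsq : ∀ x : ℕ → T, pathKernel (sqKernel K) (fun _ => 1) (j + 1) t x =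
      (K t (x 0) * ∏ i ∈ Finset.range j, K (x i) (x (i + 1))) ^ 2 := fun x => by
    simp [pathKernel_succ, sqKernel, mul_pow, Finset.prod_pow]
  have h1 := (integral_eq_zero_iff_of_nonneg (fun ω => by
    simp only [hsq, Pi.zero_apply]; positivity) hint).1 h0
  filter_upwards [h1] with ω hω
  simp only [hsq, Pi.zero_apply] at hω
  rw [pathKernel_succ, pow_eq_zero_iff two_ne_zero |>.1 hω, zero_mul]

variable [OpensMeasurableSpace T]

lemma Setting.pathKernel_moment (h : Setting μ K f) (hD : ∀ t s : T, dist t s ≤ D)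
    (hF : ∀ t, |f t| ≤ F) (hX : ∀ i, Measurable (X i)) (hlaw : ∀ i, P.map (X i) = μ)
    (hind : iIndepFun X P) (j : ℕ) (t : T) :
    Integrable (fun ω => pathKernel K f (j + 1) t fun i => X i ω) P ∧
    ∫ ω, pathKernel K f (j + 1) t (fun i => X i ω) ∂P = (kernelOp μ K)^[j + 1] f t := by
  have hm : Measurable fun x => ENNReal.ofReal (1 + D) * envelope μ K x :=
    (measurable_envelope h.measurable_kernel).const_mul _
  have hf : ∀ t, ‖f t‖ₑ ≤ ENNReal.ofReal F := fun t => by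
    rw [Real.enorm_eq_ofReal_abs]; exact ENNReal.ofReal_le_ofReal (hF t)
  exact ⟨integrable_pathKernel hX hlaw hind h.measurable_kernel hm (h.ae_enorm_le hD)
    (h.lintegral_envelope_lt_top _) h.continuous_f.measurable ENNReal.ofReal_lt_top hf j t,
    integral_pathKernel hX hlaw hind h.measurable_kernel hm (h.ae_enorm_le hD)
    (h.lintegral_envelope_lt_top _) h.continuous_f.measurable ENNReal.ofReal_lt_top hf j t⟩

lemma Setting.continuous_kernelOp (h : Setting μ K f) {g : T → ℝ} (hg : Continuous g) :
    Continuous (kernelOp μ K g) := by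
  obtain ⟨G, hG⟩ := (isCompact_range hg).isBounded.exists_norm_le
  have hE := (h.lintegral_envelope_lt_top (1 + Metric.diam (Set.univ : Set T)))
  have hm : Measurable fun x => ENNReal.ofReal (1 + Metric.diam (Set.univ : Set T)) *
      envelope μ K x := (measurable_envelope h.measurable_kernel).const_mul _
  refine continuous_of_dominated (bound := fun x =>
    (ENNReal.ofReal (1 + Metric.diam (Set.univ : Set T)) * envelope μ K x).toReal * G)
    (fun t => ?_) (fun t => ?_) ((integrable_toReal_of_lintegral_ne_top hm.aemeasurable
      hE.ne).mul_const G) ?_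
  · exact ((h.measurable_kernel.comp measurable_prodMk_left).mul
      hg.measurable).aestronglyMeasurable
  · filter_upwards [h.ae_enorm_le dist_le_diam_univ, h.envelope_lt_top] with x hx hR
    rw [norm_mul]
    refine mul_le_mul ?_ (hG _ (mem_range_self x)) (norm_nonneg _) ENNReal.toReal_nonneg
    rw [← toReal_enorm]
    exact ENNReal.toReal_mono (ENNReal.mul_lt_top (by simp) hR).ne (hx t)
  · filter_upwards [h.continuous_kernel] with x hx
    exact hx.mul_const (g x)

lemma Setting.continuous_iterate_kernelOp (h : Setting μ K f) (m : ℕ) :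
    Continuous ((kernelOp μ K)^[m] f) := by
  induction m with
  | zero => exact h.continuous_f
  | succ m ih =>
    rw [Function.iterate_succ_apply']
    exact h.continuous_kernelOp ih

end Moments

/-! ### The normalized error as a Lipschitz process in `L^q` -/

section Error

variable {T : Type u} [PseudoMetricSpace T] [CompactSpace T] [MeasurableSpace T]
  {μ : Measure T} {K : T → T → ℝ} {f : T → ℝ}
  {Ω : Type v} {ξ : ℕ → ℕ → ℕ → Ω → T}

/-- The weights `θ(m)` as a function of the norms `r_m`. -/
noncomputable def thetaOf (r : ℕ → ℝ) (N m : ℕ) : ℝ :=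
  √(r m) / ((∑ k ∈ Finset.Icc 1 N, √(k : ℝ) * √(r k)) * √(m : ℝ))

lemma theta_eq_thetaOf {r : ℕ → ℝ} {N m : ℕ} (hm : m ∈ Finset.Icc 1 N)
    (hr : ∀ m ∈ Finset.Icc 1 N, rU μ K m = r m) : theta μ K N m = thetaOf r N m := by
  rw [theta, thetaOf, hr m hm]
  congr 2
  exact Finset.sum_congr rfl fun k hk => by rw [hr k hk]

lemma thetaOf_pos {r : ℕ → ℝ} {N m : ℕ} (hm : m ∈ Finset.Icc 1 N) (hr : 0 < r m) :
    0 < thetaOf r N m := by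
  unfold thetaOf
  have hm0 : (0 : ℝ) < m := by exact_mod_cast (Finset.mem_Icc.1 hm).1
  have h1 : 0 < √(m : ℝ) * √(r m) := by positivity
  have h2 : √(m : ℝ) * √(r m) ≤ ∑ k ∈ Finset.Icc 1 N, √(k : ℝ) * √(r k) :=
    Finset.single_le_sum (f := fun k : ℕ => √(k : ℝ) * √(r k)) (fun k _ => by positivity) hm
  have := h1.trans_le h2
  positivity

lemma rU_nonneg (m : ℕ) : 0 ≤ rU μ K m := ENNReal.toReal_nonneg

/-- The factor of `√q ψ_R(q)^m` in the bound for the `m`-th term of the error. -/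
noncomputable def errorWeight (r : ℕ → ℝ) (F D : ℝ) (N m : ℕ) : ℝ :=
  4 * (√(thetaOf r N m))⁻¹ * (F * (1 + D) ^ m)

/-- Since `n(m) = 1 + ⌊θ(m) n⌋ ≥ θ(m) n`, the factor `√n` cancels. The extra `1` compensates the
rounding. -/
lemma sqrt_mul_div_sqrt_sampleSize_le {r : ℕ → ℝ} {N m n : ℕ} (hm : m ∈ Finset.Icc 1 N)
    (hr : ∀ m ∈ Finset.Icc 1 N, rU μ K m = r m) (hn : 1 ≤ n) (hrm : 0 < r m) (q : ℝ) :
    √(n : ℝ) * (4 * √q / √(sampleSize μ K N n m : ℝ)) ≤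
      √q * (4 * (√(thetaOf r N m))⁻¹) := by
  have hn0 : (0 : ℝ) < n := by exact_mod_cast hn
  have hθ := thetaOf_pos hm hrm
  have hk : thetaOf r N m * n ≤ sampleSize μ K N n m := by
    rw [sampleSize, theta_eq_thetaOf hm hr]
    push_cast
    rw [add_comm]
    exact (Nat.lt_floor_add_one _).le
  have hsk : √(thetaOf r N m) * √(n : ℝ) ≤ √(sampleSize μ K N n m : ℝ) := by
    rw [← Real.sqrt_mul hθ.le]; exact Real.sqrt_le_sqrt hk
  have hpos : 0 < √(thetaOf r N m) * √(n : ℝ) := by positivity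
  calc √(n : ℝ) * (4 * √q / √(sampleSize μ K N n m : ℝ))
      ≤ √(n : ℝ) * (4 * √q / (√(thetaOf r N m) * √(n : ℝ))) := by gcongr
    _ = _ := by field_simp

/-- The bound for the `q`-norm of the normalized error. -/
noncomputable def errorMoment (r : ℕ → ℝ) (F D : ℝ) (N : ℕ) (ψ : ℝ → ℝ≥0∞) (q : ℝ) : ℝ≥0∞ :=
  ENNReal.ofReal √q * ∑ m ∈ Finset.Icc 1 N, ENNReal.ofReal (errorWeight r F D N m) * ψ q ^ m

/-- The normalized error of the estimator. -/
noncomputable def scaledError (μ : Measure T) (K : T → T → ℝ) (f : T → ℝ)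
    (ξ : ℕ → ℕ → ℕ → Ω → T) (N n : ℕ) (t : T) (ω : Ω) : ℝ :=
  √(n : ℝ) * (yMC μ K f ξ N n t ω - yTrunc μ K f N t)

lemma scaledError_eq (N n : ℕ) (t : T) (ω : Ω) :
    scaledError μ K f ξ N n t ω = ∑ m ∈ Finset.Icc 1 N,
      √(n : ℝ) * (mcPower K f ξ m (sampleSize μ K N n m) t ω - (kernelOp μ K)^[m] f t) := by
  rw [scaledError, yMC, yTrunc, add_sub_add_left_eq_sub, ← Finset.sum_sub_distrib, Finset.mul_sum]

variable [MeasurableSpace Ω] {P : Measure Ω}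

/-- A term of the normalized error, for a functional of the path. -/
lemma term_le [IsProbabilityMeasure P] (hξ : IsSample μ P ξ) {r : ℕ → ℝ} {F D : ℝ} {N n j : ℕ}
    (hm : j + 1 ∈ Finset.Icc 1 N)
    (hr : ∀ m ∈ Finset.Icc 1 N, rU μ K m = r m) (hn : 1 ≤ n)
    {Φ : (ℕ → T) → ℝ} (hΦ : Measurable Φ)
    (hΦj : ∀ x y : ℕ → T, (∀ i ≤ j, x i = y i) → Φ x = Φ y) {q : ℝ} (hq : 2 ≤ q) {e : ℝ}
    (he : ∀ l, ∫ ω, Φ (fun i => ξ (j + 1) l i ω) ∂P = e)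
    (hi : ∀ l, Integrable (fun ω => Φ fun i => ξ (j + 1) l i ω) P) {b : ℝ≥0∞}
    (ha : ∀ l, eLpNorm' (fun ω => Φ fun i => ξ (j + 1) l i ω) q P ≤
      b * pathMoment (psiR μ K) F D (j + 1) q)
    (h0 : rU μ K (j + 1) = 0 → ∀ l, ∀ᵐ ω ∂P, Φ (fun i => ξ (j + 1) l i ω) = 0) :
    eLpNorm' (fun ω => √(n : ℝ) * ((sampleSize μ K N n (j + 1) : ℝ)⁻¹ *
        ∑ l ∈ Finset.range (sampleSize μ K N n (j + 1)), Φ (fun i => ξ (j + 1) l i ω) - e)) q P ≤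
      b * (ENNReal.ofReal √q *
        (ENNReal.ofReal (errorWeight r F D N (j + 1)) * psiR μ K q ^ (j + 1))) := by
  have hq0 : 0 < q := by linarith
  have hk : 0 < sampleSize μ K N n (j + 1) := by unfold sampleSize; omega
  rw [eLpNorm'_const_mul hq0, Real.enorm_of_nonneg (Real.sqrt_nonneg _)]
  -- If `r_m = 0`, the weight on the right is `0` because `(√0)⁻¹ = 0`, so the term has to vanish
  -- exactly.
  rcases (rU_nonneg (μ := μ) (K := K) (j + 1)).eq_or_lt with hr0 | hr0
  · have ha0 : ∀ l, eLpNorm' (fun ω => Φ fun i => ξ (j + 1) l i ω) q P ≤ 0 := fun l => by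
      refine le_of_eq ((eLpNorm'_congr_ae (h0 hr0.symm l)).trans ?_)
      simp [eLpNorm'_eq_lintegral_enorm, hq0]
    have := hξ.eLpNorm'_average_sub_le (j + 1) j hΦ hΦj hq he hi ha0 hk
    rw [mul_zero, nonpos_iff_eq_zero] at this
    rw [this, mul_zero]
    exact zero_le
  · have hrm : 0 < r (j + 1) := by rwa [← hr _ hm]
    have := hξ.eLpNorm'_average_sub_le (j + 1) j hΦ hΦj hq he hi ha hk
    refine (mul_le_mul' le_rfl this).trans ?_
    rw [← mul_assoc, ← ENNReal.ofReal_mul (Real.sqrt_nonneg _)]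
    refine (mul_le_mul' (ENNReal.ofReal_le_ofReal
      (sqrt_mul_div_sqrt_sampleSize_le hm hr hn hrm q)) le_rfl).trans (le_of_eq ?_)
    rw [pathMoment, errorWeight, ENNReal.ofReal_mul (Real.sqrt_nonneg _),
      ENNReal.ofReal_mul (p := 4 * (√(thetaOf r N (j + 1)))⁻¹) (by positivity)]
    ring

variable [OpensMeasurableSpace T] {r : ℕ → ℝ} {D F : ℝ} {N n : ℕ}

lemma measurable_mcPower (h : Setting μ K f) (hξ : IsSample μ P ξ) (m k : ℕ) (t : T) :
    Measurable (mcPower K f ξ m k t) :=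
  (Finset.measurable_sum _ fun l _ =>
    (measurable_pathKernel h.measurable_kernel h.continuous_f.measurable m t).comp
      (measurable_pi_iff.2 fun i => hξ.measurable m l i)).const_mul _

lemma measurable_scaledError (h : Setting μ K f) (hξ : IsSample μ P ξ) (t : T) :
    Measurable (scaledError μ K f ξ N n t) := by
  simp_rw [funext (scaledError_eq (μ := μ) (K := K) (f := f) (ξ := ξ) N n t)]
  exact Finset.measurable_sum _ fun m _ =>
    ((measurable_mcPower h hξ m _ t).sub_const _).const_mul _

variable [IsProbabilityMeasure μ]

lemma ae_continuous_scaledError (h : Setting μ K f) (hξ : IsSample μ P ξ) :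
    ∀ᵐ ω ∂P, Continuous fun t => scaledError μ K f ξ N n t ω := by
  have h1 : ∀ᵐ ω ∂P, ∀ m l i, Continuous fun t => K t (ξ m l i ω) :=
    ae_all_iff.2 fun m => ae_all_iff.2 fun l =>
      ae_forall_comp (hξ.measurable m l) (hξ.law m l) h.continuous_kernel
  filter_upwards [h1] with ω hω
  simp_rw [scaledError_eq]
  refine continuous_finsetSum _ fun m _ => continuous_const.mul
    (Continuous.sub ?_ (h.continuous_iterate_kernelOp m))
  refine continuous_const.mul (continuous_finsetSum _ fun l _ => ?_)
  exact ((hω m l 0).mul continuous_const).mul continuous_const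

variable [IsProbabilityMeasure P]

lemma eLpNorm'_scaledError_le (h : Setting μ K f) (hD : ∀ t s : T, dist t s ≤ D)
    (hF : ∀ t, |f t| ≤ F) (hξ : IsSample μ P ξ)
    (hr : ∀ m ∈ Finset.Icc 1 N, rU μ K m = r m) (hn : 1 ≤ n) {q : ℝ} (hq : 2 ≤ q) (t : T) :
    eLpNorm' (scaledError μ K f ξ N n t) q P ≤ errorMoment r F D N (psiR μ K) q := by
  rw [funext (scaledError_eq (μ := μ) (K := K) (f := f) (ξ := ξ) N n t), errorMoment,
    Finset.mul_sum]
  refine eLpNorm'_finset_sum_le (by linarith) _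
    (fun m _ => ((measurable_mcPower h hξ m _ t).sub_const _).const_mul _) fun m hm => ?_
  obtain ⟨j, rfl⟩ : ∃ j, m = j + 1 := ⟨m - 1, by have := (Finset.mem_Icc.1 hm).1; omega⟩
  have := term_le hξ (F := F) (D := D) (b := 1) hm hr hn
    (Φ := pathKernel K f (j + 1) t)
    (measurable_pathKernel h.measurable_kernel h.continuous_f.measurable _ t)
    (fun x y hxy => pathKernel_congr hxy) hq
    (fun l => (h.pathKernel_moment hD hF (hξ.measurable _ l) (hξ.law _ l)
      (hξ.iIndepFun_tuple _ l) j t).2)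
    (fun l => (h.pathKernel_moment hD hF (hξ.measurable _ l) (hξ.law _ l)
      (hξ.iIndepFun_tuple _ l) j t).1)
    (fun l => by
      rw [one_mul]
      exact h.eLpNorm'_pathKernel_le hD hF (hξ.measurable _ l) (hξ.law _ l)
        (hξ.iIndepFun_tuple _ l) (by linarith) j t)
    (fun h0 l => h.pathKernel_ae_eq_zero (hξ.measurable _ l) (hξ.law _ l)
      (hξ.iIndepFun_tuple _ l) h0 t)
  rw [one_mul] at this
  exact this

lemma eLpNorm'_scaledError_sub_le (h : Setting μ K f) (hD : ∀ t s : T, dist t s ≤ D)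
    (hF : ∀ t, |f t| ≤ F) (hξ : IsSample μ P ξ)
    (hr : ∀ m ∈ Finset.Icc 1 N, rU μ K m = r m) (hn : 1 ≤ n) {q : ℝ} (hq : 2 ≤ q) (t s : T) :
    eLpNorm' (fun ω => scaledError μ K f ξ N n t ω - scaledError μ K f ξ N n s ω) q P ≤
      edist t s * errorMoment r F D N (psiR μ K) q := by
  simp_rw [scaledError_eq, ← Finset.sum_sub_distrib, errorMoment, Finset.mul_sum]
  refine eLpNorm'_finset_sum_le (by linarith) _ (fun m _ =>
    (((measurable_mcPower h hξ m _ t).sub_const _).const_mul _).sub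
      (((measurable_mcPower h hξ m _ s).sub_const _).const_mul _)) fun m hm => ?_
  obtain ⟨j, rfl⟩ : ∃ j, m = j + 1 := ⟨m - 1, by have := (Finset.mem_Icc.1 hm).1; omega⟩
  have hmom := fun l t => h.pathKernel_moment hD hF (hξ.measurable (j + 1) l) (hξ.law _ l)
    (hξ.iIndepFun_tuple _ l) j t
  have := term_le hξ (F := F) (D := D) (b := edist t s) hm hr hn
    (Φ := fun x => pathKernel K f (j + 1) t x - pathKernel K f (j + 1) s x)
    ((measurable_pathKernel h.measurable_kernel h.continuous_f.measurable _ t).sub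
      (measurable_pathKernel h.measurable_kernel h.continuous_f.measurable _ s))
    (fun x y hxy => by rw [pathKernel_congr hxy, pathKernel_congr hxy]) hq
    (fun l => (integral_sub (hmom l t).1 (hmom l s).1).trans
      (congrArg₂ (· - ·) (hmom l t).2 (hmom l s).2))
    (fun l => (hmom l t).1.sub (hmom l s).1)
    (fun l => h.eLpNorm'_pathKernel_sub_le hD hF (hξ.measurable _ l) (hξ.law _ l)
        (hξ.iIndepFun_tuple _ l) (by linarith) j t s)
    (fun h0 l => by
      filter_upwards [h.pathKernel_ae_eq_zero (hξ.measurable _ l) (hξ.law _ l)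
        (hξ.iIndepFun_tuple _ l) h0 t, h.pathKernel_ae_eq_zero (hξ.measurable _ l) (hξ.law _ l)
        (hξ.iIndepFun_tuple _ l) h0 s] with ω h1 h2
      rw [h1, h2, sub_zero])
  refine le_trans (le_of_eq ?_) this
  congr 1
  funext ω
  simp only [mcPower, Finset.sum_sub_distrib, Pi.sub_apply]
  ring

/-- The tail bound from the entropy integral at the exponent `p`. -/
theorem Qbar_le_chainBound (h : Setting μ K f) (hD : ∀ t s : T, dist t s ≤ D)
    (hF : ∀ t, |f t| ≤ F) (hξ : IsSample μ P ξ)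
    (hr : ∀ m ∈ Finset.Icc 1 N, rU μ K m = r m) {p u : ℝ} (hp : 2 ≤ p) (hu : 0 < u) :
    Qbar μ K f P ξ N u ≤ (5 * (∫⁻ x in Ioc (0 : ℝ) 1,
      chainBound T (errorMoment r F D N (psiR μ K)) p x) / ENNReal.ofReal u) ^ p := by
  refine iSup_le fun n => iSup_le fun hn => ?_
  obtain ⟨B, hBm, hB, hBn⟩ := exists_chaining_bound (P := P) (p := p)
    (ρ := errorMoment r F D N (psiR μ K)) (by linarith)
    (measurable_scaledError (N := N) (n := n) h hξ) (ae_continuous_scaledError h hξ)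
    (fun q hq t => eLpNorm'_scaledError_le h hD hF hξ hr hn (hp.trans hq) t)
    (fun q hq t s => eLpNorm'_scaledError_sub_le h hD hF hξ hr hn (hp.trans hq) t s)
  refine le_trans (measure_mono_ae ?_) (measure_lt_le_of_eLpNorm'_le (by linarith) hu hBm hBn)
  filter_upwards [hB] with ω hω
  intro hlt
  refine lt_of_lt_of_le hlt (iSup_le fun t => (le_of_eq ?_).trans (hω t))
  rw [scaledError, Real.enorm_eq_ofReal_abs, abs_mul, abs_of_nonneg (Real.sqrt_nonneg _)]

end Error

/-! ### From the chaining integral to the Young–Fenchel bound -/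

section GeneralBound

lemma nonempty_of_isProbabilityMeasure {T : Type u} [MeasurableSpace T] (μ : Measure T)
    [IsProbabilityMeasure μ] : Nonempty T := by
  by_contra hne
  rw [not_nonempty_iff] at hne
  exact IsProbabilityMeasure.ne_zero μ (Measure.eq_zero_of_isEmpty μ)

lemma ofReal_exp_log_mul (n : ℕ) (hn : 1 ≤ n) (y : ℝ) :
    ENNReal.ofReal (Real.exp (Real.log n * y)) = (n : ℝ≥0∞) ^ y := by
  have hn0 : (0 : ℝ) < n := by exact_mod_cast hn
  rw [← Real.rpow_def_of_pos hn0, ← ENNReal.ofReal_rpow_of_pos hn0, ENNReal.ofReal_natCast]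

lemma exp_vHat (ψ : ℝ → ℝ≥0∞) (N n : ℕ) (hn : 1 ≤ n) :
    EReal.exp (vHat ψ N (Real.log n)) =
      ⨅ y : ℝ, ⨅ _ : y ∈ Set.Ioo (0 : ℝ) 1 ∧ ψ (1 / y) < ∞,
        (n : ℝ≥0∞) ^ y * (ψ (1 / y) ^ N / ENNReal.ofReal (y * Real.log (1 + 1 / y))) := by
  rw [vHat, ← EReal.expOrderIso_apply, OrderIso.map_iInf]
  refine iInf_congr fun y => ?_
  rw [OrderIso.map_iInf]
  refine iInf_congr fun hy => ?_
  rw [EReal.expOrderIso_apply, EReal.exp_add, EReal.exp_coe, ofReal_exp_log_mul n hn,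
    ENNReal.exp_log]

/-- This lets the factor `√q` of the moment inequality be replaced by a multiple of `q / log (1 +
q)`, the factor that appears in `vHat`. -/
lemma log_one_add_le_two_mul_sqrt {q : ℝ} (hq : 0 ≤ q) : Real.log (1 + q) ≤ 2 * √q := by
  have h1 : Real.log (1 + q) = 2 * Real.log √(1 + q) := by
    rw [Real.log_sqrt (by linarith)]; ring
  have h2 : Real.log √(1 + q) ≤ √(1 + q) - 1 :=
    Real.log_le_sub_one_of_pos (Real.sqrt_pos.2 (by linarith))
  have h3 : √(1 + q) ≤ 1 + √q := by
    rw [Real.sqrt_le_left (by positivity)]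
    nlinarith [Real.sq_sqrt hq, Real.sqrt_nonneg q]
  linarith

/-- The function `q ψ(q)^N / log (1 + q)`. -/
noncomputable def logMoment (ψ : ℝ → ℝ≥0∞) (N : ℕ) (q : ℝ) : ℝ≥0∞ :=
  ENNReal.ofReal (q / Real.log (1 + q)) * ψ q ^ N

lemma div_ofReal_eq_logMoment (ψ : ℝ → ℝ≥0∞) (N : ℕ) {y : ℝ} (hy : 0 < y) :
    ψ (1 / y) ^ N / ENNReal.ofReal (y * Real.log (1 + 1 / y)) = logMoment ψ N (1 / y) := by
  have hl : 0 < Real.log (1 + 1 / y) := Real.log_pos (by have : 0 < 1 / y := by positivity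
                                                         linarith)
  rw [logMoment, div_eq_mul_inv, ← ENNReal.ofReal_inv_of_pos (by positivity), mul_comm]
  congr 2
  field_simp

lemma ofReal_pow_le_logMoment {ψ : ℝ → ℝ≥0∞} {N : ℕ} {κ q : ℝ} (hq : 0 < q) (hκ : 0 ≤ κ)
    (h : ENNReal.ofReal κ ≤ ψ q) : ENNReal.ofReal (κ ^ N) ≤ logMoment ψ N q := by
  have hl : 0 < Real.log (1 + q) := Real.log_pos (by linarith)
  have h1 : 1 ≤ q / Real.log (1 + q) := by
    rw [le_div_iff₀ hl, one_mul]
    have := Real.log_le_sub_one_of_pos (show 0 < 1 + q by linarith)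
    linarith
  rw [logMoment, ENNReal.ofReal_pow hκ]
  calc ENNReal.ofReal κ ^ N ≤ ψ q ^ N := by gcongr
    _ = ENNReal.ofReal 1 * ψ q ^ N := by simp
    _ ≤ _ := by gcongr

lemma logMoment_le_psiN {ψ : ℝ → ℝ≥0∞} {N : ℕ} {C₀ p : ℝ} (hC : 0 < C₀) (hp : 2 ≤ p) :
    logMoment ψ N p ≤ ENNReal.ofReal C₀ * psiN C₀ ψ N p := by
  have hl : 0 < Real.log p := Real.log_pos (by linarith)
  rw [psiN, logMoment, ← mul_assoc, ← ENNReal.ofReal_mul hC.le]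
  gcongr
  rw [show C₀ * (C₀⁻¹ * p / Real.log p) = p / Real.log p by field_simp]
  have : Real.log p ≤ Real.log (1 + p) := Real.log_le_log (by linarith) (by linarith)
  gcongr

lemma errorWeight_nonneg {r : ℕ → ℝ} {F D : ℝ} (hF : 0 ≤ F) (hD : 0 ≤ D) (N m : ℕ) :
    0 ≤ errorWeight r F D N m := by
  unfold errorWeight; positivity

/-- The factor comparing the error bound with `logMoment`; one is added to make it positive. -/
noncomputable def errorConst (r : ℕ → ℝ) (F D κ : ℝ) (N : ℕ) : ℝ :=
  2 * ∑ m ∈ Finset.Icc 1 N, errorWeight r F D N m * (κ ^ (N - m))⁻¹ + 1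

lemma errorConst_pos {r : ℕ → ℝ} {F D κ : ℝ} {N : ℕ} (hF : 0 ≤ F) (hD : 0 ≤ D) (hκ : 0 < κ) :
    0 < errorConst r F D κ N := by
  have : 0 ≤ ∑ m ∈ Finset.Icc 1 N, errorWeight r F D N m * (κ ^ (N - m))⁻¹ :=
    Finset.sum_nonneg fun m _ => mul_nonneg (errorWeight_nonneg hF hD N m) (by positivity)
  unfold errorConst
  linarith

/-- Lower powers are raised to the `N`-th through `ψ^m ≤ κ^{-(N-m)} ψ^N`. This is where the lower
bound for `ψ_R` enters the constant. -/
lemma errorMoment_le {ψ : ℝ → ℝ≥0∞} {r : ℕ → ℝ} {F D κ q : ℝ} {N : ℕ} (hF : 0 ≤ F) (hD : 0 ≤ D)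
    (hκ : 0 < κ) (hq : 0 < q) (h : ENNReal.ofReal κ ≤ ψ q) :
    errorMoment r F D N ψ q ≤ ENNReal.ofReal (errorConst r F D κ N) * logMoment ψ N q := by
  have hw : ∀ m, 0 ≤ errorWeight r F D N m * (κ ^ (N - m))⁻¹ := fun m =>
    mul_nonneg (errorWeight_nonneg hF hD N m) (by positivity)
  have hl : 0 < Real.log (1 + q) := Real.log_pos (by linarith)
  have h1 : ∀ m ∈ Finset.Icc 1 N, ENNReal.ofReal (errorWeight r F D N m) * ψ q ^ m ≤
      ENNReal.ofReal (errorWeight r F D N m * (κ ^ (N - m))⁻¹) * ψ q ^ N := by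
    intro m hm
    have hmN := (Finset.mem_Icc.1 hm).2
    rw [ENNReal.ofReal_mul (errorWeight_nonneg hF hD N m), mul_assoc]
    gcongr
    rw [ENNReal.ofReal_inv_of_pos (by positivity), ENNReal.ofReal_pow hκ.le, ← pow_mul_pow_sub _ hmN,
      mul_comm, mul_assoc]
    refine le_mul_of_one_le_right' ?_
    have hne : ENNReal.ofReal κ ^ (N - m) ≠ 0 := pow_ne_zero _ (by simpa using hκ)
    rw [← div_eq_mul_inv, ENNReal.le_div_iff_mul_le (Or.inl hne) (Or.inl (by simp)), one_mul]
    gcongr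
  have h2 : √q ≤ 2 * (q / Real.log (1 + q)) := by
    have := log_one_add_le_two_mul_sqrt hq.le
    rw [← mul_div_assoc, le_div_iff₀ hl]
    nlinarith [Real.mul_self_sqrt hq.le, Real.sqrt_nonneg q]
  have hs : 0 ≤ ∑ m ∈ Finset.Icc 1 N, errorWeight r F D N m * (κ ^ (N - m))⁻¹ :=
    Finset.sum_nonneg fun m _ => hw m
  calc errorMoment r F D N ψ q ≤ ENNReal.ofReal (2 * (q / Real.log (1 + q))) *
        ∑ m ∈ Finset.Icc 1 N,
          ENNReal.ofReal (errorWeight r F D N m * (κ ^ (N - m))⁻¹) * ψ q ^ N := by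
        unfold errorMoment
        exact mul_le_mul' (ENNReal.ofReal_le_ofReal h2) (Finset.sum_le_sum h1)
    _ = ENNReal.ofReal (2 * ∑ m ∈ Finset.Icc 1 N, errorWeight r F D N m * (κ ^ (N - m))⁻¹) *
        logMoment ψ N q := by
        rw [← Finset.sum_mul, ← ENNReal.ofReal_sum_of_nonneg fun m _ => hw m, logMoment,
          ENNReal.ofReal_mul zero_le_two, ENNReal.ofReal_mul zero_le_two]
        ring
    _ ≤ _ := by
        gcongr
        unfold errorConst
        linarith

variable {T : Type u} [PseudoMetricSpace T] [CompactSpace T]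

/-- The infimum in `vHat` runs over all `q = 1/y > 1`, that in `chainBound` over `q ≥ p` only. The
factor `logMoment ψ N p` pays for the difference, because `κ^{-N} logMoment` is at least `1`
everywhere. -/
lemma chainBound_le_exp_vHat [Nonempty T] {ψ ρ : ℝ → ℝ≥0∞} {B κ p x : ℝ} {N : ℕ} (hB : 0 < B)
    (hκ : 0 < κ) (hp : 2 ≤ p) (hx : 0 < x) (hψ : ∀ q, 1 ≤ q → ENNReal.ofReal κ ≤ ψ q)
    (hρ : ∀ q, 2 ≤ q → ρ q ≤ ENNReal.ofReal B * logMoment ψ N q) (hfin : logMoment ψ N p < ∞) :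
    chainBound T ρ p x ≤ ENNReal.ofReal (B * (κ ^ N)⁻¹) * logMoment ψ N p *
      EReal.exp (vHat ψ N (entropy T x)) := by
  have hκN : 0 < κ ^ N := by positivity
  have hlow : ∀ q, 1 ≤ q → 1 ≤ ENNReal.ofReal (κ ^ N)⁻¹ * logMoment ψ N q := fun q hq => by
    rw [ENNReal.ofReal_inv_of_pos hκN, ← ENNReal.div_eq_inv_mul,
      ENNReal.le_div_iff_mul_le (by simp [hκN]) (by simp), one_mul]
    exact ofReal_pow_le_logMoment (by linarith) hκ.le (hψ q hq)
  have hpos : logMoment ψ N p ≠ 0 := by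
    have := hlow p (by linarith)
    rintro h0
    simp [h0] at this
  have hc0 : ENNReal.ofReal (B * (κ ^ N)⁻¹) * logMoment ψ N p ≠ 0 :=
    mul_ne_zero (by simp; positivity) hpos
  have hctop : ENNReal.ofReal (B * (κ ^ N)⁻¹) * logMoment ψ N p ≠ ∞ :=
    (ENNReal.mul_lt_top ENNReal.ofReal_lt_top hfin).ne
  have hcard := one_le_coverCard (T := T) hx
  have hcard' : (1 : ℝ≥0∞) ≤ coverCard T x := by exact_mod_cast hcard
  rw [entropy, ← coverCard, exp_vHat _ _ _ hcard, ENNReal.mul_iInf_of_ne hc0 hctop]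
  refine le_iInf fun y => ?_
  rw [ENNReal.mul_iInf_of_ne hc0 hctop]
  refine le_iInf fun hy => ?_
  obtain ⟨⟨hy0, hy1⟩, -⟩ := hy
  have hq1 : 1 ≤ 1 / y := by rw [le_div_iff₀ hy0]; linarith
  rw [div_ofReal_eq_logMoment ψ N hy0, ENNReal.ofReal_mul hB.le]
  -- If `1/y ≥ p`, the exponent `q = 1/y` is admissible and the factor at `p` is spare. Otherwise `q
  -- = p` is used: then `1/p ≤ y`, and the factor at `1/y` is spare.
  rcases le_total p (1 / y) with hpq | hpq
  · refine (iInf₂_le (1 / y) hpq).trans ?_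
    rw [one_div_one_div]
    calc (coverCard T x : ℝ≥0∞) ^ y * ρ (1 / y)
        ≤ (coverCard T x : ℝ≥0∞) ^ y * (ENNReal.ofReal B * logMoment ψ N (1 / y)) := by
          gcongr; exact hρ _ (hp.trans hpq)
      _ ≤ (coverCard T x : ℝ≥0∞) ^ y * (ENNReal.ofReal B * logMoment ψ N (1 / y)) *
          (ENNReal.ofReal (κ ^ N)⁻¹ * logMoment ψ N p) :=
          le_mul_of_one_le_right' (hlow p (by linarith))
      _ = _ := by ring
  · refine (iInf₂_le p le_rfl).trans ?_
    calc (coverCard T x : ℝ≥0∞) ^ (1 / p) * ρ p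
        ≤ (coverCard T x : ℝ≥0∞) ^ y * (ENNReal.ofReal B * logMoment ψ N p) := by
          refine mul_le_mul' (ENNReal.rpow_le_rpow_of_exponent_le hcard' ?_) (hρ p hp)
          rw [div_le_iff₀ (by linarith)]
          rw [div_le_iff₀ hy0] at hpq
          linarith
      _ ≤ (coverCard T x : ℝ≥0∞) ^ y * (ENNReal.ofReal B * logMoment ψ N p) *
          (ENNReal.ofReal (κ ^ N)⁻¹ * logMoment ψ N (1 / y)) :=
          le_mul_of_one_le_right' (hlow _ hq1)
      _ = _ := by ring

lemma rpow_eq_exp_neg {s C u I p : ℝ} (hs : 0 < s) (hC : 0 < C) (hu : 0 < u) (hI : 0 ≤ I) :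
    ENNReal.ofReal (C * s * (1 + I) / u) ^ p =
      EReal.exp (-(((p * Real.log (C⁻¹ * u / (1 + I)) : ℝ) : EReal) -
        (p : EReal) * ENNReal.log (ENNReal.ofReal s))) := by
  rw [ENNReal.log_ofReal_of_pos hs, ← EReal.coe_mul, ← EReal.coe_sub, ← EReal.coe_neg,
    EReal.exp_coe, ENNReal.ofReal_rpow_of_pos (by positivity)]
  congr 1
  rw [Real.rpow_def_of_pos (by positivity)]
  congr 1
  have h1 : C * s * (1 + I) / u = s / (C⁻¹ * u / (1 + I)) := by field_simp
  rw [h1, Real.log_div hs.ne' (by positivity)]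
  ring

lemma le_exp_neg_wStar {ψ : ℝ → ℝ≥0∞} {Q : ℝ≥0∞} {z : ℝ}
    (h : ∀ p, 2 ≤ p → ψ p < ∞ →
      Q ≤ EReal.exp (-(((p * z : ℝ) : EReal) - (p : EReal) * ENNReal.log (ψ p)))) :
    Q ≤ EReal.exp (-wStar ψ z) := by
  rw [← ENNReal.log_le_log_iff, EReal.log_exp, EReal.le_neg]
  refine iSup_le fun p => iSup_le fun hp => ?_
  rw [EReal.le_neg, ← EReal.log_exp (-_), ENNReal.log_le_log_iff]
  exact h p hp.1 hp.2

variable [MeasurableSpace T] [OpensMeasurableSpace T]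
  {μ : Measure T} [IsProbabilityMeasure μ] {K : T → T → ℝ} {f : T → ℝ}
  {Ω : Type v} [MeasurableSpace Ω] {P : Measure Ω} [IsProbabilityMeasure P]
  {ξ : ℕ → ℕ → ℕ → Ω → T}

lemma Qbar_zero_eq_zero (h : Setting μ K f) (hξ : IsSample μ P ξ) {F : ℝ} (hF : ∀ t, |f t| ≤ F)
    {u : ℝ} (hu : 0 < u) : Qbar μ K f P ξ 0 u = 0 := by
  have := Qbar_le_chainBound (r := fun _ => 0) (N := 0) h dist_le_diam_univ hF hξ (by simp)
    (p := 2) le_rfl hu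
  have h0 : ∀ x, chainBound T (errorMoment (fun _ => 0) F (Metric.diam (Set.univ : Set T)) 0
      (psiR μ K)) 2 x = 0 := fun x =>
    nonpos_iff_eq_zero.1 ((iInf₂_le 2 le_rfl).trans (by simp [errorMoment]))
  simpa [h0] using this

theorem Qbar_le_exp_neg_wStar {C₀ F D κ : ℝ} {N : ℕ} {r : ℕ → ℝ} (hC₀ : 0 < C₀) (hκ : 0 < κ)
    (hF0 : 0 ≤ F) (hD0 : 0 ≤ D)
    (h : Setting μ K f) (hξ : IsSample μ P ξ) (hF : ∀ t, |f t| ≤ F)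
    (hD : ∀ t s : T, dist t s ≤ D) (hψ : ENNReal.ofReal κ ≤ psiR μ K 1)
    (hr : ∀ m ∈ Finset.Icc 1 N, rU μ K m = r m) (hI : IHat μ K N < ∞) {u : ℝ} (hu : 0 < u) :
    Qbar μ K f P ξ N u ≤ EReal.exp (-wStar (psiN C₀ (psiR μ K) N)
      (Real.log ((5 * (errorConst r F D κ N * (κ ^ N)⁻¹) * C₀)⁻¹ * u /
        (1 + (IHat μ K N).toReal)))) := by
  rcases Nat.eq_zero_or_pos N with rfl | hN
  · rw [Qbar_zero_eq_zero h hξ hF hu]; exact zero_le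
  have : Nonempty T := nonempty_of_isProbabilityMeasure μ
  have hψ' : ∀ q, 1 ≤ q → ENNReal.ofReal κ ≤ psiR μ K q := fun q hq =>
    hψ.trans (psiR_mono h.measurable_kernel one_pos hq)
  have hB := errorConst_pos (r := r) (N := N) hF0 hD0 hκ
  -- The `5` comes from chaining, `errorConst` from the moments of the error, `κ^{-N}` from the
  -- comparison of exponents, and `C₀` from the normalization of `psiN`.
  set C := 5 * (errorConst r F D κ N * (κ ^ N)⁻¹) * C₀ with hC
  have hCpos : 0 < C := by positivity
  refine le_exp_neg_wStar fun p hp hfin => ?_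
  have hl : 0 < Real.log p := Real.log_pos (by linarith)
  have hp0 : 0 < p := by linarith
  have hlog := logMoment_le_psiN (ψ := psiR μ K) (N := N) hC₀ hp
  have hlogfin : logMoment (psiR μ K) N p < ∞ :=
    hlog.trans_lt (ENNReal.mul_lt_top ENNReal.ofReal_lt_top hfin)
  -- Positivity keeps `log ψ_{(N)}(p)` away from `-∞`, so that the exponent can be computed in the
  -- reals.
  have hpos : 0 < (psiN C₀ (psiR μ K) N p).toReal := by
    refine ENNReal.toReal_pos ?_ hfin.ne
    rw [psiN]
    refine mul_ne_zero (by simp; positivity) (pow_ne_zero _ ?_)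
    exact ((ENNReal.ofReal_pos.2 hκ).trans_le (hψ' p (by linarith))).ne'
  have heq : psiN C₀ (psiR μ K) N p = ENNReal.ofReal (psiN C₀ (psiR μ K) N p).toReal :=
    (ENNReal.ofReal_toReal hfin.ne).symm
  rw [heq, ← rpow_eq_exp_neg hpos hCpos hu ENNReal.toReal_nonneg]
  refine (Qbar_le_chainBound h hD hF hξ hr hp hu).trans ?_
  refine ENNReal.rpow_le_rpow ?_ hp0.le
  have hint : ∫⁻ x in Ioc (0 : ℝ) 1, chainBound T (errorMoment r F D N (psiR μ K)) p x ≤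
      ENNReal.ofReal (errorConst r F D κ N * (κ ^ N)⁻¹) * logMoment (psiR μ K) N p *
        IHat μ K N := by
    rw [IHat, ← lintegral_const_mul' _ _
      (ENNReal.mul_lt_top ENNReal.ofReal_lt_top hlogfin).ne]
    refine setLIntegral_mono' measurableSet_Ioc fun x hx => ?_
    exact chainBound_le_exp_vHat hB hκ hp hx.1 hψ'
      (fun q hq => errorMoment_le hF0 hD0 hκ (by linarith) (hψ' q (by linarith))) hlogfin
  rw [ENNReal.ofReal_div_of_pos hu]
  gcongr
  calc _ ≤ 5 * (ENNReal.ofReal (errorConst r F D κ N * (κ ^ N)⁻¹) *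
        (ENNReal.ofReal C₀ * psiN C₀ (psiR μ K) N p) * (1 + IHat μ K N)) := by
        refine mul_le_mul' le_rfl (hint.trans ?_)
        gcongr
        exact le_add_self
    _ = _ := by
        have hCe : ENNReal.ofReal C =
            5 * ENNReal.ofReal (errorConst r F D κ N * (κ ^ N)⁻¹) * ENNReal.ofReal C₀ := by
          rw [hC, ENNReal.ofReal_mul (by positivity), ENNReal.ofReal_mul (by norm_num),
            ENNReal.ofReal_ofNat]
        rw [ENNReal.ofReal_mul (p := C * (psiN C₀ (psiR μ K) N p).toReal) (by positivity),
          ENNReal.ofReal_mul hCpos.le, hCe,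
          ENNReal.ofReal_toReal hfin.ne, ENNReal.ofReal_add zero_le_one ENNReal.toReal_nonneg,
          ENNReal.ofReal_toReal hI.ne, ENNReal.ofReal_one]
        ring

end GeneralBound

/-! ### Power growth of `ψ_R` from the tail of the envelope -/

section MomentGrowth

/-- The inequality `x ≤ e^x` at `x = c y / s`, raised to the power `s`. -/
lemma rpow_le_mul_exp {y c s : ℝ} (hy : 0 ≤ y) (hc : 0 < c) (hs : 0 < s) :
    y ^ s ≤ (s / c) ^ s * Real.exp (c * y) := by
  have h1 : y ≤ s / c * Real.exp (c * y / s) := by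
    have := Real.add_one_le_exp (c * y / s)
    have h2 : y = s / c * (c * y / s) := by field_simp
    nth_rw 1 [h2]
    have : 0 < s / c := by positivity
    gcongr
    linarith
  calc y ^ s ≤ (s / c * Real.exp (c * y / s)) ^ s := Real.rpow_le_rpow hy h1 hs.le
    _ = _ := by
        rw [Real.mul_rpow (by positivity) (Real.exp_pos _).le, ← Real.exp_mul]
        congr 2
        field_simp

/-- A discrete layer-cake bound: the term with `j + 1 < y ≤ j + 2` alone suffices. The levels start
at `1` because tails are known from there on only. -/
lemma ofReal_exp_le_tsum {c : ℝ} (hc : 0 < c) (y : ℝ) :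
    ENNReal.ofReal (Real.exp (c * y)) ≤ ENNReal.ofReal (Real.exp c) +
      ∑' j : ℕ, ENNReal.ofReal (Real.exp (c * (j + 2))) *
        (Set.Ioi ((j : ℝ) + 1)).indicator (fun _ => 1) y := by
  rcases le_or_gt y 1 with h | h
  · refine le_add_right (ENNReal.ofReal_le_ofReal (Real.exp_le_exp.2 ?_))
    nlinarith
  · have h2 : 2 ≤ ⌈y⌉₊ := Nat.lt_ceil.2 (by simpa using h)
    obtain ⟨j, hj⟩ : ∃ j, ⌈y⌉₊ = j + 2 := ⟨⌈y⌉₊ - 2, by omega⟩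
    have h3 : y ≤ j + 2 := by
      have := Nat.le_ceil y
      rw [hj] at this
      exact_mod_cast this
    have h4 : (j : ℝ) + 1 < y := by
      have : j + 1 < ⌈y⌉₊ := by omega
      have := Nat.lt_ceil.1 this
      exact_mod_cast this
    refine le_add_left (le_trans ?_ (ENNReal.le_tsum j))
    rw [Set.indicator_of_mem (show y ∈ Set.Ioi ((j : ℝ) + 1) from h4), mul_one]
    exact ENNReal.ofReal_le_ofReal (Real.exp_le_exp.2 (by nlinarith))

lemma tsum_ofReal_exp_lt_top {c : ℝ} (hc : 0 < c) :
    ∑' j : ℕ, ENNReal.ofReal (Real.exp (-(c * j))) < ∞ := by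
  have h1 : ∀ j : ℕ, ENNReal.ofReal (Real.exp (-(c * j))) = ENNReal.ofReal (Real.exp (-c)) ^ j :=
    fun j => by
      rw [← ENNReal.ofReal_pow (Real.exp_pos _).le, ← Real.exp_nat_mul]
      congr 2; ring
  simp_rw [h1, ENNReal.tsum_geometric]
  rw [ENNReal.inv_lt_top, tsub_pos_iff_lt, ← ENNReal.ofReal_one]
  exact (ENNReal.ofReal_lt_ofReal_iff one_pos).2 (by simpa using hc)

/-- The bound for the exponential moment of `R^{1/β}` used below. -/
noncomputable def expMomentBound (c : ℝ) : ℝ≥0∞ :=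
  ENNReal.ofReal (Real.exp c) + ∑' j : ℕ, ENNReal.ofReal (Real.exp (-(c * j)))

lemma expMomentBound_lt_top {c : ℝ} (hc : 0 < c) : expMomentBound c < ∞ :=
  ENNReal.add_lt_top.2 ⟨ENNReal.ofReal_lt_top, tsum_ofReal_exp_lt_top hc⟩

lemma one_le_expMomentBound {c : ℝ} (hc : 0 < c) : 1 ≤ expMomentBound c := by
  refine le_add_right ?_
  rw [← ENNReal.ofReal_one]
  exact ENNReal.ofReal_le_ofReal (Real.one_le_exp hc.le)

variable {T : Type u} [MeasurableSpace T] {μ : Measure T} [IsProbabilityMeasure μ]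

/-- With `y = R^{1/β}`, the power `R^p = y^{βp}` is compared with `e^{cy}` at half of the tail rate
`2c`. Level `j` then contributes `e^{c(j+2)} e^{-2c(j+1)} = e^{-cj}`, which is summable. -/
lemma lintegral_rpow_le_of_tail {R : T → ℝ≥0∞} (hR : Measurable R) (hfin : ∀ᵐ x ∂μ, R x < ∞)
    {β c : ℝ} (hβ : 0 < β) (hc : 0 < c)
    (htail : ∀ u : ℝ, 1 ≤ u → μ {x | ENNReal.ofReal u < R x} ≤
      ENNReal.ofReal (Real.exp (-(2 * c) * u ^ (1 / β)))) {p : ℝ} (hp : 0 < p) :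
    ∫⁻ x, R x ^ p ∂μ ≤ ENNReal.ofReal ((β * p / c) ^ (β * p)) * expMomentBound c := by
  have hset : ∀ j : ℕ, MeasurableSet {x | ENNReal.ofReal (((j : ℝ) + 1) ^ β) < R x} := fun j =>
    measurableSet_lt measurable_const hR
  have hpt : ∀ᵐ x ∂μ, R x ^ p ≤ ENNReal.ofReal ((β * p / c) ^ (β * p)) *
      (ENNReal.ofReal (Real.exp c) + ∑' j : ℕ, ENNReal.ofReal (Real.exp (c * (j + 2))) *
        {x | ENNReal.ofReal (((j : ℝ) + 1) ^ β) < R x}.indicator (fun _ => 1) x) := by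
    filter_upwards [hfin] with x hx
    set a := (R x).toReal with ha
    have ha0 : 0 ≤ a := ENNReal.toReal_nonneg
    have hRa : R x = ENNReal.ofReal a := (ENNReal.ofReal_toReal hx.ne).symm
    set y := a ^ (1 / β) with hy
    have hy0 : 0 ≤ y := by positivity
    have hya : a = y ^ β := by
      rw [hy, ← Real.rpow_mul ha0, one_div_mul_cancel hβ.ne', Real.rpow_one]
    have h1 : R x ^ p = ENNReal.ofReal (y ^ (β * p)) := by
      rw [hRa, ENNReal.ofReal_rpow_of_nonneg ha0 hp.le, Real.rpow_mul hy0, ← hya]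
    have h2 := rpow_le_mul_exp hy0 hc (mul_pos hβ hp)
    rw [h1]
    refine (ENNReal.ofReal_le_ofReal h2).trans ?_
    rw [ENNReal.ofReal_mul (by positivity)]
    gcongr
    refine (ofReal_exp_le_tsum hc y).trans (le_of_eq ?_)
    congr 1
    refine tsum_congr fun j => ?_
    congr 1
    have hiff : y ∈ Set.Ioi ((j : ℝ) + 1) ↔
        x ∈ {x | ENNReal.ofReal (((j : ℝ) + 1) ^ β) < R x} := by
      rw [Set.mem_Ioi, Set.mem_ofPred_eq, hRa, hya, ENNReal.ofReal_lt_ofReal_iff_of_nonneg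
        (by positivity), Real.rpow_lt_rpow_iff (by positivity) hy0 hβ]
    by_cases hmem : y ∈ Set.Ioi ((j : ℝ) + 1)
    · rw [Set.indicator_of_mem hmem, Set.indicator_of_mem (hiff.1 hmem)]
    · rw [Set.indicator_of_notMem hmem, Set.indicator_of_notMem fun h => hmem (hiff.2 h)]
  have hind : ∀ j : ℕ, Measurable fun x => ENNReal.ofReal (Real.exp (c * (j + 2))) *
        {x | ENNReal.ofReal (((j : ℝ) + 1) ^ β) < R x}.indicator (fun _ => (1 : ℝ≥0∞)) x :=
    fun j => (measurable_const.indicator (hset j)).const_mul _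
  refine (lintegral_mono_ae hpt).trans ?_
  rw [lintegral_const_mul' _ _ ENNReal.ofReal_ne_top, lintegral_add_left measurable_const,
    lintegral_const, measure_univ, mul_one, lintegral_tsum fun j => (hind j).aemeasurable]
  unfold expMomentBound
  gcongr with j
  rw [lintegral_const_mul' _ _ ENNReal.ofReal_ne_top, lintegral_indicator (hset j), lintegral_const,
    one_mul, Measure.restrict_apply_univ]
  have hj : (1 : ℝ) ≤ ((j : ℝ) + 1) ^ β :=
    Real.one_le_rpow (by linarith [(Nat.cast_nonneg j : (0 : ℝ) ≤ j)]) hβ.le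
  refine (mul_le_mul' le_rfl (htail _ hj)).trans ?_
  rw [← Real.rpow_mul (by positivity), mul_one_div_cancel hβ.ne', Real.rpow_one,
    ← ENNReal.ofReal_mul (Real.exp_pos _).le, ← Real.exp_add]
  apply le_of_eq
  congr 2
  ring

variable {K : T → T → ℝ}

/-- The factor in the bound `ψ_R(p) ≤ A p^β`. -/
noncomputable def momentConst (β C₂ : ℝ) : ℝ :=
  1 + C₂ + (β / (C₂ / 2)) ^ β * (expMomentBound (C₂ / 2)).toReal

lemma one_le_momentConst {β C₂ : ℝ} (hβ : 0 ≤ β) (hC : 0 < C₂) : 1 ≤ momentConst β C₂ := by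
  have : 0 ≤ (β / (C₂ / 2)) ^ β * (expMomentBound (C₂ / 2)).toReal := by positivity
  unfold momentConst
  linarith

/-- The `p`-th root turns `(βp/c)^{βp}` into `(βp/c)^β`, and the exponential moment, being at least
`1`, only decreases under the root. One constant covers both `β > 0` and the bounded case. -/
lemma psiR_le_of_envelopeTail (hK : Measurable (Function.uncurry K))
    (hfin : ∀ᵐ x ∂μ, envelope μ K x < ∞) {β C₂ : ℝ} (hC : 0 < C₂) (h : EnvelopeTail μ K β C₂)
    {p : ℝ} (hp : 1 ≤ p) : psiR μ K p ≤ ENNReal.ofReal (momentConst β C₂ * p ^ β) := by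
  have hp0 : 0 < p := by linarith
  rcases h with ⟨hβ, htail⟩ | ⟨rfl, hbdd⟩
  · have hc : 0 < C₂ / 2 := by positivity
    have h1 := lintegral_rpow_le_of_tail (measurable_envelope hK) hfin hβ hc
      (fun u hu => by rw [mul_div_cancel₀ _ two_ne_zero]; exact htail u hu) hp0
    calc psiR μ K p ≤ (ENNReal.ofReal ((β * p / (C₂ / 2)) ^ (β * p)) *
          expMomentBound (C₂ / 2)) ^ (1 / p) := ENNReal.rpow_le_rpow h1 (by positivity)
      _ = ENNReal.ofReal ((β * p / (C₂ / 2)) ^ β) * expMomentBound (C₂ / 2) ^ (1 / p) := by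
          rw [ENNReal.mul_rpow_of_nonneg _ _ (by positivity),
            ENNReal.ofReal_rpow_of_nonneg (by positivity) (by positivity),
            ← Real.rpow_mul (by positivity)]
          congr 3
          field_simp
      _ ≤ ENNReal.ofReal ((β * p / (C₂ / 2)) ^ β) * expMomentBound (C₂ / 2) := by
          gcongr
          refine (ENNReal.rpow_le_rpow_of_exponent_le (one_le_expMomentBound hc)
            ((div_le_one hp0).2 hp)).trans ?_
          rw [ENNReal.rpow_one]
      _ = ENNReal.ofReal ((β * p / (C₂ / 2)) ^ β * (expMomentBound (C₂ / 2)).toReal) := by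
          rw [ENNReal.ofReal_mul (by positivity),
            ENNReal.ofReal_toReal (expMomentBound_lt_top hc).ne]
      _ ≤ _ := by
          apply ENNReal.ofReal_le_ofReal
          have e1 : (β * p / (C₂ / 2)) ^ β = (β / (C₂ / 2)) ^ β * p ^ β := by
            rw [← Real.mul_rpow (by positivity) hp0.le]; congr 1; ring
          have e2 : 0 ≤ p ^ β := by positivity
          rw [e1, momentConst]
          nlinarith
  · have h1 : ∫⁻ x, envelope μ K x ^ p ∂μ ≤ ENNReal.ofReal C₂ ^ p := by
      refine (lintegral_mono_ae (g := fun _ => ENNReal.ofReal C₂ ^ p) ?_).trans (by simp)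
      filter_upwards [hbdd] with x hx
      exact ENNReal.rpow_le_rpow hx hp0.le
    calc psiR μ K p ≤ (ENNReal.ofReal C₂ ^ p) ^ (1 / p) :=
          ENNReal.rpow_le_rpow h1 (by positivity)
      _ = ENNReal.ofReal C₂ := by
          rw [← ENNReal.rpow_mul, mul_one_div_cancel hp0.ne', ENNReal.rpow_one]
      _ ≤ _ := by
          apply ENNReal.ofReal_le_ofReal
          have : 0 ≤ (0 / (C₂ / 2)) ^ (0 : ℝ) * (expMomentBound (C₂ / 2)).toReal := by positivity
          rw [Real.rpow_zero p, momentConst]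
          linarith

end MomentGrowth

/-! ### Entropy of `T` under a logarithmic modulus -/

section Covering

/-- One point of `T` is picked in each occupied cell, so the centres lie in `T`. -/
lemma coverCard_le_card {T : Type u} [PseudoMetricSpace T] {ι' : Type*} {x : ℝ} (cell : T → ι')
    (S : Finset ι') (hS : ∀ t, cell t ∈ S)
    (hx : ∀ t s, cell t = cell s → edist t s ≤ ENNReal.ofReal x) : coverCard T x ≤ S.card := by
  rcases isEmpty_or_nonempty T with hT | hT
  · rw [coverCard, Set.eq_empty_of_isEmpty (Set.univ : Set T), Metric.coveringNumber_empty]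
    simp
  set C : Set T := Function.invFun cell '' Set.range cell with hC
  have hcov : Metric.IsCover x.toNNReal (Set.univ : Set T) C := by
    intro t _
    refine ⟨_, ⟨cell t, mem_range_self t, rfl⟩, ?_⟩
    exact hx _ _ (Function.invFun_eq ⟨t, rfl⟩).symm
  have h1 : Metric.coveringNumber x.toNNReal (Set.univ : Set T) ≤ (S.card : ℕ∞) :=
    calc _ ≤ C.encard := hcov.coveringNumber_le_encard (subset_univ _)
      _ ≤ (Set.range cell).encard := Set.encard_image_le _ _
      _ ≤ (S : Set ι').encard := Set.encard_le_encard (by rintro _ ⟨t, rfl⟩; exact hS t)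
      _ = _ := Set.encard_coe_eq_coe_finsetCard S
  exact ENat.toNat_le_of_le_natCast h1

lemma norm_sub_le_of_floor_eq {k : ℕ} {a b : EuclideanSpace ℝ (Fin k)} {h : ℝ} (hh : 0 < h)
    (hab : ∀ i, ⌊a i / h⌋ = ⌊b i / h⌋) : ‖a - b‖ ≤ (k + 1) * h := by
  have h1 : ∀ i, ‖(a - b) i‖ ≤ h := fun i => by
    have := Int.abs_sub_lt_one_of_floor_eq_floor (hab i)
    rw [← sub_div, abs_div, abs_of_pos hh, div_lt_one hh] at this
    simpa using this.le
  rw [EuclideanSpace.norm_eq, Real.sqrt_le_left (by positivity)]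
  calc ∑ i, ‖(a - b) i‖ ^ 2 ≤ ∑ _i : Fin k, h ^ 2 := by
        gcongr with i
        exact h1 i
    _ = k * h ^ 2 := by simp
    _ ≤ ((k + 1) * h) ^ 2 := by
        rw [mul_pow]
        gcongr
        nlinarith [(Nat.cast_nonneg k : (0 : ℝ) ≤ k)]

/-- Cubes of side `δ/(k + 1)` have diameter at most `δ`; using `k + 1` in place of `√k` also covers
`k = 0`. The `3` absorbs the rounding at both ends of each axis. -/
lemma coverCard_le_of_modulus {T : Type u} [PseudoMetricSpace T] {k : ℕ}
    {ι : T → EuclideanSpace ℝ (Fin k)} {L δ x : ℝ} (hL : 0 ≤ L) (hδ : 0 < δ) (hδ1 : δ ≤ 1)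
    (hι : ∀ t, ‖ι t‖ ≤ L)
    (hd : ∀ t s, ‖ι t - ι s‖ ≤ δ → edist t s ≤ ENNReal.ofReal x) :
    (coverCard T x : ℝ) ≤ ((2 * L * (k + 1) + 3) / δ) ^ k := by
  have hk : (0 : ℝ) < k + 1 := by positivity
  set h : ℝ := δ / (k + 1) with hh
  have hh0 : 0 < h := by positivity
  set m : ℤ := ⌊L / h⌋ + 1 with hm
  have hm0 : 0 ≤ m := by
    have : 0 ≤ ⌊L / h⌋ := Int.floor_nonneg.2 (by positivity)
    omega
  have hcell : ∀ t i, ⌊ι t i / h⌋ ∈ Finset.Icc (-m) m := fun t i => by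
    have h1 : |ι t i| ≤ L := by
      have := PiLp.norm_apply_le (ι t) i
      rw [Real.norm_eq_abs] at this
      exact this.trans (hι t)
    have h2 : L / h < m := by rw [hm]; push_cast; exact Int.lt_floor_add_one _
    have h3 := abs_le.1 h1
    rw [Finset.mem_Icc]
    constructor
    · rw [Int.le_floor]
      push_cast
      have : -(L / h) ≤ ι t i / h := by rw [← neg_div]; gcongr; exact h3.1
      linarith
    · have h4 : ι t i / h ≤ L / h := by gcongr; exact h3.2
      have : ((⌊ι t i / h⌋ : ℤ) : ℝ) < m := (Int.floor_le _).trans_lt (h4.trans_lt h2)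
      exact_mod_cast this.le
  have h1 := coverCard_le_card (x := x) (fun t i => ⌊ι t i / h⌋)
    (Fintype.piFinset fun _ : Fin k => Finset.Icc (-m) m)
    (fun t => Fintype.mem_piFinset.2 fun i => hcell t i) fun t s hts => by
      refine hd t s ((norm_sub_le_of_floor_eq hh0 fun i => congrFun hts i).trans (le_of_eq ?_))
      rw [hh]; field_simp
  rw [Fintype.card_piFinset_const, Int.card_Icc] at h1
  have h2 : (((m + 1 - -m).toNat : ℕ) : ℝ) ≤ (2 * L * (k + 1) + 3) / δ := by
    have e1 : (((m + 1 - -m).toNat : ℕ) : ℝ) = 2 * m + 1 := by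
      have : (((m + 1 - -m).toNat : ℕ) : ℤ) = 2 * m + 1 := by
        rw [Int.toNat_of_nonneg (by omega)]; ring
      exact_mod_cast this
    have e2 : (m : ℝ) ≤ L / h + 1 := by
      rw [hm]; push_cast
      linarith [Int.floor_le (L / h)]
    have e3 : L / h = L * (k + 1) / δ := by rw [hh]; field_simp
    have e4 : 3 ≤ 3 / δ := by rw [le_div_iff₀ hδ]; linarith
    have e5 : (2 * L * (k + 1) + 3) / δ = 2 * (L * (k + 1) / δ) + 3 / δ := by ring
    rw [e1, e5, ← e3]
    linarith
  calc (coverCard T x : ℝ) ≤ (((m + 1 - -m).toNat ^ k : ℕ) : ℝ) := by exact_mod_cast h1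
    _ = (((m + 1 - -m).toNat : ℕ) : ℝ) ^ k := by push_cast; rfl
    _ ≤ _ := by gcongr

/-- The factor in the entropy bound `H(T,d,x) ≤ a x^{-1/γ}`. -/
noncomputable def entropyConst (C₃ γ L : ℝ) (k : ℕ) : ℝ :=
  1 + k * (Real.log (2 * |L| * (k + 1) + 3) + C₃ ^ (1 / γ))

lemma one_le_entropyConst {C₃ γ L : ℝ} (k : ℕ) (hC : 0 < C₃) : 1 ≤ entropyConst C₃ γ L k := by
  have h1 : 0 ≤ Real.log (2 * |L| * (k + 1) + 3) := Real.log_nonneg (by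
    have : 0 ≤ 2 * |L| * ((k : ℝ) + 1) := by positivity
    linarith)
  have : 0 ≤ (k : ℝ) * (Real.log (2 * |L| * (k + 1) + 3) + C₃ ^ (1 / γ)) := by positivity
  unfold entropyConst
  linarith

variable {T : Type u} [PseudoMetricSpace T] [CompactSpace T] [MeasurableSpace T]
  {μ : Measure T} {K : T → T → ℝ} {f : T → ℝ} {k : ℕ} {ι : T → EuclideanSpace ℝ (Fin k)}
  {γ C₃ L : ℝ}

lemma Setting.dist_le_of_logModulus (h : Setting μ K f) (hC : 0 < C₃)
    (hmod : LogModulus μ K ι γ C₃) (t s : T) : dist t s ≤ C₃ := by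
  rcases eq_or_ne t s with rfl | hts
  · simpa using hC.le
  · rw [dist_edist, h.edist_eq]
    refine ENNReal.toReal_le_of_le_ofReal hC.le ((hmod t s hts).trans ?_)
    exact (mul_le_mul' le_rfl (min_le_right _ _)).trans_eq (mul_one _)

/-- The threshold solves `C₃ l^{-γ} = x` for `l = |log |t - s||`. Injectivity of `ι` excludes `|t -
s| = 0` for distinct points, where the real logarithm is `0` by convention. -/
lemma Setting.edist_le_of_logModulus (h : Setting μ K f) (hC : 0 < C₃) (hγ : 0 < γ)
    (hmod : LogModulus μ K ι γ C₃) (hι : Function.Injective ι) {x : ℝ} (hx : 0 < x) {t s : T}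
    (hts : ‖ι t - ι s‖ ≤ Real.exp (-(C₃ / x) ^ (1 / γ))) : edist t s ≤ ENNReal.ofReal x := by
  rcases eq_or_ne t s with rfl | hne
  · simp
  set l := (C₃ / x) ^ (1 / γ) with hl
  have hl0 : 0 < l := by positivity
  have hpos : 0 < ‖ι t - ι s‖ := norm_pos_iff.2 (sub_ne_zero.2 fun e => hne (hι e))
  have h1 : l ≤ |Real.log ‖ι t - ι s‖| := by
    have : Real.log ‖ι t - ι s‖ ≤ -l := by rwa [Real.log_le_iff_le_exp hpos]
    exact le_trans (by linarith) (neg_le_abs _)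
  rw [h.edist_eq]
  calc naturalDist μ K t s ≤ ENNReal.ofReal C₃ * ENNReal.ofReal |Real.log ‖ι t - ι s‖| ^ (-γ) :=
        (hmod t s hne).trans (mul_le_mul' le_rfl (min_le_left _ _))
    _ ≤ ENNReal.ofReal C₃ * ENNReal.ofReal l ^ (-γ) := by
        gcongr 1
        rw [ENNReal.rpow_neg, ENNReal.rpow_neg, ENNReal.inv_le_inv]
        gcongr
    _ = ENNReal.ofReal x := by
        rw [ENNReal.ofReal_rpow_of_pos hl0, ← ENNReal.ofReal_mul hC.le, hl,
          ← Real.rpow_mul (by positivity)]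
        congr 1
        rw [show 1 / γ * -γ = -1 by field_simp, Real.rpow_neg_one]
        field_simp

/-- A mesh `e^{-l}` costs `k (const + l)` in entropy, with `l` proportional to `x^{-1/γ}`. The
constant is absorbed since `x ≤ 1`. -/
lemma Setting.log_coverCard_le [Nonempty T] (h : Setting μ K f) (hC : 0 < C₃) (hγ : 0 < γ)
    (hmod : LogModulus μ K ι γ C₃) (hι : Function.Injective ι) (hL : ∀ t, ‖ι t‖ ≤ L) {x : ℝ}
    (hx : 0 < x) (hx1 : x ≤ 1) :
    Real.log (coverCard T x) ≤ entropyConst C₃ γ L k * x ^ (-(1 / γ)) := by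
  set l := (C₃ / x) ^ (1 / γ) with hl
  have hl0 : 0 < l := by positivity
  have h1 := coverCard_le_of_modulus (abs_nonneg L) (Real.exp_pos (-l))
    (Real.exp_le_one_iff.2 (by linarith)) (fun t => (hL t).trans (le_abs_self L))
    fun t s => h.edist_le_of_logModulus hC hγ hmod hι hx (t := t) (s := s)
  have hc : (1 : ℝ) ≤ coverCard T x := by exact_mod_cast one_le_coverCard (T := T) hx
  have h2 := Real.log_le_log (by linarith) h1
  have hb : 0 < 2 * |L| * ((k : ℝ) + 1) + 3 := by positivity
  rw [Real.log_pow, Real.log_div hb.ne' (Real.exp_pos _).ne', Real.log_exp, sub_neg_eq_add] at h2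
  have hx2 : 1 ≤ x ^ (-(1 / γ)) := by
    apply Real.one_le_rpow_of_pos_of_le_one_of_nonpos hx hx1
    have : 0 < 1 / γ := by positivity
    linarith
  have hl2 : l = C₃ ^ (1 / γ) * x ^ (-(1 / γ)) := by
    rw [hl, Real.div_rpow hC.le hx.le, Real.rpow_neg hx.le]; rfl
  have hlog : 0 ≤ Real.log (2 * |L| * (k + 1) + 3) := Real.log_nonneg (by
    have : 0 ≤ 2 * |L| * ((k : ℝ) + 1) := by positivity
    linarith)
  refine h2.trans ?_
  have h4 : entropyConst C₃ γ L k * x ^ (-(1 / γ)) = x ^ (-(1 / γ)) +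
      k * (Real.log (2 * |L| * (k + 1) + 3) * x ^ (-(1 / γ)) + C₃ ^ (1 / γ) * x ^ (-(1 / γ))) := by
    unfold entropyConst; ring
  rw [hl2, h4]
  have h3 : (k : ℝ) * (Real.log (2 * |L| * (k + 1) + 3) + C₃ ^ (1 / γ) * x ^ (-(1 / γ))) ≤
      k * (Real.log (2 * |L| * (k + 1) + 3) * x ^ (-(1 / γ)) + C₃ ^ (1 / γ) * x ^ (-(1 / γ))) := by
    gcongr
    nlinarith
  linarith

end Covering

/-! ### The example: power growth of moments and entropy -/

section LogExample

lemma natCast_rpow_one_div_le_exp_one {n : ℕ} {q : ℝ} (hn : 1 ≤ n) (hq : 0 < q)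
    (h : Real.log n ≤ q) : (n : ℝ≥0∞) ^ (1 / q) ≤ ENNReal.ofReal (Real.exp 1) := by
  rw [← ofReal_exp_log_mul n hn]
  apply ENNReal.ofReal_le_ofReal (Real.exp_le_exp.2 _)
  rw [mul_one_div, div_le_one hq]
  exact h

lemma psi_pow_le {ψ : ℝ → ℝ≥0∞} {A β q : ℝ} {m N : ℕ} (hA : 1 ≤ A) (hβ : 0 ≤ β) (hq : 1 ≤ q)
    (hm : m ≤ N) (h : ψ q ≤ ENNReal.ofReal (A * q ^ β)) :
    ψ q ^ m ≤ ENNReal.ofReal (A ^ N * q ^ (β * N)) := by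
  have h1 : 1 ≤ q ^ β := Real.one_le_rpow hq hβ
  have h2 : 1 ≤ A * q ^ β := by nlinarith
  calc ψ q ^ m ≤ ENNReal.ofReal (A * q ^ β) ^ m := by gcongr
    _ = ENNReal.ofReal ((A * q ^ β) ^ m) := (ENNReal.ofReal_pow (by linarith) m).symm
    _ ≤ ENNReal.ofReal ((A * q ^ β) ^ N) :=
        ENNReal.ofReal_le_ofReal (pow_le_pow_right₀ h2 hm)
    _ = _ := by
        rw [mul_pow, Real.rpow_mul (by linarith), Real.rpow_natCast]

lemma mul_rpow_le_rpow_add_one {β q : ℝ} (N : ℕ) (hq : 1 ≤ q) :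
    q * q ^ (β * N) = q ^ (β * N + 1) := by
  rw [Real.rpow_add_one (by linarith), mul_comm]

/-- The factor in the bound of `errorMoment` by a power. -/
noncomputable def errorGrowthConst (r : ℕ → ℝ) (F D A : ℝ) (N : ℕ) : ℝ :=
  1 + (∑ m ∈ Finset.Icc 1 N, errorWeight r F D N m) * A ^ N

lemma one_le_errorGrowthConst {r : ℕ → ℝ} {F D A : ℝ} {N : ℕ} (hF : 0 ≤ F) (hD : 0 ≤ D)
    (hA : 1 ≤ A) : 1 ≤ errorGrowthConst r F D A N := by
  have h1 : 0 ≤ ∑ m ∈ Finset.Icc 1 N, errorWeight r F D N m :=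
    Finset.sum_nonneg fun m _ => errorWeight_nonneg hF hD N m
  have : 0 ≤ (∑ m ∈ Finset.Icc 1 N, errorWeight r F D N m) * A ^ N := by positivity
  unfold errorGrowthConst
  linarith

/-- Replacing `√q` by `q` produces the exponent `β̃ = βN + 1`. Since `A q^β ≥ 1`, lower powers of
`ψ` are absorbed without a lower bound for `ψ`. -/
lemma errorMoment_le_rpow {ψ : ℝ → ℝ≥0∞} {r : ℕ → ℝ} {F D A β q : ℝ} {N : ℕ} (hF : 0 ≤ F)
    (hD : 0 ≤ D) (hA : 1 ≤ A) (hβ : 0 ≤ β) (hq : 1 ≤ q)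
    (h : ψ q ≤ ENNReal.ofReal (A * q ^ β)) :
    errorMoment r F D N ψ q ≤
      ENNReal.ofReal (errorGrowthConst r F D A N * q ^ (β * N + 1)) := by
  have hw := fun m => errorWeight_nonneg (r := r) hF hD N m
  have hs : 0 ≤ ∑ m ∈ Finset.Icc 1 N, errorWeight r F D N m := Finset.sum_nonneg fun m _ => hw m
  have hsq : √q ≤ q := by
    rw [Real.sqrt_le_left (by linarith)]; nlinarith
  calc errorMoment r F D N ψ q ≤ ENNReal.ofReal q * ∑ m ∈ Finset.Icc 1 N,
        ENNReal.ofReal (errorWeight r F D N m) * ENNReal.ofReal (A ^ N * q ^ (β * N)) := by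
        refine mul_le_mul' (ENNReal.ofReal_le_ofReal hsq) (Finset.sum_le_sum fun m hm => ?_)
        exact mul_le_mul' le_rfl (psi_pow_le hA hβ hq (Finset.mem_Icc.1 hm).2 h)
    _ = ENNReal.ofReal ((∑ m ∈ Finset.Icc 1 N, errorWeight r F D N m) * A ^ N *
          q ^ (β * N + 1)) := by
        rw [← Finset.sum_mul, ← ENNReal.ofReal_sum_of_nonneg fun m _ => hw m,
          ← ENNReal.ofReal_mul hs, ← ENNReal.ofReal_mul (by linarith),
          ← mul_rpow_le_rpow_add_one N hq]
        congr 1; ring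
    _ ≤ _ := by
        apply ENNReal.ofReal_le_ofReal
        gcongr
        unfold errorGrowthConst
        linarith

/-- The integral `∫_0^1 x^{-s} dx`. -/
noncomputable def powerIntegral (s : ℝ) : ℝ≥0∞ := ∫⁻ x in Ioc (0 : ℝ) 1, ENNReal.ofReal (x ^ (-s))

lemma powerIntegral_lt_top {s : ℝ} (hs : s < 1) : powerIntegral s < ∞ := by
  have h := (intervalIntegral.intervalIntegrable_rpow' (a := 0) (b := 1) (r := -s) (by linarith)).1
  exact h.lintegral_lt_top

variable {T : Type u} [PseudoMetricSpace T] [CompactSpace T]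

lemma rpow_scale {p a x γ b : ℝ} (hp : 0 ≤ p) (ha : 0 ≤ a) (hx : 0 < x) :
    (p * a * x ^ (-(1 / γ))) ^ b = (p * a) ^ b * x ^ (-(b / γ)) := by
  rw [Real.mul_rpow (by positivity) (by positivity), ← Real.rpow_mul hx.le]
  congr 2; ring

lemma le_scaled_exponent {p a x γ : ℝ} (hp : 0 ≤ p) (ha : 1 ≤ a) (hx : 0 < x) (hx1 : x ≤ 1)
    (hγ : 0 < γ) : p ≤ p * a * x ^ (-(1 / γ)) := by
  have h1 : 1 ≤ x ^ (-(1 / γ)) := by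
    apply Real.one_le_rpow_of_pos_of_le_one_of_nonpos hx hx1
    have : 0 < 1 / γ := by positivity
    linarith
  have : 1 ≤ a * x ^ (-(1 / γ)) := by nlinarith
  nlinarith

/-- The entropy integral when the entropy grows like `x^{-1/γ}` and the moments like a power. -/
lemma lintegral_chainBound_le [Nonempty T] {ρ : ℝ → ℝ≥0∞} {B a b γ p : ℝ} (hγ : 0 < γ)
    (hp : 1 ≤ p) (hB : 0 ≤ B) (ha : 1 ≤ a)
    (hH : ∀ x, 0 < x → x ≤ 1 → Real.log (coverCard T x) ≤ a * x ^ (-(1 / γ)))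
    (hρ : ∀ q, p ≤ q → ρ q ≤ ENNReal.ofReal (B * q ^ b)) :
    ∫⁻ x in Ioc (0 : ℝ) 1, chainBound T ρ p x ≤
      ENNReal.ofReal (Real.exp 1 * B * (p * a) ^ b) * powerIntegral (b / γ) := by
  rw [powerIntegral, ← lintegral_const_mul' _ _ ENNReal.ofReal_ne_top]
  refine setLIntegral_mono' measurableSet_Ioc fun x hx => ?_
  -- This exponent is at least `p` and at least the entropy at scale `x`, so the covering number
  -- contributes at most `e`.
  set q := p * a * x ^ (-(1 / γ)) with hq
  have hpq : p ≤ q := le_scaled_exponent (by linarith) ha hx.1 hx.2 hγ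
  have haq : Real.log (coverCard T x) ≤ q := by
    refine (hH x hx.1 hx.2).trans ?_
    rw [hq, mul_assoc]
    have : 0 ≤ a * x ^ (-(1 / γ)) := mul_nonneg (by linarith) (Real.rpow_nonneg hx.1.le _)
    nlinarith
  refine (iInf₂_le q hpq).trans ?_
  refine (mul_le_mul' (natCast_rpow_one_div_le_exp_one (one_le_coverCard hx.1) (by linarith) haq)
    (hρ q hpq)).trans (le_of_eq ?_)
  rw [← ENNReal.ofReal_mul (Real.exp_pos _).le, ← ENNReal.ofReal_mul (by positivity), hq,
    rpow_scale (by linarith) (by linarith) hx.1]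
  congr 1; ring

/-- The choice `y = 1/q` with `q` above the entropy bounds `N^y` by `e`. Since `q ≥ 2`, `log (1 + q)
≥ 1` and the logarithm can be dropped. -/
lemma exp_vHat_le_of_moment_growth [Nonempty T] {ψ : ℝ → ℝ≥0∞} {A β q x : ℝ} {N : ℕ} (hA : 1 ≤ A)
    (hβ : 0 ≤ β) (hq : 2 ≤ q) (hx : 0 < x) (hH : Real.log (coverCard T x) ≤ q)
    (hψ : ψ q ≤ ENNReal.ofReal (A * q ^ β)) :
    EReal.exp (vHat ψ N (entropy T x)) ≤
      ENNReal.ofReal (Real.exp 1 * A ^ N * q ^ (β * N + 1)) := by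
  have hcard := one_le_coverCard (T := T) hx
  have hq0 : 0 < q := by linarith
  have hlog : 1 ≤ Real.log (1 + q) := by
    rw [Real.le_log_iff_exp_le (by linarith)]
    linarith [Real.exp_one_lt_d9]
  rw [entropy, ← coverCard, exp_vHat _ _ _ hcard]
  refine (iInf₂_le (1 / q) ⟨⟨by positivity, by rw [div_lt_one hq0]; linarith⟩, ?_⟩).trans ?_
  · rw [div_ofReal_eq_logMoment ψ N (by positivity), one_div_one_div, logMoment]
    calc _ ≤ ENNReal.ofReal (Real.exp 1) * (ENNReal.ofReal q *
          ENNReal.ofReal (A ^ N * q ^ (β * N))) := by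
          refine mul_le_mul' (natCast_rpow_one_div_le_exp_one hcard hq0 hH) (mul_le_mul'
            (ENNReal.ofReal_le_ofReal (div_le_self hq0.le hlog))
            (psi_pow_le hA hβ (by linarith) le_rfl hψ))
      _ = _ := by
          rw [← ENNReal.ofReal_mul hq0.le, ← ENNReal.ofReal_mul (Real.exp_pos _).le,
            ← mul_rpow_le_rpow_add_one N (by linarith)]
          congr 1; ring
  · rw [one_div_one_div]; exact hψ.trans_lt ENNReal.ofReal_lt_top

lemma IHat_lt_top_of_growth [Nonempty T] [MeasurableSpace T] {μ : Measure T} {K : T → T → ℝ}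
    {A β a γ : ℝ} {N : ℕ} (hA : 1 ≤ A) (hβ : 0 ≤ β) (ha : 1 ≤ a) (hγ : β * N + 1 < γ)
    (hH : ∀ x, 0 < x → x ≤ 1 → Real.log (coverCard T x) ≤ a * x ^ (-(1 / γ)))
    (hψ : ∀ q, 1 ≤ q → psiR μ K q ≤ ENNReal.ofReal (A * q ^ β)) : IHat μ K N < ∞ := by
  have hβN : 0 ≤ β * N := by positivity
  have hγ0 : 0 < γ := by linarith
  refine lt_of_le_of_lt (b := ENNReal.ofReal (Real.exp 1 * A ^ N * (2 * a) ^ (β * N + 1)) *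
    powerIntegral ((β * N + 1) / γ)) ?_ (ENNReal.mul_lt_top ENNReal.ofReal_lt_top
      (powerIntegral_lt_top (by rwa [div_lt_one hγ0])))
  rw [powerIntegral, ← lintegral_const_mul' _ _ ENNReal.ofReal_ne_top]
  refine setLIntegral_mono' measurableSet_Ioc fun x hx => ?_
  -- The factor `2` keeps `q ≥ 2`, so that `y = 1/q` lies below `1`.
  have h2 : 2 ≤ 2 * a * x ^ (-(1 / γ)) := le_scaled_exponent zero_le_two ha hx.1 hx.2 hγ0
  refine (exp_vHat_le_of_moment_growth hA hβ h2 hx.1 ?_ (hψ _ (by linarith))).trans (le_of_eq ?_)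
  · refine (hH x hx.1 hx.2).trans ?_
    have : 0 ≤ a * x ^ (-(1 / γ)) := mul_nonneg (by linarith) (Real.rpow_nonneg hx.1.le _)
    nlinarith
  · rw [← ENNReal.ofReal_mul (by positivity), rpow_scale zero_le_two (by linarith) hx.1]
    congr 1; ring

/-- Optimization of the bounds `(C p^b / u)^p` over `p ≥ 2`. -/
lemma le_exp_of_forall_moment_le {Q : ℝ≥0∞} {C b u : ℝ} (hC : 0 < C) (hb : 0 < b) (hu : 0 < u)
    (hu2 : Real.exp 1 * C * 2 ^ b ≤ u)
    (h : ∀ p, 2 ≤ p → Q ≤ ENNReal.ofReal (C * p ^ b / u) ^ p) :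
    Q ≤ ENNReal.ofReal (Real.exp (-(Real.exp 1 * C) ^ (-(1 / b)) * u ^ (1 / b))) := by
  have hE : 0 < Real.exp 1 * C := by positivity
  -- With this `p` the base `C p^b / u` equals `1/e`; the lower bound on `u` says that `p ≥ 2`.
  set p := (u / (Real.exp 1 * C)) ^ (1 / b) with hp
  have hp0 : 0 < p := by positivity
  have hpb : p ^ b = u / (Real.exp 1 * C) := by
    rw [hp, ← Real.rpow_mul (by positivity), one_div_mul_cancel hb.ne', Real.rpow_one]
  have hp2 : 2 ≤ p := by
    rw [← Real.rpow_le_rpow_iff zero_le_two hp0.le hb, hpb, le_div_iff₀ hE]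
    linarith
  have h1 : C * p ^ b / u = Real.exp (-1) := by
    rw [hpb, Real.exp_neg]; field_simp
  refine (h p hp2).trans (le_of_eq ?_)
  rw [h1, ENNReal.ofReal_rpow_of_pos (Real.exp_pos _), ← Real.exp_mul]
  congr 2
  rw [hp, Real.div_rpow hu.le hE.le, Real.rpow_neg hE.le]
  ring

variable [MeasurableSpace T] [OpensMeasurableSpace T]
  {μ : Measure T} [IsProbabilityMeasure μ] {K : T → T → ℝ} {f : T → ℝ}
  {Ω : Type v} [MeasurableSpace Ω] {P : Measure Ω} [IsProbabilityMeasure P]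
  {ξ : ℕ → ℕ → ℕ → Ω → T}

/-- The constant in the tail bound under power growth of the moments and of the entropy. -/
noncomputable def tailConst (r : ℕ → ℝ) (F D A a b γ : ℝ) (N : ℕ) : ℝ :=
  5 * (Real.exp 1 * errorGrowthConst r F D A N * a ^ b) * (1 + (powerIntegral (b / γ)).toReal)

lemma tailConst_pos {r : ℕ → ℝ} {F D A a b γ : ℝ} {N : ℕ} (hF : 0 ≤ F) (hD : 0 ≤ D) (hA : 1 ≤ A)
    (ha : 1 ≤ a) : 0 < tailConst r F D A a b γ N := by
  have h1 := one_le_errorGrowthConst (r := r) (N := N) hF hD hA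
  have h2 : 0 ≤ (powerIntegral (b / γ)).toReal := ENNReal.toReal_nonneg
  unfold tailConst
  positivity

/-- The chaining bound is used directly rather than through the general estimate, whose constant
involves a lower bound for `ψ_R(1)`. -/
lemma Qbar_le_rpow_of_growth [Nonempty T] {r : ℕ → ℝ} {F D A a β γ : ℝ} {N : ℕ}
    (h : Setting μ K f) (hξ : IsSample μ P ξ) (hF0 : 0 ≤ F) (hD0 : 0 ≤ D) (hF : ∀ t, |f t| ≤ F)
    (hD : ∀ t s : T, dist t s ≤ D) (hr : ∀ m ∈ Finset.Icc 1 N, rU μ K m = r m)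
    (hA : 1 ≤ A) (hβ : 0 ≤ β) (ha : 1 ≤ a) (hγ : β * N + 1 < γ)
    (hH : ∀ x, 0 < x → x ≤ 1 → Real.log (coverCard T x) ≤ a * x ^ (-(1 / γ)))
    (hψ : ∀ q, 1 ≤ q → psiR μ K q ≤ ENNReal.ofReal (A * q ^ β)) {u p : ℝ} (hu : 0 < u)
    (hp : 2 ≤ p) :
    Qbar μ K f P ξ N u ≤
      ENNReal.ofReal (tailConst r F D A a (β * N + 1) γ N * p ^ (β * N + 1) / u) ^ p := by
  have hβN : 0 ≤ β * N := by positivity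
  have hγ0 : 0 < γ := by linarith
  have hB := one_le_errorGrowthConst (r := r) (N := N) hF0 hD0 hA
  have hJ := powerIntegral_lt_top (s := (β * N + 1) / γ) (by rwa [div_lt_one hγ0])
  refine (Qbar_le_chainBound h hD hF hξ hr hp hu).trans ?_
  refine ENNReal.rpow_le_rpow ?_ (by linarith)
  rw [ENNReal.ofReal_div_of_pos hu]
  gcongr
  have h1 := lintegral_chainBound_le (T := T) (ρ := errorMoment r F D N (psiR μ K)) (p := p) hγ0
    (by linarith) (by linarith : 0 ≤ errorGrowthConst r F D A N) ha hH
    (fun q hq => errorMoment_le_rpow hF0 hD0 hA hβ (by linarith) (hψ q (by linarith)))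
  refine (mul_le_mul' le_rfl h1).trans ?_
  rw [← ENNReal.ofReal_toReal hJ.ne, ← ENNReal.ofReal_mul (by positivity),
    ← ENNReal.ofReal_ofNat, ← ENNReal.ofReal_mul (by norm_num)]
  apply ENNReal.ofReal_le_ofReal
  rw [tailConst, Real.mul_rpow (by linarith) (by linarith)]
  have h2 : 0 ≤ 5 * (Real.exp 1 * errorGrowthConst r F D A N * a ^ (β * N + 1)) *
      p ^ (β * N + 1) := by positivity
  nlinarith

end LogExample

end FredholmMC

/-! ### The theorem -/

theorem theorem6p2 :
    -- The general bound. The constant `C` is chosen before the space, the measure, the kernel,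
    -- the free term, `ε`, the samples and `u`.
    (∀ (C₀ F D κ : ℝ) (N : ℕ) (r : ℕ → ℝ), 0 < C₀ → 0 < κ →
      ∃ C : ℝ, 0 < C ∧
        ∀ (T : Type u) [PseudoMetricSpace T] [CompactSpace T] [MeasurableSpace T]
          [OpensMeasurableSpace T] (μ : Measure T) [IsProbabilityMeasure μ]
          (K : T → T → ℝ) (f : T → ℝ) (ε : ℝ)
          (Ω : Type v) [MeasurableSpace Ω] (P : Measure Ω) [IsProbabilityMeasure P]
          (ξ : ℕ → ℕ → ℕ → Ω → T),
          FredholmMC.Setting μ K f →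
          0 < ε → ε < 1 → FredholmMC.neumannTail μ K f N < ENNReal.ofReal ε →
          FredholmMC.IsSample μ P ξ →
          (∀ t, |f t| ≤ F) → (∀ t s : T, dist t s ≤ D) →
          ENNReal.ofReal κ ≤ FredholmMC.psiR μ K 1 →
          (∀ m ∈ Finset.Icc 1 N, FredholmMC.rU μ K m = r m) →
          FredholmMC.IHat μ K N < ∞ →
          ∀ u : ℝ, 0 < u →
            FredholmMC.Qbar μ K f P ξ N u ≤
              EReal.exp (-FredholmMC.wStar (FredholmMC.psiN C₀ (FredholmMC.psiR μ K) N)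
                (Real.log (C⁻¹ * u / (1 + (FredholmMC.IHat μ K N).toReal))))) ∧
    -- The example.
    (∀ (C₂ C₃ β γ F L : ℝ) (k N : ℕ) (r : ℕ → ℝ), 0 < C₂ → 0 < C₃ → 0 ≤ β → β * N + 1 < γ →
      ∃ C₄ u₀ : ℝ, 0 < C₄ ∧ 1 ≤ u₀ ∧
        ∀ (T : Type u) [PseudoMetricSpace T] [CompactSpace T] [MeasurableSpace T]
          [OpensMeasurableSpace T] (μ : Measure T) [IsProbabilityMeasure μ]
          (K : T → T → ℝ) (f : T → ℝ) (ε : ℝ)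
          (Ω : Type v) [MeasurableSpace Ω] (P : Measure Ω) [IsProbabilityMeasure P]
          (ξ : ℕ → ℕ → ℕ → Ω → T) (ι : T → EuclideanSpace ℝ (Fin k)),
          FredholmMC.Setting μ K f →
          0 < ε → ε < 1 → FredholmMC.neumannTail μ K f N < ENNReal.ofReal ε →
          FredholmMC.IsSample μ P ξ →
          (∀ t, |f t| ≤ F) →
          (∀ m ∈ Finset.Icc 1 N, FredholmMC.rU μ K m = r m) →
          Function.Injective ι → (∀ t, ‖ι t‖ ≤ L) →
          FredholmMC.EnvelopeTail μ K β C₂ →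
          FredholmMC.LogModulus μ K ι γ C₃ →
          FredholmMC.IHat μ K N < ∞ ∧
          ∀ u : ℝ, u₀ ≤ u →
            FredholmMC.Qbar μ K f P ξ N u ≤
              ENNReal.ofReal (Real.exp (-C₄ * u ^ (1 / (β * N + 1))))) := by
  refine ⟨?_, ?_⟩
  · intro C₀ F D κ N r hC₀ hκ
    have hB := FredholmMC.errorConst_pos (r := r) (N := N) (abs_nonneg F) (abs_nonneg D) hκ
    -- Absolute values are taken because `F` and `D` are arbitrary reals at the point where `C` is
    -- chosen.
    refine ⟨5 * (FredholmMC.errorConst r |F| |D| κ N * (κ ^ N)⁻¹) * C₀, by positivity, ?_⟩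
    intro T _ _ _ _ μ _ K f ε Ω _ P _ ξ h _ _ _ hξ hF hD hψ hr hI u hu
    exact FredholmMC.Qbar_le_exp_neg_wStar hC₀ hκ (abs_nonneg F) (abs_nonneg D) h hξ
      (fun t => (hF t).trans (le_abs_self F)) (fun t s => (hD t s).trans (le_abs_self D)) hψ hr hI
      hu
  · intro C₂ C₃ β γ F L k N r hC₂ hC₃ hβ hγ
    have hβN : 0 ≤ β * N := by positivity
    have hA := FredholmMC.one_le_momentConst hβ hC₂
    have ha := FredholmMC.one_le_entropyConst (γ := γ) (L := L) k hC₃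
    -- `C₃` serves as the bound for the diameter, since the minimum in the modulus is at most `1`.
    set C := FredholmMC.tailConst r |F| C₃ (FredholmMC.momentConst β C₂)
      (FredholmMC.entropyConst C₃ γ L k) (β * N + 1) γ N with hC
    have hCpos : 0 < C := FredholmMC.tailConst_pos (abs_nonneg F) hC₃.le hA ha
    refine ⟨(Real.exp 1 * C) ^ (-(1 / (β * N + 1))),
      max 1 (Real.exp 1 * C * 2 ^ (β * N + 1)), by positivity, le_max_left _ _, ?_⟩
    intro T _ _ _ _ μ _ K f ε Ω _ P _ ξ ι h _ _ _ hξ hF hr hι hL htail hmod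
    have := FredholmMC.nonempty_of_isProbabilityMeasure μ
    have hH : ∀ x, 0 < x → x ≤ 1 → Real.log (FredholmMC.coverCard T x) ≤
        FredholmMC.entropyConst C₃ γ L k * x ^ (-(1 / γ)) := fun x hx hx1 =>
      h.log_coverCard_le hC₃ (by linarith) hmod hι hL hx hx1
    have hψ := fun q (hq : 1 ≤ q) => FredholmMC.psiR_le_of_envelopeTail h.measurable_kernel
      h.envelope_lt_top hC₂ htail hq
    refine ⟨FredholmMC.IHat_lt_top_of_growth hA hβ ha hγ hH hψ, fun u hu => ?_⟩
    have hu0 : 0 < u := one_pos.trans_le ((le_max_left _ _).trans hu)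
    exact FredholmMC.le_exp_of_forall_moment_le hCpos (by linarith) hu0
      ((le_max_right _ _).trans hu) fun p hp =>
        FredholmMC.Qbar_le_rpow_of_growth h hξ (abs_nonneg F) hC₃.le
          (fun t => (hF t).trans (le_abs_self F)) (h.dist_le_of_logModulus hC₃ hmod) hr hA hβ ha hγ
          hH hψ hu0 hp
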